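/- Let $n\ge 0$ and consider $n$ parties, each holding one bosonic mode with Hilbert space $L^2(\mathbb R)$, so that the total Hilbert space is $\mathcal H_n=L^2(\mathbb R)^{\otimes n}=L^2(\mathbb R^n)$. Let $r=(x_1,p_1,\dots,x_n,p_n)^{\intercal}$ be the vector of position and momentum operators ($p_j=-i\partial_j$), so that $[r,r^\intercal]=i\Omega$ with $\Omega=\begin{pmatrix}0&1\\-1&0\end{pmatrix}^{\oplus n}$. Let $S$ be an arbitrary real $2n\times 2n$ symplectic matrix, i.e. $S\Omega S^{\intercal}=\Omega$, and let $U_S$ be the corresponding Gaussian unitary on $\mathcal H_n$, i.e. a unitary (unique up to a phase) with $U_S^\dagger\, r_i\, U_S=\sum_k S_{ik}r_k$ for all $i$. For $\lambda>0$ let $\mathcal E_\lambda$ be the ensemble of coherent states $|\alpha\rangle=|\alpha_1\rangle\otimes\cdots\otimes|\alpha_n\rangle$, $\alpha\in\mathbb C^n$, with probability density $p_\lambda(\alpha)=(\lambda/\pi)^n e^{-\lambda\sum_j|\alpha_j|^2}$, where $|\alpha_j\rangle=e^{-|\alpha_j|^2/2}\sum_{k\ge 0}\frac{\alpha_j^k}{\sqrt{k!}}|k\rangle$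 in terms of the Fock states $|k\rangle$. Define the classical (LOCC) simulation fidelity $$F_{c\ell}(\mathcal E_\lambda,U_S)=\sup_{\Lambda}\int_{\mathbb C^n}p_\lambda(\alpha)\,\langle\alpha|U_S^\dagger\,\Lambda(|\alpha\rangle\langle\alpha|)\,U_S|\alpha\rangle\,d^{2n}\alpha ,$$ where $\Lambda$ ranges over the quantum channels on $\mathcal H_n$ that the $n$ parties can implement (exactly or as a limit) by local operations and classical communication. For $J\subseteq[n]=\{1,\dots,n\}$ let $$\Omega_J=\bigoplus_{j\in J}\begin{pmatrix}0&1\\-1&0\end{pmatrix}\oplus\bigoplus_{k\in [n]\setminus J}\begin{pmatrix}0&-1\\1&0\end{pmatrix}$$ (each block acting on the mode with the same label), and let $z_1(\lambda,S,J),\dots,z_{2n}(\lambda,S,J)$ be the eigenvalues, with multiplicity, of the Hermitian matrix $(1+\lambda)S^{-1}\,i\Omega_J\,S^{-\intercal}-i\Omega_J$. Then $$F_{c\ell}(\mathcal E_\lambda,U_S)\le\min_{J\subseteq[n]}\frac{2^n(1+\lambda)^n}{\prod_{\ell=1}^{2n}\sqrt{2+\lambda+|z_\ell(\lambda,S,J)|}}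 .$$ Moreover, if $n\ge 2$, the minimum on the right-hand side does not change when it is restricted to the subsets $J$ with $1\le|J|\le\lfloor n/2\rfloor$. -/

import Mathlib

open MeasureTheory SchwartzMap
open scoped ENNReal Matrix

noncomputable section

namespace GaussLOCC

/-! ### Hilbert spaces of one and of `n` modes -/

/-- The Hilbert space `L²(ℝ)` of one mode. -/
abbrev Mode : Type := Lp ℂ 2 (volume : Measure ℝ)

/-- The Hilbert space `L²(ℝⁿ)` of `n` modes. -/
abbrev Modes (n : ℕ) : Type := Lp ℂ 2 (volume : Measure (Fin n → ℝ))

theorem memLp_tensor {n : ℕ} (f : Fin n → Mode) :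
    MemLp (fun q : Fin n → ℝ => ∏ j, (f j : ℝ → ℂ) (q j)) 2 volume := by
  have hm : AEStronglyMeasurable (fun q : Fin n → ℝ => ∏ j, (f j : ℝ → ℂ) (q j)) volume := by
    refine Finset.aestronglyMeasurable_fun_prod _ fun j _ => ?_
    exact (Lp.aestronglyMeasurable (f j)).comp_quasiMeasurePreserving
      (Measure.quasiMeasurePreserving_eval (fun _ : Fin n => (volume : Measure ℝ)) j)
  rw [memLp_two_iff_integrable_sq_norm hm]
  have h : ∀ j, Integrable (fun x : ℝ => ‖(f j : ℝ → ℂ) x‖ ^ 2) volume := fun j =>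
    (memLp_two_iff_integrable_sq_norm (Lp.aestronglyMeasurable (f j))).1 (Lp.memLp (f j))
  have := Integrable.fintype_prod h
  rw [← volume_pi] at this
  simpa [norm_prod, Finset.prod_pow] using this

/-- The product vector `f₁ ⊗ ⋯ ⊗ fₙ` in `L²(ℝ) ⊗ ⋯ ⊗ L²(ℝ) = L²(ℝⁿ)`. -/
def tensor {n : ℕ} (f : Fin n → Mode) : Modes n := (memLp_tensor f).toLp

/-- `K` is the product operator `A₁ ⊗ ⋯ ⊗ Aₙ`. -/
def IsTensorOp {n : ℕ} (A : Fin n → (Mode →L[ℂ] Mode)) (K : Modes n →L[ℂ] Modes n) : Prop :=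
  ∀ f : Fin n → Mode, K (tensor f) = tensor fun j => A j (f j)

/-! ### Canonical operators and Gaussian unitaries -/

/-- The canonical operators on Schwartz functions: index `(0, j)` is the position operator `x_j`,
index `(1, j)` the momentum operator `p_j = -i ∂_j`. -/
def canonicalOp {n : ℕ} (i : Fin 2 × Fin n) (φ : 𝓢(Fin n → ℝ, ℂ)) : 𝓢(Fin n → ℝ, ℂ) :=
  if i.1 = 0 then SchwartzMap.smulLeftCLM ℂ (fun q : Fin n → ℝ => (q i.2 : ℂ)) φ
  else (-Complex.I) • LineDeriv.lineDerivOp (Pi.single i.2 (1 : ℝ) : Fin n → ℝ) φ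

/-- The matrix `Ω_J`: the direct sum over the modes of `[[0, 1], [-1, 0]]` for `j ∈ J` and of its
negative for `j ∉ J`. -/
def omegaJ {n : ℕ} (J : Finset (Fin n)) : Matrix (Fin 2 × Fin n) (Fin 2 × Fin n) ℝ :=
  Matrix.blockDiagonal fun j => if j ∈ J then !![0, 1; -1, 0] else !![0, -1; 1, 0]

/-- The standard symplectic form `Ω`, the direct sum over the modes of `[[0, 1], [-1, 0]]`. -/
def omega (n : ℕ) : Matrix (Fin 2 × Fin n) (Fin 2 × Fin n) ℝ :=
  Matrix.blockDiagonal fun _ => !![0, 1; -1, 0]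

/-- `S` is symplectic: `S Ω Sᵀ = Ω`. -/
def IsSymplectic {n : ℕ} (S : Matrix (Fin 2 × Fin n) (Fin 2 × Fin n) ℝ) : Prop :=
  S * omega n * Sᵀ = omega n

/-- `U` is a Gaussian unitary with symplectic matrix `S`, i.e. `U† r_i U = ∑ₖ S_{ik} r_k`, read as
`r_i U ψ = U ∑ₖ S_{ik} r_k ψ` for every Schwartz function `ψ`. As `U ψ` is only known to lie in
`L²(ℝⁿ)`, the left-hand side is tested against Schwartz functions `φ`: this says that `U ψ` lies in
the domain of the adjoint of the canonical operator on Schwartz functions, which is its self-adjoint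
closure, and gives the value of that closure there. -/
def IsGaussianUnitary {n : ℕ} (S : Matrix (Fin 2 × Fin n) (Fin 2 × Fin n) ℝ)
    (U : Modes n ≃ₗᵢ[ℂ] Modes n) : Prop :=
  ∀ (i : Fin 2 × Fin n) (φ ψ : 𝓢(Fin n → ℝ, ℂ)),
    inner ℂ ((canonicalOp i φ).toLp 2 volume) (U (ψ.toLp 2 volume)) =
      inner ℂ (φ.toLp 2 volume) (U ((∑ k, (S i k : ℂ) • canonicalOp k ψ).toLp 2 volume))

/-! ### Fock states and coherent states -/

/-- The creation operator `a† = (x - i p) / √2 = (x - d/dx) / √2` of one mode. -/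
def creation (f : ℝ → ℂ) : ℝ → ℂ := fun q => (q * f q - deriv f q) / (Real.sqrt 2 : ℂ)

/-- The normalised vacuum wave function. -/
def vacuumFun : ℝ → ℂ := fun q => ((Real.pi ^ (-(1 / 4) : ℝ) * Real.exp (-q ^ 2 / 2) : ℝ) : ℂ)

/-- The wave function of the Fock state `|k⟩ = (k!)^{-1/2} (a†)^k |0⟩`. -/
def fockFun (k : ℕ) : ℝ → ℂ := fun q => (creation^[k] vacuumFun) q / (Real.sqrt (k.factorial) : ℂ)

theorem creation_iterate_vacuum (k : ℕ) : ∃ p : Polynomial ℂ, ∀ q : ℝ,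
    (creation^[k] vacuumFun) q = p.eval (q : ℂ) * ((Real.exp (-q ^ 2 / 2) : ℝ) : ℂ) := by
  induction k with
  | zero =>
    refine ⟨Polynomial.C ((Real.pi ^ (-(1 / 4) : ℝ) : ℝ) : ℂ), fun q => ?_⟩
    simp only [Function.iterate_zero, id, vacuumFun, Polynomial.eval_C]
    push_cast
    rfl
  | succ k ih =>
    obtain ⟨p, hp⟩ := ih
    refine ⟨Polynomial.C ((Real.sqrt 2 : ℂ)⁻¹) *
      (2 * Polynomial.X * p - Polynomial.derivative p), fun q => ?_⟩
    rw [Function.iterate_succ_apply']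
    have hf : (creation^[k] vacuumFun) =
        fun q : ℝ => p.eval (q : ℂ) * ((Real.exp (-q ^ 2 / 2) : ℝ) : ℂ) := funext hp
    have h1 : HasDerivAt (fun q : ℝ => p.eval (q : ℂ)) (p.derivative.eval (q : ℂ)) q :=
      (p.hasDerivAt (q : ℂ)).comp_ofReal
    have h2 : HasDerivAt (fun q : ℝ => ((Real.exp (-q ^ 2 / 2) : ℝ) : ℂ))
        ((Real.exp (-q ^ 2 / 2) * (-q) : ℝ) : ℂ) q := by
      have h0 : HasDerivAt (fun q : ℝ => -q ^ 2 / 2) (-q) q := by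
        have := ((hasDerivAt_pow 2 q).neg).div_const 2
        refine this.congr_deriv ?_
        norm_num
        ring
      exact h0.exp.ofReal_comp
    simp only [creation, hf]
    rw [(h1.fun_mul h2).deriv]
    simp only [Polynomial.eval_mul, Polynomial.eval_C, Polynomial.eval_sub, Polynomial.eval_X,
      Polynomial.eval_ofNat]
    push_cast
    ring

theorem memLp_fockFun (k : ℕ) : MemLp (fockFun k) 2 volume := by
  obtain ⟨p, hp⟩ := creation_iterate_vacuum k
  have hmon : ∀ m : ℕ,
      MemLp (fun q : ℝ => (q : ℂ) ^ m * ((Real.exp (-q ^ 2 / 2) : ℝ) : ℂ)) 2 volume := by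
    intro m
    have hc : Continuous (fun q : ℝ => (q : ℂ) ^ m * ((Real.exp (-q ^ 2 / 2) : ℝ) : ℂ)) := by
      fun_prop
    rw [memLp_two_iff_integrable_sq_norm hc.aestronglyMeasurable]
    have h := integrable_rpow_mul_exp_neg_mul_sq (b := 1) one_pos (s := (2 * m : ℕ))
      (by have : (0 : ℝ) ≤ ((2 * m : ℕ) : ℝ) := Nat.cast_nonneg _
          linarith)
    refine h.congr (Filter.Eventually.of_forall fun q => ?_)
    simp only [Real.rpow_natCast, norm_mul, norm_pow, Complex.norm_real, Real.norm_eq_abs,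
      Real.abs_exp, mul_pow, ← pow_mul, ← Real.exp_nat_mul]
    rw [mul_comm m 2, pow_mul |q| 2 m, sq_abs, ← pow_mul]
    congr 2
    push_cast
    ring
  have heq : fockFun k = fun q : ℝ => ∑ m ∈ p.support,
      (p.coeff m / (Real.sqrt (k.factorial) : ℂ)) *
        ((q : ℂ) ^ m * ((Real.exp (-q ^ 2 / 2) : ℝ) : ℂ)) := by
    funext q
    simp only [fockFun, hp, Polynomial.eval_eq_sum, Polynomial.sum, Finset.sum_mul,
      Finset.sum_div]
    exact Finset.sum_congr rfl fun m _ => by ring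
  rw [heq]
  exact memLp_finsetSum _ fun m _ => (hmon m).const_mul _

/-- The Fock state `|k⟩`. -/
def fock (k : ℕ) : Mode := (memLp_fockFun k).toLp

/-- The one-mode coherent state `|α⟩ = e^{-|α|²/2} ∑ₖ α^k / √(k!) |k⟩`. -/
def coherentMode (α : ℂ) : Mode :=
  ((Real.exp (-‖α‖ ^ 2 / 2) : ℝ) : ℂ) •
    ∑' k : ℕ, (α ^ k / (Real.sqrt (k.factorial) : ℂ)) • fock k

/-- The coherent state `|α₁⟩ ⊗ ⋯ ⊗ |αₙ⟩`. -/
def coherent {n : ℕ} (α : Fin n → ℂ) : Modes n := tensor fun j => coherentMode (α j)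

/-- The Gaussian probability measure with density `(l/π)^n e^{-l ‖α‖²}` on `ℂⁿ`. -/
def gaussianEnsemble (n : ℕ) (l : ℝ) : Measure (Fin n → ℂ) :=
  volume.withDensity fun α =>
    ENNReal.ofReal ((l / Real.pi) ^ n * Real.exp (-l * ∑ j, ‖α j‖ ^ 2))

/-! ### Quantum channels and LOCC -/

/-- The operator `|ψ⟩⟨ψ|`. -/
def pureState {H : Type} [NormedAddCommGroup H] [InnerProductSpace ℂ H] (ψ : H) : H →L[ℂ] H :=
  (innerSL ℂ ψ).smulRight ψ

/-- A quantum channel on a Hilbert space, given by Kraus operators with `∑ Kᵢ† Kᵢ = 1`. -/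
structure Channel (H : Type) [NormedAddCommGroup H] [InnerProductSpace ℂ H] [CompleteSpace H] where
  kraus : ℕ → (H →L[ℂ] H)
  complete : ∀ ψ : H, HasSum (fun i => ‖kraus i ψ‖ ^ 2) (‖ψ‖ ^ 2)

/-- The action `ρ ↦ ∑ᵢ Kᵢ ρ Kᵢ†` of a channel on trace class operators (on which the series
converges). -/
def Channel.apply {H : Type} [NormedAddCommGroup H] [InnerProductSpace ℂ H] [CompleteSpace H]
    (L : Channel H) (ρ : H →L[ℂ] H) : H →L[ℂ] H :=
  ∑' i, (L.kraus i).comp (ρ.comp (ContinuousLinearMap.adjoint (L.kraus i)))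

/-- A complex Hilbert space, bundled. -/
structure HilbertSpace where
  carrier : Type
  [normed : NormedAddCommGroup carrier]
  [innerProduct : InnerProductSpace ℂ carrier]
  [complete : CompleteSpace carrier]

attribute [instance] HilbertSpace.normed HilbertSpace.innerProduct HilbertSpace.complete

/-- The Hilbert space `L²(ℝ)`, bundled. -/
def modeSpace : HilbertSpace := ⟨Mode⟩

/-- A protocol of local operations and classical communication for `n` parties whose local systems
are `H₁, …, Hₙ` at the start and `H'₁, …, H'ₙ` at the end. In a round, party `j` measures its own
system with Kraus operators `M j x : H j → K j`, where `∑ₓ (M j x)† (M j x) = 1`; here `K j` is an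
arbitrary Hilbert space, so that ancillas can be added and discarded. All outcomes `x j` are then
broadcast, and the rest of the protocol may depend on them. Coarser local instruments, local
channels, local randomness and idle parties are special cases, because later operations may ignore
outcomes. Every branch of the protocol has finitely many rounds. -/
inductive Protocol {n : ℕ} : (Fin n → HilbertSpace) → (Fin n → HilbertSpace) → Type 1
  | done (H : Fin n → HilbertSpace) : Protocol H H
  | round {H K H' : Fin n → HilbertSpace}
      (M : ∀ j, ℕ → ((H j).carrier →L[ℂ] (K j).carrier))
      (complete : ∀ j (v : (H j).carrier), HasSum (fun x => ‖M j x v‖ ^ 2) (‖v‖ ^ 2))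
      (next : (Fin n → ℕ) → Protocol K H') : Protocol H H'

/-- The branches of a protocol: the complete records of outcomes. -/
def Protocol.Branch {n : ℕ} {H H' : Fin n → HilbertSpace} : Protocol H H' → Type
  | .done _ => Unit
  | .round _ _ next => Σ x, (next x).Branch

/-- The local Kraus operators that the parties have applied along a branch. -/
def Protocol.localOp {n : ℕ} {H H' : Fin n → HilbertSpace} :
    (P : Protocol H H') → P.Branch → ∀ j, (H j).carrier →L[ℂ] (H' j).carrier
  | .done _ => fun _ _ => ContinuousLinearMap.id ℂ _
  | .round M _ next => fun (b : Σ x, (next x).Branch) j =>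
      ((next b.1).localOp b.2 j).comp (M j (b.1 j))

/-- `L` is the channel implemented by the protocol `P` on `n` modes, one for each party:
`L(|ψ⟩⟨ψ|) = ∑_b K_b |ψ⟩⟨ψ| K_b†`, where `K_b` is the tensor product of the local Kraus operators
of the branch `b`. -/
def IsImplementedBy {n : ℕ} (L : Channel (Modes n))
    (P : Protocol (fun _ : Fin n => modeSpace) (fun _ : Fin n => modeSpace)) : Prop :=
  ∃ K : P.Branch → (Modes n →L[ℂ] Modes n),
    (∀ b, IsTensorOp (P.localOp b) (K b)) ∧
    ∀ ψ, HasSum (fun b => pureState (K b ψ)) (L.apply (pureState ψ))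

/-- LOCC channels on `n` modes: channels implemented by protocols as above, and channels that are
limits `L_m(|ψ⟩⟨ψ|) → L(|ψ⟩⟨ψ|)` of such (weak convergence of states to a state is convergence in
trace norm). The limits bring in measurements with a continuum of outcomes, such as heterodyne
detection, and protocols with infinitely many rounds; they do not change the supremum in
`simulationFidelity`, in which the average fidelity is continuous in `L`. -/
def IsLOCC {n : ℕ} (L : Channel (Modes n)) : Prop :=
  ∃ (P : ℕ → Protocol (fun _ : Fin n => modeSpace) (fun _ : Fin n => modeSpace))
    (Lm : ℕ → Channel (Modes n)),
    (∀ m, IsImplementedBy (Lm m) (P m)) ∧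
    ∀ φ ψ : Modes n, Filter.Tendsto (fun m => inner ℂ φ ((Lm m).apply (pureState ψ) φ))
      Filter.atTop (nhds (inner ℂ φ (L.apply (pureState ψ) φ)))

/-- The LOCC (classical) simulation fidelity of the unitary `U` on the ensemble of pure states
`ψ a` with `a` distributed according to `μ`: the supremum over LOCC channels `L` of the average of
`Tr [L(|ψ⟩⟨ψ|) |Uψ⟩⟨Uψ|] = ⟨Uψ| L(|ψ⟩⟨ψ|) |Uψ⟩`. -/
def simulationFidelity {n : ℕ} {A : Type} [MeasurableSpace A] (μ : Measure A) (ψ : A → Modes n)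
    (U : Modes n ≃ₗᵢ[ℂ] Modes n) : ℝ≥0∞ :=
  ⨆ (L : Channel (Modes n)) (_ : IsLOCC L),
    ∫⁻ a, ENNReal.ofReal (inner ℂ (U (ψ a)) (L.apply (pureState (ψ a)) (U (ψ a)))).re ∂μ

/-! ### The upper bound -/

/-- The matrix `(1 + l) S⁻¹ (iΩ_J) S⁻ᵀ - iΩ_J`. -/
def zMatrix {n : ℕ} (l : ℝ) (S : Matrix (Fin 2 × Fin n) (Fin 2 × Fin n) ℝ) (J : Finset (Fin n)) :
    Matrix (Fin 2 × Fin n) (Fin 2 × Fin n) ℂ :=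
  ((1 + l : ℝ) : ℂ) • ((S⁻¹).map Complex.ofReal * (Complex.I • (omegaJ J).map Complex.ofReal) *
    ((S⁻¹)ᵀ).map Complex.ofReal) - Complex.I • (omegaJ J).map Complex.ofReal

theorem omegaJ_transpose {n : ℕ} (J : Finset (Fin n)) : (omegaJ J)ᵀ = -omegaJ J := by
  rw [omegaJ, Matrix.blockDiagonal_transpose, ← Matrix.blockDiagonal_neg]
  congr 1
  funext j
  by_cases h : j ∈ J <;> ext a b <;> fin_cases a <;> fin_cases b <;> simp [h]

theorem zMatrix_isHermitian {n : ℕ} (l : ℝ) (S : Matrix (Fin 2 × Fin n) (Fin 2 × Fin n) ℝ)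
    (J : Finset (Fin n)) : (zMatrix l S J).IsHermitian := by
  have hmap : ∀ A : Matrix (Fin 2 × Fin n) (Fin 2 × Fin n) ℝ,
      (A.map Complex.ofReal)ᴴ = Aᵀ.map Complex.ofReal := by
    intro A
    ext a b
    simp [Matrix.conjTranspose_apply]
  have hneg : ((-omegaJ J).map Complex.ofReal) = -((omegaJ J).map Complex.ofReal) := by
    ext a b
    simp
  simp only [Matrix.IsHermitian, zMatrix, Matrix.conjTranspose_sub, Matrix.conjTranspose_smul,
    Matrix.conjTranspose_mul, hmap, Matrix.transpose_transpose, omegaJ_transpose, hneg,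
    Complex.star_def, Complex.conj_ofReal, Complex.conj_I, neg_smul_neg, Matrix.mul_assoc]

/-- The bound `2ⁿ (1 + l)ⁿ / ∏_ℓ √(2 + l + |z_ℓ|)`, where the `z_ℓ` are the `2n` eigenvalues of
`(1 + l) S⁻¹ (iΩ_J) S⁻ᵀ - iΩ_J`, with multiplicity. -/
def bound {n : ℕ} (l : ℝ) (S : Matrix (Fin 2 × Fin n) (Fin 2 × Fin n) ℝ) (J : Finset (Fin n)) :
    ℝ :=
  2 ^ n * (1 + l) ^ n /
    ∏ k : Fin 2 × Fin n, Real.sqrt (2 + l + |(zMatrix_isHermitian l S J).eigenvalues k|)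

end GaussLOCC

end

open MeasureTheory SchwartzMap
open scoped ENNReal Matrix

noncomputable section

namespace GaussLOCC

section

/-! ### Eigenvalues of Hermitian matrices -/

section Eigenvalues

variable {ι : Type*} [Fintype ι] [DecidableEq ι]

/-! Along one branch of a protocol the parties apply a product operator K = A₁ ⊗ ⋯ ⊗ Aₙ. It suffices
to bound the averaged overlap ∫ p(α) |⟨Kα, Uα⟩|² dα by `bound l S J` times ∫ p(α) ‖Kα‖² dα. The last
integrals are the branch probabilities. They sum to 1, and limits of protocols follow by Fatou's
lemma.

For one branch, |⟨φ, α⟩|² is a Gaussian average over phase space of ⟨φ, W(ξ)φ⟩, with W the Weyl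
operators (`norm_inner_coherent_sq`). With φ = U⁻¹Kα, the relation U W(Sᵀξ) U⁻¹ = W(ξ)
(`IsGaussianUnitary.conj_weyl`) moves U out of the inner product. Since K, W and the coherent states
are all products, the α-integral becomes a product of one-mode kernels at (ξ_j, (S⁻ᵀξ)_j)
(`integral_norm_inner_sq`).

Each one-mode kernel, multiplied by e^{|ξ|²/(4(1+l))}, is positive definite up to a symplectic
phase: the output contributes the form σ, and the input ensemble contributes -σ/(1+l)
(`isTwistedPosDef_modeKernel`). This rests on the holomorphy of the unnormalised coherent vectors
and the reproducing formula of Fock space. The sign of the phase can be reversed in each mode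
separately, the analogue of a partial transposition; here locality enters. By Schur's product
theorem the product h of the kernels is therefore positive definite with respect to Z = S⁻¹Ω_J S⁻ᵀ -
Ω_J/(1+l), for every J (`isTwistedPosDef_prod_modeKernel`).

It remains to bound ∫ e^{-c|ξ|²} h(ξ) dξ by h(0) ∏ √(π/(c + ζ_k/4)), where the ζ_k are the singular
values of Z and c = (2+l)/(4(1+l)) (`IsTwistedPosDef.norm_gaussAvg_le_prod`). The Cauchy-Schwarz
inequality bounds the square of such an average by h(0) times another one, with c_k replaced by
c_k/2 + ζ_k²/(32c_k). The claimed bound satisfies this recursion with equality, so the ratio R of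
the two sides obeys R(c)² ≤ R(c'). As R is bounded along the iteration, R ≤ 1. Since the eigenvalues
have |z_k| = (1+l)ζ_k up to order, this is the stated bound.

For the restriction on J, complementation only changes the sign of the z_k, J = ∅ and J = [n] give
the value 1, and every J gives at most 1. -/

open Polynomial in
/-- The eigenvalues of a Hermitian matrix are determined, up to order, by a factorisation of its
characteristic polynomial. -/
theorem prod_eigenvalues_eq_of_charpoly_eq {𝕜 : Type*} [RCLike 𝕜] {A : Matrix ι ι 𝕜}
    (hA : A.IsHermitian) {d : ι → ℝ} (h : A.charpoly = ∏ i, (X - C (d i : 𝕜))) (f : ℝ → ℝ) :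
    ∏ i, f (hA.eigenvalues i) = ∏ i, f (d i) := by
  have h1 : A.charpoly.roots = Multiset.map (RCLike.ofReal ∘ d) Finset.univ.val := by
    rw [h, Polynomial.roots_prod]
    · simp
    · simp [Finset.prod_ne_zero_iff, Polynomial.X_sub_C_ne_zero]
  rw [hA.roots_charpoly_eq_eigenvalues] at h1
  have h2 := congrArg (Multiset.map (fun z : 𝕜 => f (RCLike.re z))) h1
  simp only [Multiset.map_map, Function.comp_def, RCLike.ofReal_re] at h2
  exact congrArg Multiset.prod h2

-- Mathlib's eigenvalues are sorted, so those of -A are not the negatives index by index; the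
-- characteristic polynomial carries the statement about multisets.
open Polynomial in
theorem charpoly_neg_eq {A : Matrix ι ι ℂ} (hA : A.IsHermitian) :
    (-A).charpoly = ∏ i, (X - C (((-hA.eigenvalues i : ℝ) : ℂ))) := by
  conv_lhs => rw [hA.spectral_theorem, Unitary.conjStarAlgAut_apply, ← Matrix.neg_mul,
    ← Matrix.mul_neg, Matrix.charpoly_mul_comm, ← mul_assoc]
  rw [Unitary.coe_star_mul_self, one_mul, Matrix.diagonal_neg]
  simp [Matrix.charpoly_diagonal]

open Polynomial in
theorem charpoly_mul_self_eq {A : Matrix ι ι ℂ} (hA : A.IsHermitian) :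
    (A * A).charpoly = ∏ i, (X - C (((hA.eigenvalues i ^ 2 : ℝ) : ℂ))) := by
  conv_lhs => rw [hA.spectral_theorem, ← map_mul, Unitary.conjStarAlgAut_apply,
    Matrix.charpoly_mul_comm, ← mul_assoc, Matrix.diagonal_mul_diagonal]
  simp [Matrix.charpoly_diagonal, ← sq]

/-- A product over the squared eigenvalues of `A`, evaluated through `A * A`. -/
theorem prod_sq_eigenvalues_eq {A : Matrix ι ι ℂ} (hA : A.IsHermitian) {d : ι → ℝ}
    (h : (A * A).charpoly = ∏ i, (Polynomial.X - Polynomial.C (d i : ℂ))) (f : ℝ → ℝ) :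
    ∏ i, f (hA.eigenvalues i ^ 2) = ∏ i, f (d i) := by
  have hAA : (A * A).IsHermitian := by
    rw [Matrix.IsHermitian, Matrix.conjTranspose_mul, hA]
  rw [← prod_eigenvalues_eq_of_charpoly_eq hAA h]
  exact (prod_eigenvalues_eq_of_charpoly_eq hAA (charpoly_mul_self_eq hA) f).symm

theorem inner_apply_self_eq_sum {n : ℕ} {E : Type*} [NormedAddCommGroup E]
    [InnerProductSpace ℂ E] [FiniteDimensional ℂ E] {T : E →ₗ[ℂ] E} (hT : T.IsSymmetric)
    (hn : Module.finrank ℂ E = n) (x : E) :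
    (inner ℂ x (T x)).re =
      ∑ i, hT.eigenvalues hn i * ‖inner ℂ (hT.eigenvectorBasis hn i) x‖ ^ 2 := by
  rw [← (hT.eigenvectorBasis hn).sum_inner_mul_inner x (T x), Complex.re_sum]
  refine Finset.sum_congr rfl fun i _ => ?_
  rw [← OrthonormalBasis.repr_apply_apply, hT.eigenvectorBasis_apply_self_apply hn,
    OrthonormalBasis.repr_apply_apply, mul_left_comm, ← inner_conj_symm, Complex.conj_mul',
    ← Complex.ofReal_pow]
  exact Complex.re_ofReal_mul _ _

/-- Weyl's monotonicity theorem. -/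
theorem eigenvalues_le_add {n : ℕ} {E : Type*} [NormedAddCommGroup E]
    [InnerProductSpace ℂ E] [FiniteDimensional ℂ E] {T T' : E →ₗ[ℂ] E} (hT : T.IsSymmetric)
    (hT' : T'.IsSymmetric) (hn : Module.finrank ℂ E = n) {ε : ℝ}
    (h : ∀ x, (inner ℂ x (T x)).re ≤ (inner ℂ x (T' x)).re + ε * ‖x‖ ^ 2) (k : Fin n) :
    hT.eigenvalues hn k ≤ hT'.eigenvalues hn k + ε := by
  set e := hT.eigenvectorBasis hn
  set e' := hT'.eigenvectorBasis hn
  -- These are n - 1 conditions in dimension n. A nonzero solution lies in the span of the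
  -- eigenvectors of T with index at most k and of those of T' with index at least k, so its
  -- Rayleigh quotients compare the two k-th eigenvalues.
  let L : E →ₗ[ℂ] ({i : Fin n // i ≠ k} → ℂ) := LinearMap.pi fun i =>
    if k < i.1 then (innerSL ℂ (e i.1)).toLinearMap else (innerSL ℂ (e' i.1)).toLinearMap
  have hker : LinearMap.ker L ≠ ⊥ := by
    apply LinearMap.ker_ne_bot_of_finrank_lt
    rw [hn, Module.finrank_fintype_fun_eq_card]
    simp only [ne_eq, Fintype.card_subtype_compl, Fintype.card_fin, Fintype.card_unique]
    have := k.pos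
    omega
  obtain ⟨x, hx, hx0⟩ := (Submodule.ne_bot_iff _).1 hker
  have hL : ∀ i : {i : Fin n // i ≠ k}, L x i = 0 := fun i => by
    rw [LinearMap.mem_ker] at hx
    rw [hx]; rfl
  have h1 : ∀ i, k < i → inner ℂ (e i) x = 0 := fun i hi => by
    have := hL ⟨i, hi.ne'⟩
    simpa [L, hi] using this
  have h2 : ∀ i, i < k → inner ℂ (e' i) x = 0 := fun i hi => by
    have := hL ⟨i, hi.ne⟩
    simpa [L, hi.not_gt] using this
  have hx1 : hT.eigenvalues hn k * ‖x‖ ^ 2 ≤ (inner ℂ x (T x)).re := by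
    rw [inner_apply_self_eq_sum hT hn, ← e.sum_sq_norm_inner_right x, Finset.mul_sum]
    refine Finset.sum_le_sum fun i _ => ?_
    rcases lt_or_ge k i with hi | hi
    · have := h1 i hi
      simp [e, this] at this ⊢
    · exact mul_le_mul_of_nonneg_right (hT.eigenvalues_antitone hn hi) (by positivity)
  have hx2 : (inner ℂ x (T' x)).re ≤ hT'.eigenvalues hn k * ‖x‖ ^ 2 := by
    rw [inner_apply_self_eq_sum hT' hn, ← e'.sum_sq_norm_inner_right x, Finset.mul_sum]
    refine Finset.sum_le_sum fun i _ => ?_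
    rcases lt_or_ge i k with hi | hi
    · have := h2 i hi
      simp [e', this] at this ⊢
    · exact mul_le_mul_of_nonneg_right (hT'.eigenvalues_antitone hn hi) (by positivity)
  have hpos : 0 < ‖x‖ ^ 2 := by positivity
  refine le_of_mul_le_mul_right ?_ hpos
  linarith [h x]

/-- Weyl's perturbation bound for the sorted eigenvalues of Hermitian matrices that differ by a
Hermitian involution. -/
theorem abs_eigenvalues_sub_le {A B H : Matrix ι ι ℂ} (hA : A.IsHermitian) (hB : B.IsHermitian)
    (hH : H.IsHermitian) (hH1 : H * H = 1) (hAB : A = B - H) (k : ι) :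
    |hA.eigenvalues k - hB.eigenvalues k| ≤ 1 := by
  -- A Hermitian involution is isometric, so its quadratic form lies between -‖x‖² and ‖x‖².
  have key : ∀ (s : ℝ), s = 1 ∨ s = -1 → ∀ x : EuclideanSpace ℂ ι,
      s * (inner ℂ x (Matrix.toEuclideanLin H x)).re ≤ ‖x‖ ^ 2 := by
    intro s hs x
    have hs2 : s ^ 2 = 1 := by rcases hs with rfl | rfl <;> norm_num
    have hn : ‖Matrix.toEuclideanLin H x‖ ^ 2 = ‖x‖ ^ 2 := by
      have hsym := Matrix.isSymmetric_toEuclideanLin_iff.mpr hH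
      have : inner ℂ (Matrix.toEuclideanLin H x) (Matrix.toEuclideanLin H x) = inner ℂ x x := by
        rw [hsym x (Matrix.toEuclideanLin H x)]
        congr 1
        simp [Matrix.toLpLin_apply, hH1]
      rw [inner_self_eq_norm_sq_to_K, inner_self_eq_norm_sq_to_K] at this
      exact_mod_cast this
    have h3 := (Complex.abs_re_le_norm _).trans
      (norm_inner_le_norm (𝕜 := ℂ) x (Matrix.toEuclideanLin H x))
    have hn' : ‖Matrix.toEuclideanLin H x‖ = ‖x‖ := by
      have := abs_eq_abs.2 (sq_eq_sq_iff_eq_or_eq_neg.1 hn)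
      simpa using this
    rw [hn', ← sq] at h3
    have h4 := abs_le.1 h3
    rcases hs with rfl | rfl <;> linarith
  have hlin : ∀ x, Matrix.toEuclideanLin A x =
      Matrix.toEuclideanLin B x - Matrix.toEuclideanLin H x := by
    intro x
    rw [hAB, map_sub, LinearMap.sub_apply]
  have u1 := eigenvalues_le_add (Matrix.isSymmetric_toEuclideanLin_iff.mpr hA)
    (Matrix.isSymmetric_toEuclideanLin_iff.mpr hB) finrank_euclideanSpace (ε := 1)
    (fun x => by
      rw [hlin, inner_sub_right, Complex.sub_re]
      linarith [key (-1) (Or.inr rfl) x])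
    ((Fintype.equivOfCardEq (Fintype.card_fin _)).symm k)
  have u2 := eigenvalues_le_add (Matrix.isSymmetric_toEuclideanLin_iff.mpr hB)
    (Matrix.isSymmetric_toEuclideanLin_iff.mpr hA) finrank_euclideanSpace (ε := 1)
    (fun x => by
      rw [hlin, inner_sub_right, Complex.sub_re]
      linarith [key 1 (Or.inl rfl) x])
    ((Fintype.equivOfCardEq (Fintype.card_fin _)).symm k)
  rw [abs_le]
  constructor
  · have : hB.eigenvalues k ≤ hA.eigenvalues k + 1 := u2
    linarith
  · have : hA.eigenvalues k ≤ hB.eigenvalues k + 1 := u1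
    linarith

end Eigenvalues

/-! ### Symmetries of the bound -/

theorem omegaJ_mul_omegaJ {n : ℕ} (J : Finset (Fin n)) : omegaJ J * omegaJ J = -1 := by
  rw [omegaJ, ← Matrix.blockDiagonal_mul, ← Matrix.blockDiagonal_one, ← Matrix.blockDiagonal_neg]
  congr 1
  funext j
  by_cases h : j ∈ J <;> ext a b <;> fin_cases a <;> fin_cases b <;> simp [h]

theorem omegaJ_compl {n : ℕ} (J : Finset (Fin n)) : omegaJ Jᶜ = -omegaJ J := by
  rw [omegaJ, omegaJ, ← Matrix.blockDiagonal_neg]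
  congr 1
  funext j
  by_cases h : j ∈ J <;> simp [h]

theorem omegaJ_univ (n : ℕ) : omegaJ (Finset.univ : Finset (Fin n)) = omega n := by
  simp [omegaJ, omega]

variable {n : ℕ} {S : Matrix (Fin 2 × Fin n) (Fin 2 × Fin n) ℝ}

theorem IsSymplectic.det_sq (hS : IsSymplectic S) : S.det ^ 2 = 1 := by
  have h := congrArg Matrix.det hS
  have hΩ : (omega n).det ≠ 0 := by
    rw [← omegaJ_univ]
    intro h0
    have := congrArg Matrix.det (omegaJ_mul_omegaJ (Finset.univ : Finset (Fin n)))
    rw [Matrix.det_mul, h0, Matrix.det_neg, Matrix.det_one] at this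
    simp at this
  rw [Matrix.det_mul, Matrix.det_mul, Matrix.det_transpose] at h
  have : (S.det ^ 2 - 1) * (omega n).det = 0 := by linear_combination h
  rcases mul_eq_zero.1 this with h1 | h1
  · linarith
  · exact absurd h1 hΩ

theorem IsSymplectic.isUnit_det (hS : IsSymplectic S) : IsUnit S.det := by
  rw [isUnit_iff_ne_zero]
  intro h
  have := hS.det_sq
  rw [h] at this
  norm_num at this

theorem IsSymplectic.inv_mul_omega_mul (hS : IsSymplectic S) :
    S⁻¹ * omega n * (S⁻¹)ᵀ = omega n := by
  have hu := hS.isUnit_det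
  have hut : IsUnit Sᵀ.det := by rwa [Matrix.det_transpose]
  conv_lhs => rw [← hS]
  rw [Matrix.transpose_nonsing_inv, ← Matrix.mul_assoc, ← Matrix.mul_assoc,
    Matrix.nonsing_inv_mul _ hu, Matrix.one_mul, Matrix.mul_assoc, Matrix.mul_nonsing_inv _ hut,
    Matrix.mul_one]

theorem zMatrix_compl (l : ℝ) (J : Finset (Fin n)) : zMatrix l S Jᶜ = -zMatrix l S J := by
  have hneg : ((-omegaJ J).map Complex.ofReal) = -((omegaJ J).map Complex.ofReal) := by
    ext a b
    simp
  simp only [zMatrix, omegaJ_compl, hneg, smul_neg, Matrix.mul_neg, Matrix.neg_mul]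
  rw [neg_sub_neg, neg_sub]

/-- Passing to the complement negates all eigenvalues, and only their absolute values enter. -/
theorem bound_compl (l : ℝ) (J : Finset (Fin n)) : bound l S Jᶜ = bound l S J := by
  have h := charpoly_neg_eq (zMatrix_isHermitian l S J)
  rw [← zMatrix_compl] at h
  have h2 := prod_eigenvalues_eq_of_charpoly_eq (zMatrix_isHermitian l S Jᶜ)
    (d := fun i => -(zMatrix_isHermitian l S J).eigenvalues i) h
    (fun z => Real.sqrt (2 + l + |z|))
  simp only [abs_neg] at h2
  rw [bound, h2, bound]

theorem prod_sqrt_const {a : ℝ} (ha : 0 ≤ a) :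
    ∏ _k : Fin 2 × Fin n, Real.sqrt a = a ^ n := by
  rw [Finset.prod_const, Finset.card_univ, Fintype.card_prod, Fintype.card_fin, Fintype.card_fin,
    pow_mul, Real.sq_sqrt ha]

theorem iOmegaJ_isHermitian (J : Finset (Fin n)) :
    (Complex.I • (omegaJ J).map Complex.ofReal).IsHermitian := by
  ext a b
  have h := congrFun (congrFun (omegaJ_transpose J) a) b
  simp only [Matrix.transpose_apply, Matrix.neg_apply] at h
  simp [Matrix.conjTranspose_apply, h]

theorem iOmegaJ_mul_self (J : Finset (Fin n)) :
    (Complex.I • (omegaJ J).map Complex.ofReal) * (Complex.I • (omegaJ J).map Complex.ofReal) =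
      1 := by
  rw [Matrix.smul_mul, Matrix.mul_smul, smul_smul, Complex.I_mul_I]
  have := Matrix.map_mul (L := omegaJ J) (M := omegaJ J) (f := Complex.ofRealHom)
  have h2 : (omegaJ J).map Complex.ofReal * (omegaJ J).map Complex.ofReal =
      (omegaJ J * omegaJ J).map Complex.ofReal := this.symm
  rw [h2, omegaJ_mul_omegaJ]
  ext a b
  by_cases h : a = b <;> simp [h, Matrix.one_apply]

/-- The Hermitian matrix `S⁻¹ (iΩ_J) S⁻ᵀ`. -/
def congMatrix (S : Matrix (Fin 2 × Fin n) (Fin 2 × Fin n) ℝ) (J : Finset (Fin n)) :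
    Matrix (Fin 2 × Fin n) (Fin 2 × Fin n) ℂ :=
  (S⁻¹).map Complex.ofReal * (Complex.I • (omegaJ J).map Complex.ofReal) *
    ((S⁻¹)ᵀ).map Complex.ofReal

theorem zMatrix_eq (l : ℝ) (J : Finset (Fin n)) :
    zMatrix l S J = ((1 + l : ℝ) : ℂ) • congMatrix S J -
      Complex.I • (omegaJ J).map Complex.ofReal := rfl

theorem congMatrix_isHermitian (J : Finset (Fin n)) : (congMatrix S J).IsHermitian := by
  have h : ((S⁻¹)ᵀ).map Complex.ofReal = ((S⁻¹).map Complex.ofReal)ᴴ := by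
    ext a b
    simp [Matrix.conjTranspose_apply]
  rw [congMatrix, h]
  exact Matrix.isHermitian_mul_mul_conjTranspose _ (iOmegaJ_isHermitian J)

theorem IsSymplectic.norm_det_congMatrix (hS : IsSymplectic S) (J : Finset (Fin n)) :
    ‖(congMatrix S J).det‖ = 1 := by
  have h1 : ‖(Complex.I • (omegaJ J).map Complex.ofReal).det‖ ^ 2 = 1 := by
    have := congrArg Matrix.det (iOmegaJ_mul_self J)
    rw [Matrix.det_mul, Matrix.det_one, ← sq] at this
    rw [← norm_pow, this, norm_one]
  have h1' : ‖(Complex.I • (omegaJ J).map Complex.ofReal).det‖ = 1 := by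
    exact (pow_eq_one_iff_of_nonneg (norm_nonneg _) two_ne_zero).1 h1
  have hmap : ∀ A : Matrix (Fin 2 × Fin n) (Fin 2 × Fin n) ℝ,
      (A.map Complex.ofReal).det = ((A.det : ℝ) : ℂ) := fun A =>
    (RingHom.map_det Complex.ofRealHom A).symm
  have h2 : (S⁻¹).det ^ 2 = 1 := by
    rw [Matrix.det_nonsing_inv, Ring.inverse_eq_inv, inv_pow, hS.det_sq, inv_one]
  rw [congMatrix, Matrix.det_mul, Matrix.det_mul, hmap, hmap, Matrix.det_transpose, norm_mul,
    norm_mul, h1', mul_one, ← norm_mul, ← Complex.ofReal_mul, ← sq, h2]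
  simp

/-- Let a_k be the eigenvalues of (1+l) S⁻¹ iΩ_J S⁻ᵀ. By Weyl's inequality |z_k - a_k| ≤ 1, so 2 + l
+ |z_k| ≥ (1+l) + |a_k| ≥ 2√((1+l)|a_k|). The product of the |a_k| is (1+l)^{2n} because the
determinant of S⁻¹ iΩ_J S⁻ᵀ has modulus 1. -/
theorem IsSymplectic.bound_le_one (hS : IsSymplectic S) {l : ℝ} (hl : 0 < l)
    (J : Finset (Fin n)) : bound l S J ≤ 1 := by
  set z := (zMatrix_isHermitian l S J).eigenvalues with hz
  have hc : (((1 + l : ℝ) : ℂ) • congMatrix S J).IsHermitian := by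
    have := congMatrix_isHermitian (S := S) J
    rw [Matrix.IsHermitian, Matrix.conjTranspose_smul, this]
    simp
  set a := hc.eigenvalues with ha
  have hza : ∀ k, |z k - a k| ≤ 1 := fun k =>
    abs_eigenvalues_sub_le (zMatrix_isHermitian l S J) hc (iOmegaJ_isHermitian J)
      (iOmegaJ_mul_self J) rfl k
  have hdet : ∏ k, |a k| = (1 + l) ^ (2 * n) := by
    have h := congrArg (fun z : ℂ => ‖z‖) hc.det_eq_prod_eigenvalues
    simp only [Matrix.det_smul, norm_mul, hS.norm_det_congMatrix, norm_prod, norm_pow,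
      RCLike.ofReal_eq_complex_ofReal, Complex.norm_real, Real.norm_eq_abs] at h
    rw [← h, abs_of_pos (by linarith)]
    simp
  have hstep : ∀ k, Real.sqrt (4 * (1 + l) * |a k|) ≤ 2 + l + |z k| := by
    intro k
    have h1 : |a k| ≤ |z k| + 1 := by
      have := abs_sub_abs_le_abs_sub (a k) (z k)
      rw [abs_sub_comm] at this
      linarith [hza k]
    rw [Real.sqrt_le_left (by positivity)]
    nlinarith [sq_nonneg (1 + l - |a k|), abs_nonneg (a k), abs_nonneg (z k)]
  rw [bound, div_le_one (Finset.prod_pos fun k _ => Real.sqrt_pos.2 (by positivity))]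
  -- Comparing fourth powers removes both layers of square roots.
  have h0 : (2 : ℝ) ^ n * (1 + l) ^ n =
      ∏ k : Fin 2 × Fin n, Real.sqrt (Real.sqrt (4 * (1 + l) * |a k|)) := by
    have hl1 : (0 : ℝ) ≤ 1 + l := by linarith
    have : ∀ k, 0 ≤ 4 * (1 + l) * |a k| := fun k => by positivity
    have hsq : (∏ k : Fin 2 × Fin n, Real.sqrt (Real.sqrt (4 * (1 + l) * |a k|))) ^ 4 =
        ((2 : ℝ) ^ n * (1 + l) ^ n) ^ 4 := by
      rw [← Finset.prod_pow]
      have : ∀ k, Real.sqrt (Real.sqrt (4 * (1 + l) * |a k|)) ^ 4 = 4 * (1 + l) * |a k| := by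
        intro k
        rw [show (4 : ℕ) = 2 * 2 from rfl, pow_mul, Real.sq_sqrt (Real.sqrt_nonneg _),
          Real.sq_sqrt (this k)]
      simp only [this]
      rw [Finset.prod_mul_distrib, hdet, Finset.prod_const]
      simp only [Finset.card_univ, Fintype.card_prod, Fintype.card_fin]
      have h4 : (4 : ℝ) ^ (2 * n) = 2 ^ (4 * n) := by
        rw [show (4 : ℝ) = 2 ^ 2 by norm_num, ← pow_mul]
        ring_nf
      rw [mul_pow (4 : ℝ), h4]
      ring
    exact ((pow_left_inj₀ (Finset.prod_nonneg fun k _ => Real.sqrt_nonneg _) (by positivity)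
      four_ne_zero).1 hsq).symm
  rw [h0]
  exact Finset.prod_le_prod (fun k _ => Real.sqrt_nonneg _) fun k _ =>
    Real.sqrt_le_sqrt (hstep k)

/-- For J = [n] the congruence by S⁻¹ fixes Ω, so the matrix is l · iΩ. Its square is l², hence
|z_k| = l throughout. -/
theorem IsSymplectic.bound_univ (hS : IsSymplectic S) {l : ℝ} (hl : 0 < l) :
    bound l S Finset.univ = 1 := by
  have hc : congMatrix S Finset.univ =
      Complex.I • (omegaJ (Finset.univ : Finset (Fin n))).map Complex.ofReal := by
    conv_rhs => rw [omegaJ_univ, ← hS.inv_mul_omega_mul]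
    have h : ∀ A B : Matrix (Fin 2 × Fin n) (Fin 2 × Fin n) ℝ,
        (A * B).map Complex.ofReal = A.map Complex.ofReal * B.map Complex.ofReal := fun A B =>
      Matrix.map_mul (f := Complex.ofRealHom)
    rw [congMatrix, omegaJ_univ, h, h, Matrix.mul_smul, Matrix.smul_mul]
  have hz : zMatrix l S Finset.univ =
      (l : ℂ) • (Complex.I • (omegaJ (Finset.univ : Finset (Fin n))).map Complex.ofReal) := by
    rw [zMatrix_eq, hc]
    push_cast
    rw [add_smul, one_smul, add_sub_cancel_left]
  have hzz : (zMatrix l S Finset.univ * zMatrix l S Finset.univ).charpoly =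
      ∏ _i : Fin 2 × Fin n, (Polynomial.X - Polynomial.C (((l ^ 2 : ℝ)) : ℂ)) := by
    rw [hz, Matrix.smul_mul, Matrix.mul_smul, iOmegaJ_mul_self, smul_smul, ← Complex.ofReal_mul,
      ← sq, Matrix.smul_one_eq_diagonal, Matrix.charpoly_diagonal]
  have h := prod_sq_eigenvalues_eq (zMatrix_isHermitian l S Finset.univ) hzz
    (fun z => Real.sqrt (2 + l + Real.sqrt z))
  simp only [Real.sqrt_sq_eq_abs] at h
  rw [bound, h, abs_of_pos hl, prod_sqrt_const (by linarith),
    show 2 + l + l = 2 * (1 + l) by ring, mul_pow, div_self (by positivity)]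

/-- The excluded sets ∅ and [n] give the largest possible value 1, and any other set or its
complement has between 1 and n/2 elements. -/
theorem IsSymplectic.iInf_bound_eq (hS : IsSymplectic S) {l : ℝ} (hl : 0 < l) (hn : 2 ≤ n) :
    (⨅ J : Finset (Fin n), bound l S J) =
      ⨅ J : {J : Finset (Fin n) // 1 ≤ J.card ∧ J.card ≤ n / 2}, bound l S J.1 := by
  -- A singleton is admissible as n ≥ 2; its value, at most 1, disposes of J = ∅ and J = [n].
  let J₀ : {J : Finset (Fin n) // 1 ≤ J.card ∧ J.card ≤ n / 2} :=
    ⟨{⟨0, by omega⟩}, by simp, by simp; omega⟩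
  have : Nonempty {J : Finset (Fin n) // 1 ≤ J.card ∧ J.card ≤ n / 2} := ⟨J₀⟩
  have hbdd : BddBelow (Set.range fun J : {J : Finset (Fin n) // 1 ≤ J.card ∧ J.card ≤ n / 2} =>
      bound l S J.1) := Set.Finite.bddBelow (Set.finite_range _)
  apply le_antisymm
  · exact le_ciInf fun J => ciInf_le (Set.Finite.bddBelow (Set.finite_range _)) J.1
  · refine le_ciInf fun J => ?_
    have hJ₀ : (⨅ J : {J : Finset (Fin n) // 1 ≤ J.card ∧ J.card ≤ n / 2}, bound l S J.1) ≤ 1 :=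
      (ciInf_le hbdd J₀).trans (hS.bound_le_one hl _)
    by_cases h0 : J = ∅
    · rw [h0, ← bound_compl, Finset.compl_empty, hS.bound_univ hl]
      exact hJ₀
    by_cases h1 : Jᶜ = ∅
    · rw [Finset.compl_eq_empty_iff] at h1
      rw [h1, hS.bound_univ hl]
      exact hJ₀
    have c0 := Finset.card_pos.2 (Finset.nonempty_iff_ne_empty.2 h0)
    have c1 := Finset.card_pos.2 (Finset.nonempty_iff_ne_empty.2 h1)
    have c2 := Finset.card_add_card_compl J
    rw [Fintype.card_fin] at c2
    by_cases h2 : J.card ≤ n / 2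
    · exact ciInf_le hbdd ⟨J, c0, h2⟩
    · rw [← bound_compl]
      exact ciInf_le hbdd ⟨Jᶜ, c1, by omega⟩

end

section

open scoped ComplexOrder

/-! ### Positive semidefinite kernels -/

/-- A positive semidefinite kernel is the Gram matrix of a family of vectors. -/
theorem exists_gram_of_posSemidef {X : Type} {G : Matrix X X ℂ} (hG : G.PosSemidef) :
    ∃ (H : HilbertSpace) (Φ : X → H.carrier), ∀ x y, inner ℂ (Φ x) (Φ y) = G x y := by
  -- The kernels of `RKHS` are operator valued, so each scalar becomes a multiple of the identity of
  -- ℂ; the vectors are the kernel functions evaluated at 1.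
  let K : Matrix X X (ℂ →L[ℂ] ℂ) := Matrix.of fun x y => G x y • ContinuousLinearMap.id ℂ ℂ
  have hGh : ∀ x y, (starRingEnd ℂ) (G x y) = G y x := fun x y => hG.1.apply y x
  have hK : K.PosSemidef := by
    refine ((RKHS.posSemidef_tfae (K := K)).out 0 2 rfl rfl).mpr ⟨?_, fun vv => ?_⟩
    · ext x y
      simp only [Matrix.conjTranspose_apply, K, Matrix.of_apply, star_smul,
        ContinuousLinearMap.star_eq_adjoint]
      rw [Complex.star_def, hGh, ← ContinuousLinearMap.one_def, ← ContinuousLinearMap.star_eq_adjoint,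
        star_one]
    · have h := hG.2 vv
      have h2 := (Complex.le_def.1 h).1
      simp only [Complex.zero_re] at h2
      refine h2.trans (le_of_eq ?_)
      simp only [RCLike.re_to_complex]
      congr 1
      refine Finsupp.sum_congr fun x _ => Finsupp.sum_congr fun y _ => ?_
      simp only [K, Matrix.of_apply, _root_.smul_apply,
        ContinuousLinearMap.id_apply, smul_eq_mul, RCLike.inner_apply, map_mul, hGh]
      simp only [Complex.star_def]
      ring
  have : Fact K.PosSemidef := ⟨hK⟩
  refine ⟨⟨RKHS.OfKernel K⟩, fun x => RKHS.kerFun (RKHS.OfKernel K) x (1 : ℂ), fun x y => ?_⟩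
  have := RKHS.kernel_inner (RKHS.OfKernel K) y x (1 : ℂ) (1 : ℂ)
  rw [RKHS.OfKernel.kernel_ofKernel] at this
  refine this.symm.trans ?_
  simp [K, hGh]

/-! ### Cauchy-Schwarz inequalities for kernels through their Gram vectors. -/

section CauchySchwarz

variable {X : Type} [TopologicalSpace X] [SecondCountableTopology X] [MeasurableSpace X]
  [BorelSpace X] {μ : Measure X} [SFinite μ]

theorem PosSemidef.norm_apply_le {X : Type} {G : Matrix X X ℂ} (hG : G.PosSemidef) {M : ℝ}
    (hM : ∀ x, (G x x).re = M) (x y : X) : ‖G x y‖ ≤ M := by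
  obtain ⟨H, Φ, hΦ⟩ := exists_gram_of_posSemidef hG
  have h : ∀ x, ‖Φ x‖ ^ 2 = M := fun x => by
    rw [← hM x, ← hΦ x x, inner_self_eq_norm_sq_to_K]
    norm_cast
  have h1 := norm_inner_le_norm (𝕜 := ℂ) (Φ x) (Φ y)
  rw [hΦ] at h1
  nlinarith [h x, h y, sq_nonneg (‖Φ x‖ - ‖Φ y‖)]

/-- The Cauchy-Schwarz inequality for a continuous positive semidefinite kernel with constant
diagonal, between the point `x₀` and the density `g`. -/
theorem PosSemidef.norm_integral_sq_le {G : Matrix X X ℂ} (hG : G.PosSemidef)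
    (hGc : Continuous fun p : X × X => G p.1 p.2) {M : ℝ} (hM : ∀ x, (G x x).re = M)
    {g : X → ℝ} (hg : Integrable g μ) (x₀ : X) :
    ‖∫ x, (g x : ℂ) * G x₀ x ∂μ‖ ^ 2 ≤
      M * ‖∫ p, ((g p.1 * g p.2 : ℝ) : ℂ) * G p.1 p.2 ∂(μ.prod μ)‖ := by
  obtain ⟨H, Φ, hΦ⟩ := exists_gram_of_posSemidef hG
  have hn : ∀ x, ‖Φ x‖ ^ 2 = M := fun x => by
    rw [← hM x, ← hΦ x x, inner_self_eq_norm_sq_to_K]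
    norm_cast
  -- The diagonal being constant, ‖Φ x - Φ y‖² = 2M - 2 Re G x y, so continuity of the kernel gives
  -- norm continuity of Φ.
  have hΦc : Continuous Φ := by
    rw [continuous_iff_continuousAt]
    intro y
    rw [ContinuousAt, tendsto_iff_norm_sub_tendsto_zero]
    have h2 : Filter.Tendsto (fun x => ‖Φ x - Φ y‖ ^ 2) (nhds y) (nhds 0) := by
      have he : ∀ x, ‖Φ x - Φ y‖ ^ 2 = 2 * M - 2 * (G x y).re := fun x => by
        rw [@norm_sub_sq ℂ, hn, hn, hΦ]
        simp only [RCLike.re_to_complex]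
        ring
      simp only [he]
      have hcont : Continuous fun x => 2 * M - 2 * (G x y).re := by
        have : Continuous fun x => G x y := hGc.comp (Continuous.prodMk_left y)
        fun_prop
      have := hcont.tendsto y
      rwa [hM, sub_self] at this
    have h3 := h2.sqrt
    simpa using h3
  have hM0 : 0 ≤ M := by rw [← hn x₀]; positivity
  have hi : Integrable (fun x => (g x : ℂ) • Φ x) μ := by
    refine (hg.norm.mul_const (Real.sqrt M)).mono'
      ((Complex.continuous_ofReal.comp_aestronglyMeasurable hg.aestronglyMeasurable).smul
        hΦc.aestronglyMeasurable) (Filter.Eventually.of_forall fun x => ?_)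
    rw [norm_smul, Complex.norm_real, ← hn x, Real.sqrt_sq (norm_nonneg _)]
  -- With this vector the left side is |⟨Φ x₀, v⟩|² and the double integral is ‖v‖².
  set v := ∫ x, (g x : ℂ) • Φ x ∂μ with hv
  have h1 : ∫ x, (g x : ℂ) * G x₀ x ∂μ = inner ℂ (Φ x₀) v := by
    rw [hv, ← integral_inner hi]
    exact integral_congr_ae (Filter.Eventually.of_forall fun x => by
      simp only [inner_smul_right, hΦ])
  have hint : Integrable (fun p : X × X => ((g p.1 * g p.2 : ℝ) : ℂ) * G p.1 p.2)
      (μ.prod μ) := by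
    refine ((hg.mul_prod hg).ofReal (𝕜 := ℂ)).mul_bdd (c := M) hGc.aestronglyMeasurable
      (Filter.Eventually.of_forall fun p => PosSemidef.norm_apply_le hG hM _ _)
  have h2 : ∫ p, ((g p.1 * g p.2 : ℝ) : ℂ) * G p.1 p.2 ∂(μ.prod μ) = inner ℂ v v := by
    rw [integral_prod _ hint]
    have : ∀ w : H.carrier, inner ℂ v w = ∫ x, (g x : ℂ) * inner ℂ (Φ x) w ∂μ := by
      intro w
      rw [← inner_conj_symm, hv, ← integral_inner hi, ← integral_conj]
      exact integral_congr_ae (Filter.Eventually.of_forall fun x => by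
        simp only [inner_smul_right, map_mul, Complex.conj_ofReal, inner_conj_symm])
    rw [this]
    refine integral_congr_ae (Filter.Eventually.of_forall fun x => ?_)
    simp only
    rw [hv, ← integral_inner hi, ← integral_const_mul]
    refine integral_congr_ae (Filter.Eventually.of_forall fun y => ?_)
    simp only [inner_smul_right, hΦ]
    push_cast
    ring
  rw [h1, h2, inner_self_eq_norm_sq_to_K, ← hn x₀]
  have h3 := norm_inner_le_norm (𝕜 := ℂ) (Φ x₀) v
  calc ‖inner ℂ (Φ x₀) v‖ ^ 2 ≤ (‖Φ x₀‖ * ‖v‖) ^ 2 := by gcongr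
    _ = _ := by simp [mul_pow]

end CauchySchwarz

/-! ### Twisted positive definite functions -/

/-- `f` is positive definite with respect to the twist `e^{(i/2) B}`. -/
def IsTwistedPosDef {V : Type} [AddCommGroup V] (B : V → V → ℝ) (f : V → ℂ) : Prop :=
  (Matrix.of fun x y => Complex.exp (Complex.I / 2 * (B x y : ℝ)) * f (y - x)).PosSemidef

namespace IsTwistedPosDef

variable {V : Type} [AddCommGroup V] {B B' : V → V → ℝ} {f f' : V → ℂ}

/-- Schur's product theorem; the twists add because they are exponents. -/
theorem mul (h : IsTwistedPosDef B f) (h' : IsTwistedPosDef B' f') :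
    IsTwistedPosDef (fun x y => B x y + B' x y) (fun x => f x * f' x) := by
  have := Matrix.PosSemidef.hadamard h h'
  refine (congrArg Matrix.PosSemidef ?_).mpr this
  ext x y
  simp only [Matrix.of_apply, Matrix.hadamard_apply, Complex.ofReal_add, mul_add, Complex.exp_add]
  ring

theorem one : IsTwistedPosDef (fun _ _ : V => 0) (fun _ => 1) := by
  unfold IsTwistedPosDef
  have : (Matrix.of fun _ _ : V => Complex.exp (Complex.I / 2 * ((0 : ℝ) : ℝ)) * (1 : ℂ)) =
      Matrix.vecMulVec (fun _ => 1) (star fun _ => 1) := by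
    ext x y
    simp [Matrix.vecMulVec_apply]
  rw [this]
  refine ⟨?_, fun c => ?_⟩
  · ext x y
    simp [Matrix.vecMulVec_apply]
  · have : (c.sum fun i xi => c.sum fun j xj =>
        star xi * Matrix.vecMulVec (fun _ : V => (1 : ℂ)) (star fun _ => 1) i j * xj) =
        star (c.sum fun _ xi => xi) * (c.sum fun _ xi => xi) := by
      simp [Matrix.vecMulVec_apply, Finsupp.sum, Finset.sum_mul_sum, star_sum]
    rw [this]
    exact star_mul_self_nonneg _

theorem prod {ι : Type*} (s : Finset ι) {B : ι → V → V → ℝ} {f : ι → V → ℂ}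
    (h : ∀ i ∈ s, IsTwistedPosDef (B i) (f i)) :
    IsTwistedPosDef (fun x y => ∑ i ∈ s, B i x y) (fun x => ∏ i ∈ s, f i x) := by
  classical
  induction s using Finset.induction_on with
  | empty => simpa using one
  | insert i s hi ih =>
    simp only [Finset.sum_insert hi, Finset.prod_insert hi]
    exact (h i (Finset.mem_insert_self _ _)).mul
      (ih fun j hj => h j (Finset.mem_insert_of_mem hj))

theorem comp {W : Type} [AddCommGroup W] (h : IsTwistedPosDef B f) (L : W →+ V) :
    IsTwistedPosDef (fun x y => B (L x) (L y)) (fun x => f (L x)) := by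
  have := Matrix.PosSemidef.submatrix h L
  refine (congrArg Matrix.PosSemidef ?_).mpr this
  ext x y
  simp

/-- Complex conjugation and reflection show that the sign of the twist does not matter. -/
theorem neg_twist (h : IsTwistedPosDef B f) (hB : ∀ x y, B y x = -B x y)
    (hB' : ∀ x y, B (-x) (-y) = B x y) : IsTwistedPosDef (fun x y => -B x y) f := by
  -- Transposition exchanges x and y, which reverses the twist but also the argument of f; the
  -- reflection restores the argument and leaves the twist alone.
  have h1 := (Matrix.PosSemidef.transpose h).submatrix (fun x : V => -x)
  refine (congrArg Matrix.PosSemidef ?_).mpr h1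
  ext x y
  simp only [Matrix.of_apply, Matrix.submatrix_apply, Matrix.transpose_apply, hB', hB x y]
  congr 2
  abel

theorem zero_re_nonneg (h : IsTwistedPosDef B f) (hB : ∀ x, B x x = 0) : 0 ≤ (f 0).re := by
  have h1 := h.diag_nonneg (i := 0)
  simp only [Matrix.of_apply, hB, sub_zero] at h1
  simpa using (Complex.le_def.1 h1).1

end IsTwistedPosDef

end

section

open scoped ComplexOrder

/-! ### Gaussian averages of twisted positive definite functions -/

section GaussianAverage

variable {ι : Type} [Fintype ι]

/-- The bilinear form of a matrix. -/
def matForm (Z : Matrix ι ι ℝ) (x y : ι → ℝ) : ℝ := x ⬝ᵥ Z *ᵥ y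

theorem matForm_antisymm {Z : Matrix ι ι ℝ} (hZ : Zᵀ = -Z) (x y : ι → ℝ) :
    matForm Z y x = -matForm Z x y := by
  unfold matForm
  rw [Matrix.dotProduct_mulVec, ← Matrix.mulVec_transpose, hZ, Matrix.neg_mulVec,
    neg_dotProduct, dotProduct_comm]

theorem matForm_self {Z : Matrix ι ι ℝ} (hZ : Zᵀ = -Z) (x : ι → ℝ) : matForm Z x x = 0 := by
  have := matForm_antisymm hZ x x
  linarith

/-- The integral of `h` against the Gaussian `e^{-∑ cₖ ξₖ²}`. -/
def gaussAvg (c : ι → ℝ) (h : (ι → ℝ) → ℂ) : ℂ :=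
  ∫ ξ : ι → ℝ, (Real.exp (-∑ k, c k * ξ k ^ 2) : ℂ) * h ξ

theorem integrable_gauss {c : ι → ℝ} (hc : ∀ k, 0 < c k) :
    Integrable fun ξ : ι → ℝ => Real.exp (-∑ k, c k * ξ k ^ 2) := by
  have h := (GaussianFourier.integrable_cexp_neg_sum_mul_add (b := fun k => (c k : ℂ))
    (by simpa using hc) 0).norm
  refine h.congr (Filter.Eventually.of_forall fun ξ => ?_)
  simp only [Complex.norm_exp, Pi.zero_apply, zero_mul, Finset.sum_const_zero, add_zero]
  congr 1
  rw [← Complex.ofReal_re (-∑ k, c k * ξ k ^ 2)]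
  push_cast
  rfl

theorem integral_gauss (c : ι → ℝ) :
    ∫ ξ : ι → ℝ, Real.exp (-∑ k, c k * ξ k ^ 2) = ∏ k, Real.sqrt (Real.pi / c k) := by
  simp_rw [← Finset.sum_neg_distrib, Real.exp_sum]
  rw [integral_fintype_prod_volume_eq_prod (f := fun k (v : ℝ) => Real.exp (-(c k * v ^ 2)))]
  refine Finset.prod_congr rfl fun k _ => ?_
  simpa [neg_mul] using integral_gaussian (c k)

theorem norm_gaussAvg_le {c : ι → ℝ} (hc : ∀ k, 0 < c k) {h : (ι → ℝ) → ℂ} {M : ℝ}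
    (hM : ∀ ξ, ‖h ξ‖ ≤ M) : ‖gaussAvg c h‖ ≤ M * ∏ k, Real.sqrt (Real.pi / c k) := by
  rw [← integral_gauss c, ← integral_const_mul]
  refine norm_integral_le_of_norm_le ((integrable_gauss hc).const_mul M)
    (Filter.Eventually.of_forall fun ξ => ?_)
  rw [norm_mul, Complex.norm_real, Real.norm_eq_abs, Real.abs_exp, mul_comm]
  exact mul_le_mul_of_nonneg_right (hM ξ) (Real.exp_pos _).le

variable {Z : Matrix ι ι ℝ} {h : (ι → ℝ) → ℂ}

theorem IsTwistedPosDef.norm_apply_le (hh : IsTwistedPosDef (matForm Z) h) (hZ : Zᵀ = -Z)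
    (ξ : ι → ℝ) : ‖h ξ‖ ≤ (h 0).re := by
  have h1 := PosSemidef.norm_apply_le hh (M := (h 0).re)
    (fun x => by simp [matForm_self hZ]) 0 ξ
  simpa [matForm] using h1

variable [DecidableEq ι]

/-- The covariance of the twisted convolution square of a Gaussian. -/
def nextCoeff {ι : Type} (ζ c : ι → ℝ) (k : ι) : ℝ := c k / 2 + ζ k ^ 2 / (32 * c k)

/-- Completing the square with the linear coefficient -2cσ + (i/2)Zσ. The mixed term σ·Zσ vanishes
by antisymmetry, and |Zσ|² is diagonal by `hd`. The widths c cannot be kept equal because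
`nextCoeff` depends on ζ; `hcZ` says that diag(c) commutes with Z, which the iteration preserves. -/
theorem integral_twisted_gauss (hZ : Zᵀ = -Z) {ζ c : ι → ℝ}
    (hd : Zᵀ * Z = Matrix.diagonal fun k => ζ k ^ 2) (hc : ∀ k, 0 < c k)
    (hcZ : ∀ k l, Z k l ≠ 0 → c k = c l) (σ : ι → ℝ) :
    ∫ x : ι → ℝ, ((Real.exp (-∑ k, c k * x k ^ 2) * Real.exp (-∑ k, c k * (x + σ) k ^ 2) : ℝ) : ℂ)
        * Complex.exp (Complex.I / 2 * (matForm Z x σ : ℝ)) =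
      ((∏ k, Real.sqrt (Real.pi / (2 * c k)) : ℝ) : ℂ) *
        (Real.exp (-∑ k, nextCoeff ζ c k * σ k ^ 2) : ℂ) := by
  set τ : ι → ℝ := Z *ᵥ σ with hτ
  have e1 : ∀ x : ι → ℝ,
      ((Real.exp (-∑ k, c k * x k ^ 2) * Real.exp (-∑ k, c k * (x + σ) k ^ 2) : ℝ) : ℂ)
        * Complex.exp (Complex.I / 2 * (matForm Z x σ : ℝ)) =
      Complex.exp (-∑ k, (c k : ℂ) * σ k ^ 2) *
        Complex.exp (-∑ k, ((2 * c k : ℝ) : ℂ) * (x k : ℂ) ^ 2 +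
          ∑ k, (-2 * c k * σ k + Complex.I / 2 * τ k : ℂ) * x k) := by
    intro x
    push_cast
    rw [← Complex.exp_add, ← Complex.exp_add, ← Complex.exp_add]
    congr 1
    have : (matForm Z x σ : ℂ) = ∑ k, (x k : ℂ) * τ k := by
      simp only [matForm, dotProduct, ← hτ]
      push_cast
      rfl
    rw [this]
    simp only [Finset.mul_sum, ← Finset.sum_neg_distrib, ← Finset.sum_add_distrib, Pi.add_apply]
    refine Finset.sum_congr rfl fun k _ => ?_
    push_cast
    ring
  simp only [e1]
  rw [integral_const_mul, GaussianFourier.integral_cexp_neg_sum_mul_add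
    (by intro k; simpa using hc k), Finset.prod_mul_distrib, ← Complex.exp_sum, mul_left_comm,
    ← Complex.exp_add]
  congr 1
  · push_cast
    refine Finset.prod_congr rfl fun k _ => ?_
    rw [Real.sqrt_eq_rpow, Complex.ofReal_cpow (by have := hc k; positivity)]
    push_cast
    rfl
  · rw [Complex.ofReal_exp]
    congr 1
    have hcross : ∑ k, σ k * τ k = 0 := matForm_self hZ σ
    have hdiag : ∑ k, τ k ^ 2 / (32 * c k) = ∑ k, ζ k ^ 2 / (32 * c k) * σ k ^ 2 := by
      -- The weights 1/(32c) commute with Z, so they can be moved inside and Zᵀ Z appears.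
      have h1 : ∀ k, τ k / (32 * c k) = (Z *ᵥ fun l => σ l / (32 * c l)) k := by
        intro k
        simp only [hτ, Matrix.mulVec, dotProduct, Finset.sum_div]
        refine Finset.sum_congr rfl fun l _ => ?_
        by_cases hz : Z k l = 0
        · simp [hz]
        · rw [hcZ k l hz, mul_div_assoc]
      have h2 : ∑ k, τ k ^ 2 / (32 * c k) = τ ⬝ᵥ (Z *ᵥ fun l => σ l / (32 * c l)) := by
        refine Finset.sum_congr rfl fun k _ => ?_
        rw [← h1]; ring
      rw [h2, hτ, Matrix.dotProduct_mulVec, ← Matrix.mulVec_transpose, Matrix.mulVec_mulVec, hd]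
      refine Finset.sum_congr rfl fun k _ => ?_
      rw [Matrix.mulVec_diagonal]
      ring
    have hre : ∀ k, (-2 * c k * σ k + Complex.I / 2 * τ k : ℂ) ^ 2 / (4 * ((2 * c k : ℝ) : ℂ)) =
        ((c k * σ k ^ 2 / 2 - τ k ^ 2 / (32 * c k) : ℝ) : ℂ) -
          Complex.I / 4 * ((σ k * τ k : ℝ) : ℂ) := by
      intro k
      have : (c k : ℂ) ≠ 0 := by exact_mod_cast (hc k).ne'
      push_cast
      field_simp
      ring_nf
      simp only [Complex.I_sq]
      ring
    simp only [hre, Finset.sum_sub_distrib, ← Finset.mul_sum, ← Complex.ofReal_sum, hcross,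
      hdiag]
    simp only [nextCoeff, add_mul, Finset.sum_add_distrib]
    push_cast
    have : ∑ k, (c k : ℂ) / 2 * (σ k : ℂ) ^ 2 = ∑ k, (c k : ℂ) * (σ k : ℂ) ^ 2 / 2 :=
      Finset.sum_congr rfl fun k _ => by ring
    rw [this, ← Finset.sum_div]
    ring

/-- One step of the iteration: Cauchy-Schwarz and twisted convolution. -/
theorem IsTwistedPosDef.norm_gaussAvg_sq_le (hh : IsTwistedPosDef (matForm Z) h)
    (hcont : Continuous h) (hZ : Zᵀ = -Z) {ζ c : ι → ℝ}
    (hd : Zᵀ * Z = Matrix.diagonal fun k => ζ k ^ 2) (hc : ∀ k, 0 < c k)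
    (hcZ : ∀ k l, Z k l ≠ 0 → c k = c l) :
    ‖gaussAvg c h‖ ^ 2 ≤ (h 0).re * ((∏ k, Real.sqrt (Real.pi / (2 * c k))) *
      ‖gaussAvg (nextCoeff ζ c) h‖) := by
  set g : (ι → ℝ) → ℝ := fun ξ => Real.exp (-∑ k, c k * ξ k ^ 2) with hg
  have hgi : Integrable g := integrable_gauss hc
  have hmc : Continuous fun p : (ι → ℝ) × (ι → ℝ) => matForm Z p.1 p.2 := by
    unfold matForm
    simp only [dotProduct, Matrix.mulVec]
    fun_prop
  have hGc : Continuous fun p : (ι → ℝ) × (ι → ℝ) =>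
      Complex.exp (Complex.I / 2 * (matForm Z p.1 p.2 : ℝ)) * h (p.2 - p.1) := by
    fun_prop
  have h1 := PosSemidef.norm_integral_sq_le (μ := (volume : Measure (ι → ℝ))) hh hGc
    (M := (h 0).re) (fun x => by simp [matForm_self hZ]) hgi 0
  -- At the base point 0 the twist is trivial and the kernel entry is h itself.
  have e1 : gaussAvg c h = ∫ x, (g x : ℂ) * Matrix.of (fun x y =>
      Complex.exp (Complex.I / 2 * (matForm Z x y : ℝ)) * h (y - x)) 0 x := by
    simp [gaussAvg, matForm, hg]
  rw [← e1] at h1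
  refine h1.trans (mul_le_mul_of_nonneg_left (le_of_eq ?_)
    (hh.zero_re_nonneg (matForm_self hZ)))
  -- In the variables x and σ = y - x the function h depends on σ only, so the x-integral is the
  -- twisted convolution of two Gaussians.
  have hsh := measurePreserving_prod_add (volume : Measure (ι → ℝ)) (volume : Measure (ι → ℝ))
  have hemb : MeasurableEmbedding fun z : (ι → ℝ) × (ι → ℝ) => (z.1, z.1 + z.2) :=
    (MeasurableEquiv.shearAddRight (ι → ℝ)).measurableEmbedding
  have hint : Integrable (fun p : (ι → ℝ) × (ι → ℝ) => ((g p.1 * g p.2 : ℝ) : ℂ) *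
      (Complex.exp (Complex.I / 2 * (matForm Z p.1 p.2 : ℝ)) * h (p.2 - p.1)))
      (volume.prod volume) := by
    refine ((hgi.mul_prod hgi).ofReal (𝕜 := ℂ)).mul_bdd (c := (h 0).re)
      hGc.aestronglyMeasurable (Filter.Eventually.of_forall fun p => ?_)
    rw [norm_mul, show Complex.I / 2 * (matForm Z p.1 p.2 : ℝ) =
      ((matForm Z p.1 p.2 / 2 : ℝ) : ℂ) * Complex.I by push_cast; ring,
      Complex.norm_exp_ofReal_mul_I, one_mul]
    exact hh.norm_apply_le hZ _
  have hint2 := (hsh.integrable_comp_emb hemb).2 hint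
  have e2 : ∫ p, ((g p.1 * g p.2 : ℝ) : ℂ) * Matrix.of (fun x y =>
      Complex.exp (Complex.I / 2 * (matForm Z x y : ℝ)) * h (y - x)) p.1 p.2
      ∂(volume.prod volume) =
      ((∏ k, Real.sqrt (Real.pi / (2 * c k)) : ℝ) : ℂ) * gaussAvg (nextCoeff ζ c) h := by
    simp only [Matrix.of_apply]
    rw [← hsh.integral_comp hemb]
    refine (integral_prod_symm _ hint2).trans ?_
    rw [gaussAvg, ← integral_const_mul]
    refine integral_congr_ae (Filter.Eventually.of_forall fun σ => ?_)
    simp only [Function.comp_apply, add_sub_cancel_left]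
    rw [← mul_assoc, ← integral_twisted_gauss hZ hd hc hcZ σ, ← integral_mul_const]
    refine integral_congr_ae (Filter.Eventually.of_forall fun x => ?_)
    have : matForm Z x (x + σ) = matForm Z x σ := by
      have h0 := matForm_self hZ x
      simp only [matForm, Matrix.mulVec_add, dotProduct_add] at h0 ⊢
      rw [h0, zero_add]
    simp only [this, hg]
    ring
  rw [e2, norm_mul, Complex.norm_real, Real.norm_of_nonneg
    (Finset.prod_nonneg fun k _ => Real.sqrt_nonneg _)]

/-- The bound for the Gaussian average of a twisted positive definite function, in coordinates
that diagonalise the twist. -/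
theorem IsTwistedPosDef.norm_gaussAvg_le (hh : IsTwistedPosDef (matForm Z) h)
    (hcont : Continuous h) (hZ : Zᵀ = -Z) {ζ : ι → ℝ} (hζ : ∀ k, 0 ≤ ζ k)
    (hd : Zᵀ * Z = Matrix.diagonal fun k => ζ k ^ 2)
    (hζZ : ∀ k l, Z k l ≠ 0 → ζ k = ζ l) {c : ι → ℝ} (hc : ∀ k, 0 < c k)
    (hcZ : ∀ k l, Z k l ≠ 0 → c k = c l) :
    ‖gaussAvg c h‖ ≤ (h 0).re * ∏ k, Real.sqrt (Real.pi / (c k + ζ k / 4)) := by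
  set M := (h 0).re with hM
  have hM0 : 0 ≤ M := hh.zero_re_nonneg (matForm_self hZ)
  set b : (ι → ℝ) → ℝ := fun c => ∏ k, Real.sqrt (Real.pi / (c k + ζ k / 4)) with hb
  have hbpos : ∀ c : ι → ℝ, (∀ k, 0 < c k) → 0 < b c := fun c hc =>
    Finset.prod_pos fun k _ => Real.sqrt_pos.2 (by have := hc k; have := hζ k; positivity)
  have hnpos : ∀ c : ι → ℝ, (∀ k, 0 < c k) → ∀ k, 0 < nextCoeff ζ c k := fun c hc k => by
    have := hc k
    unfold nextCoeff
    positivity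
  have hnZ : ∀ c : ι → ℝ, (∀ k l, Z k l ≠ 0 → c k = c l) →
      ∀ k l, Z k l ≠ 0 → nextCoeff ζ c k = nextCoeff ζ c l := fun c hcZ k l hkl => by
    unfold nextCoeff
    rw [hcZ k l hkl, hζZ k l hkl]
  -- The inequality of arithmetic and geometric means: one step brings any c into the region c ≥
  -- ζ/4.
  have hnge : ∀ c : ι → ℝ, (∀ k, 0 < c k) → ∀ k, ζ k / 4 ≤ nextCoeff ζ c k := fun c hc k => by
    have h0 := hc k
    unfold nextCoeff
    rw [div_add_div _ _ (by norm_num) (by positivity), div_le_div_iff₀ (by norm_num) (by positivity)]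
    nlinarith [sq_nonneg (4 * c k - ζ k)]
  -- The claimed bound solves the recursion exactly, because c' + ζ/4 = (c + ζ/4)²/(2c).
  have hbstep : ∀ c : ι → ℝ, (∀ k, 0 < c k) →
      (∏ k, Real.sqrt (Real.pi / (2 * c k))) * b (nextCoeff ζ c) = b c ^ 2 := fun c hc => by
    simp only [hb]
    rw [← Finset.prod_pow, ← Finset.prod_mul_distrib]
    refine Finset.prod_congr rfl fun k _ => ?_
    have h0 := hc k
    have h1 := hζ k
    have h2 : nextCoeff ζ c k + ζ k / 4 = (c k + ζ k / 4) ^ 2 / (2 * c k) := by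
      unfold nextCoeff
      field_simp
      ring
    rw [← Real.sqrt_mul (by positivity), Real.sq_sqrt (by positivity), h2]
    have : Real.pi / (2 * c k) * (Real.pi / ((c k + ζ k / 4) ^ 2 / (2 * c k))) =
        (Real.pi / (c k + ζ k / 4)) ^ 2 := by
      field_simp
    rw [this, Real.sqrt_sq (by positivity)]
  -- If M = 0 then h vanishes; otherwise one may divide by M.
  rcases hM0.eq_or_lt with hM1 | hM1
  · have := GaussLOCC.norm_gaussAvg_le hc (fun ξ => hh.norm_apply_le hZ ξ)
    rw [← hM, ← hM1, zero_mul] at this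
    rw [← hM1, zero_mul]
    exact this
  set R : (ι → ℝ) → ℝ := fun c => ‖gaussAvg c h‖ / (M * b c) with hR
  have hR0 : ∀ c : ι → ℝ, (∀ k, 0 < c k) → 0 ≤ R c := fun c hc =>
    div_nonneg (norm_nonneg _) (mul_pos hM1 (hbpos c hc)).le
  have hRstep : ∀ c : ι → ℝ, (∀ k, 0 < c k) → (∀ k l, Z k l ≠ 0 → c k = c l) →
      R c ^ 2 ≤ R (nextCoeff ζ c) := fun c hc hcZ => by
    have h1 := hh.norm_gaussAvg_sq_le hcont hZ hd hc hcZ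
    have hb' := hbpos _ (hnpos c hc)
    have hbc := hbpos c hc
    simp only [hR]
    rw [div_pow, div_le_div_iff₀ (by positivity) (by positivity), mul_pow, ← hbstep c hc]
    calc ‖gaussAvg c h‖ ^ 2 * (M * b (nextCoeff ζ c)) ≤
        (M * ((∏ k, Real.sqrt (Real.pi / (2 * c k))) * ‖gaussAvg (nextCoeff ζ c) h‖)) *
          (M * b (nextCoeff ζ c)) := by gcongr
      _ = _ := by ring
  -- In that region c + ζ/4 ≤ 2c, so the trivial bound ‖h‖ ≤ M loses at most a factor √2 per
  -- coordinate.
  have hRtriv : ∀ c : ι → ℝ, (∀ k, 0 < c k) → (∀ k, ζ k / 4 ≤ c k) →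
      R c ≤ ∏ _k : ι, Real.sqrt 2 := fun c hc hcζ => by
    have hbc := hbpos c hc
    simp only [hR]
    rw [div_le_iff₀ (by positivity)]
    refine (GaussLOCC.norm_gaussAvg_le hc (fun ξ => hh.norm_apply_le hZ ξ)).trans ?_
    rw [mul_left_comm]
    refine mul_le_mul_of_nonneg_left ?_ hM0
    rw [← Finset.prod_mul_distrib]
    refine Finset.prod_le_prod (fun k _ => Real.sqrt_nonneg _) fun k _ => ?_
    have h0 := hc k
    have h1 := hζ k
    have h2 := hcζ k
    rw [← Real.sqrt_mul (by norm_num)]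
    apply Real.sqrt_le_sqrt
    rw [mul_div_assoc', div_le_div_iff₀ h0 (by positivity)]
    nlinarith [Real.pi_pos]
  have hpow : ∀ m : ℕ, ∀ c : ι → ℝ, (∀ k, 0 < c k) → (∀ k l, Z k l ≠ 0 → c k = c l) →
      (∀ k, ζ k / 4 ≤ c k) → R c ^ 2 ^ m ≤ ∏ _k : ι, Real.sqrt 2 := by
    intro m
    induction m with
    | zero => intro c hc _ hcζ; simpa using hRtriv c hc hcζ
    | succ m ih =>
      intro c hc hcZ hcζ
      rw [pow_succ', pow_mul]
      exact (pow_le_pow_left₀ (sq_nonneg _) (hRstep c hc hcZ) _).trans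
        (ih _ (hnpos c hc) (hnZ c hcZ) (hnge c hc))
  -- All powers R(c)^(2^m) stay below a constant independent of m, which excludes R(c) > 1.
  have hR1 : ∀ c : ι → ℝ, (∀ k, 0 < c k) → (∀ k l, Z k l ≠ 0 → c k = c l) →
      (∀ k, ζ k / 4 ≤ c k) → R c ≤ 1 := by
    intro c hc hcZ hcζ
    by_contra hcon
    push Not at hcon
    obtain ⟨m, hm⟩ := pow_unbounded_of_one_lt (∏ _k : ι, Real.sqrt 2) hcon
    have h1 := hpow m c hc hcZ hcζ
    have h2 : R c ^ m ≤ R c ^ 2 ^ m := pow_le_pow_right₀ hcon.le Nat.lt_two_pow_self.le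
    linarith
  have hfin : R c ^ 2 ≤ 1 := (hRstep c hc hcZ).trans
    (hR1 _ (hnpos c hc) (hnZ c hcZ) (hnge c hc))
  have hfin' : R c ≤ 1 := by
    have := hR0 c hc
    nlinarith
  have hbc := hbpos c hc
  simp only [hR] at hfin'
  rwa [div_le_one (by positivity)] at hfin'

theorem gaussAvg_comp_orthogonal (O : Matrix ι ι ℝ) (hO : Oᵀ * O = 1) (c : ℝ)
    (h : (ι → ℝ) → ℂ) :
    gaussAvg (fun _ => c) (fun ξ => h (O *ᵥ ξ)) = gaussAvg (fun _ => c) h := by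
  have hdet : |O.det| = 1 := by
    have := congrArg Matrix.det hO
    rw [Matrix.det_mul, Matrix.det_transpose, Matrix.det_one, ← sq] at this
    rw [← sq_abs] at this
    exact (pow_eq_one_iff_of_nonneg (abs_nonneg _) two_ne_zero).1 this
  have hdet0 : O.det ≠ 0 := by
    intro h0
    rw [h0] at hdet
    simp at hdet
  have hmp : MeasurePreserving (Matrix.toLin' O) (volume : Measure (ι → ℝ)) volume := by
    refine ⟨(Matrix.toLin' O).continuous_of_finiteDimensional.measurable, ?_⟩
    rw [Real.map_matrix_volume_pi_eq_smul_volume_pi hdet0, abs_inv, hdet]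
    simp
  have hemb : MeasurableEmbedding (Matrix.toLin' O) := by
    have : IsUnit O.det := hdet0.isUnit
    exact ((Matrix.toLinearEquiv' O (Matrix.invertibleOfIsUnitDet O this)).toContinuousLinearEquiv
      ).toHomeomorph.measurableEmbedding
  unfold gaussAvg
  refine Eq.trans ?_ (hmp.integral_comp hemb
    fun ξ => (Real.exp (-∑ k, c * ξ k ^ 2) : ℂ) * h ξ)
  refine integral_congr_ae (Filter.Eventually.of_forall fun ξ => ?_)
  have : ∑ k, (O *ᵥ ξ) k ^ 2 = ∑ k, ξ k ^ 2 := by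
    have h1 : (O *ᵥ ξ) ⬝ᵥ (O *ᵥ ξ) = ξ ⬝ᵥ ξ := by
      rw [Matrix.dotProduct_mulVec, ← Matrix.mulVec_transpose, Matrix.mulVec_mulVec, hO,
        Matrix.one_mulVec]
    simpa [dotProduct, ← sq] using h1
  simp only [Matrix.toLin'_apply, ← Finset.mul_sum, this]

/-- The bound for the isotropic Gaussian average of a twisted positive definite function. -/
theorem IsTwistedPosDef.norm_gaussAvg_le_prod (hh : IsTwistedPosDef (matForm Z) h)
    (hcont : Continuous h) (hZ : Zᵀ = -Z) (hM : (Zᵀ * Z).IsHermitian) {c : ℝ} (hc : 0 < c) :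
    ‖gaussAvg (fun _ => c) h‖ ≤
      (h 0).re * ∏ k, Real.sqrt (Real.pi / (c + Real.sqrt (hM.eigenvalues k) / 4)) := by
  set O : Matrix ι ι ℝ := (hM.eigenvectorUnitary : Matrix ι ι ℝ) with hO
  have hOO : Oᵀ * O = 1 := by
    have := Unitary.coe_star_mul_self hM.eigenvectorUnitary
    rwa [Matrix.star_eq_conjTranspose, Matrix.conjTranspose_eq_transpose_of_trivial] at this
  have hOO' : O * Oᵀ = 1 := mul_eq_one_comm.1 hOO
  have hspec : Oᵀ * (Zᵀ * Z) * O = Matrix.diagonal hM.eigenvalues := by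
    have := hM.conjStarAlgAut_star_eigenvectorUnitary
    rw [Unitary.conjStarAlgAut_star_apply, Matrix.star_eq_conjTranspose,
      Matrix.conjTranspose_eq_transpose_of_trivial] at this
    exact this
  have hev : ∀ k, 0 ≤ hM.eigenvalues k := by
    have : (Zᵀ * Z).PosSemidef := by
      have := Matrix.posSemidef_conjTranspose_mul_self Z
      rwa [Matrix.conjTranspose_eq_transpose_of_trivial] at this
    exact this.eigenvalues_nonneg
  set Z' := Oᵀ * Z * O with hZ'
  have hZ't : Z'ᵀ = -Z' := by
    simp only [hZ', Matrix.transpose_mul, Matrix.transpose_transpose, hZ, Matrix.neg_mul,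
      Matrix.mul_neg, Matrix.mul_assoc]
  have hd : Z'ᵀ * Z' = Matrix.diagonal fun k => Real.sqrt (hM.eigenvalues k) ^ 2 := by
    simp only [Real.sq_sqrt (hev _)]
    rw [← hspec, hZ', Matrix.transpose_mul, Matrix.transpose_mul, Matrix.transpose_transpose]
    simp only [Matrix.mul_assoc]
    rw [← Matrix.mul_assoc O Oᵀ, hOO', Matrix.one_mul]
  -- Z' commutes with Z'ᵀ Z' = -Z'². As the latter is diagonal, a nonzero entry of Z' can only join
  -- two equal singular values.
  have hcomm : ∀ k l, Z' k l ≠ 0 →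
      Real.sqrt (hM.eigenvalues k) = Real.sqrt (hM.eigenvalues l) := by
    intro k l hkl
    have h1 : Z' * (Z'ᵀ * Z') = (Z'ᵀ * Z') * Z' := by
      rw [hZ't]
      simp only [Matrix.mul_neg, Matrix.neg_mul, Matrix.mul_assoc]
    have h2 := congrFun (congrFun h1 k) l
    rw [hd, Matrix.mul_diagonal, Matrix.diagonal_mul, mul_comm, Real.sq_sqrt (hev _),
      Real.sq_sqrt (hev _)] at h2
    rw [mul_right_cancel₀ hkl h2]
  let L : (ι → ℝ) →+ (ι → ℝ) := (Matrix.toLin' O).toAddMonoidHom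
  have hh' : IsTwistedPosDef (matForm Z') (fun ξ => h (O *ᵥ ξ)) := by
    have h1 := hh.comp L
    have h2 : (fun x y => matForm Z (L x) (L y)) = matForm Z' := by
      funext x y
      simp only [matForm, L, LinearMap.toAddMonoidHom_coe, Matrix.toLin'_apply, hZ']
      rw [Matrix.dotProduct_mulVec, Matrix.dotProduct_mulVec, Matrix.dotProduct_mulVec,
        ← Matrix.vecMul_vecMul, ← Matrix.vecMul_vecMul, Matrix.vecMul_transpose]
    rw [h2] at h1
    exact h1
  have key := hh'.norm_gaussAvg_le (hcont.comp (by fun_prop)) hZ't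
    (fun k => Real.sqrt_nonneg _) hd hcomm (c := fun _ => c) (fun _ => hc) (fun _ _ _ => rfl)
  rw [gaussAvg_comp_orthogonal O hOO] at key
  simpa using key

end GaussianAverage

/-! ### The bound as a Gaussian average -/

open Polynomial in
theorem charpoly_smul_eq {ι : Type*} [Fintype ι] [DecidableEq ι] {A : Matrix ι ι ℝ}
    (hA : A.IsHermitian) (r : ℝ) :
    (r • A).charpoly = ∏ i, (X - C (r * hA.eigenvalues i)) := by
  conv_lhs => rw [hA.spectral_theorem, Unitary.conjStarAlgAut_apply, ← Matrix.smul_mul,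
    ← Matrix.mul_smul, Matrix.charpoly_mul_comm, ← mul_assoc]
  rw [Unitary.coe_star_mul_self, one_mul, ← Matrix.diagonal_smul]
  exact Matrix.charpoly_diagonal _

variable {n : ℕ} {S : Matrix (Fin 2 × Fin n) (Fin 2 × Fin n) ℝ}

/-- The real antisymmetric matrix `S⁻¹ Ω_J S⁻ᵀ - Ω_J / (1 + l)`. -/
def twistMatrix (l : ℝ) (S : Matrix (Fin 2 × Fin n) (Fin 2 × Fin n) ℝ) (J : Finset (Fin n)) :
    Matrix (Fin 2 × Fin n) (Fin 2 × Fin n) ℝ :=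
  S⁻¹ * omegaJ J * (S⁻¹)ᵀ - (1 + l)⁻¹ • omegaJ J

theorem twistMatrix_transpose (l : ℝ) (J : Finset (Fin n)) :
    (twistMatrix l S J)ᵀ = -twistMatrix l S J := by
  simp only [twistMatrix, Matrix.transpose_sub, Matrix.transpose_mul, Matrix.transpose_transpose,
    Matrix.transpose_smul, omegaJ_transpose, Matrix.neg_mul, Matrix.mul_neg, Matrix.mul_assoc,
    smul_neg, neg_sub, sub_neg_eq_add]
  rw [add_comm, ← sub_eq_add_neg]

/-- Hence the |z_k| are 1 + l times the singular values of the twist, up to order. -/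
theorem zMatrix_eq_smul_twistMatrix {l : ℝ} (hl : 0 < l) (J : Finset (Fin n)) :
    zMatrix l S J = (((1 + l : ℝ) : ℂ) * Complex.I) • (twistMatrix l S J).map Complex.ofReal := by
  have h : ∀ A B : Matrix (Fin 2 × Fin n) (Fin 2 × Fin n) ℝ,
      (A * B).map Complex.ofReal = A.map Complex.ofReal * B.map Complex.ofReal := fun A B =>
    Matrix.map_mul (f := Complex.ofRealHom)
  have hl1 : (1 + (l : ℂ)) ≠ 0 := by
    have : (1 + l : ℝ) ≠ 0 := by positivity
    exact_mod_cast this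
  have h2 : (twistMatrix l S J).map Complex.ofReal =
      (S⁻¹).map Complex.ofReal * (omegaJ J).map Complex.ofReal * ((S⁻¹)ᵀ).map Complex.ofReal -
        (((1 + l)⁻¹ : ℝ) : ℂ) • (omegaJ J).map Complex.ofReal := by
    rw [← h, ← h]
    ext a b
    simp [twistMatrix]
  rw [h2, zMatrix, Matrix.mul_smul, Matrix.smul_mul, smul_sub, smul_smul, smul_smul]
  congr 2
  push_cast
  field_simp

/-- The square of `zMatrix` is (1+l)² Zᵀ Z, so each denominator is (2 + l + |z|)/(4(1+l)). The 2n
numerators √(4π(1+l)) multiply to (4π(1+l))ⁿ, and division by (2π)ⁿ leaves 2ⁿ(1+l)ⁿ. -/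
theorem prod_sqrt_eq_bound {l : ℝ} (hl : 0 < l) (J : Finset (Fin n))
    (hM : ((twistMatrix l S J)ᵀ * twistMatrix l S J).IsHermitian) :
    ((2 * Real.pi) ^ n)⁻¹ * ∏ k, Real.sqrt (Real.pi /
      ((2 + l) / (4 * (1 + l)) + Real.sqrt (hM.eigenvalues k) / 4)) = bound l S J := by
  set Z := twistMatrix l S J with hZ
  have hzz : zMatrix l S J * zMatrix l S J = (((1 + l) ^ 2 • (Zᵀ * Z)).map Complex.ofReal) := by
    rw [zMatrix_eq_smul_twistMatrix hl, Matrix.smul_mul, Matrix.mul_smul, smul_smul]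
    have h : Z.map Complex.ofReal * Z.map Complex.ofReal = (Z * Z).map Complex.ofReal :=
      (Matrix.map_mul (f := Complex.ofRealHom)).symm
    rw [← hZ, h, hZ, twistMatrix_transpose, Matrix.neg_mul]
    ext a b
    simp only [Matrix.smul_apply, Matrix.map_apply, smul_eq_mul, Matrix.neg_apply]
    push_cast
    linear_combination (1 + (l : ℂ)) ^ 2 * (((twistMatrix l S J * twistMatrix l S J) a b : ℝ) : ℂ)
      * Complex.I_sq
  have hchar : (zMatrix l S J * zMatrix l S J).charpoly = ∏ i, (Polynomial.X -
      Polynomial.C ((((1 + l) ^ 2 * hM.eigenvalues i : ℝ)) : ℂ)) := by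
    have h1 := Matrix.charpoly_map ((1 + l) ^ 2 • (Zᵀ * Z)) Complex.ofRealHom
    rw [hzz]
    refine h1.trans ?_
    rw [charpoly_smul_eq hM, Polynomial.map_prod]
    simp
  have h := prod_sq_eigenvalues_eq (zMatrix_isHermitian l S J)
    (d := fun i => (1 + l) ^ 2 * hM.eigenvalues i) hchar
    (fun z => Real.sqrt (2 + l + Real.sqrt z))
  simp only [Real.sqrt_sq_eq_abs] at h
  rw [bound, h]
  have hl1 : 0 < 1 + l := by linarith
  have h3 : ∀ k, Real.sqrt (Real.pi /
      ((2 + l) / (4 * (1 + l)) + Real.sqrt (hM.eigenvalues k) / 4)) =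
      Real.sqrt (4 * Real.pi * (1 + l)) /
        Real.sqrt (2 + l + Real.sqrt ((1 + l) ^ 2 * hM.eigenvalues k)) := by
    intro k
    rw [← Real.sqrt_div (by positivity), Real.sqrt_mul (by positivity), Real.sqrt_sq hl1.le]
    congr 1
    have := Real.sqrt_nonneg (hM.eigenvalues k)
    field_simp
  simp only [h3]
  rw [Finset.prod_div_distrib, prod_sqrt_const (by positivity), ← mul_div_assoc]
  congr 1
  rw [← inv_pow, ← mul_pow, ← mul_pow]
  congr 1
  field_simp
  ring

end

section

/-! ### Weyl operators -/

/-- On a sphere, ‖F p - F p₀‖² = 2M² - 2 Re ⟨F p₀, F p⟩, so continuity of inner products is enough.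
-/
theorem continuous_of_norm_eq_of_inner {P H : Type*} [TopologicalSpace P] [NormedAddCommGroup H]
    [InnerProductSpace ℂ H] {F : P → H} {M : ℝ} (hM : ∀ p, ‖F p‖ = M)
    (h : ∀ p₀, ContinuousAt (fun p => inner ℂ (F p₀) (F p)) p₀) : Continuous F := by
  rw [continuous_iff_continuousAt]
  intro p₀
  rw [ContinuousAt, tendsto_iff_norm_sub_tendsto_zero]
  have he : ∀ p, ‖F p - F p₀‖ ^ 2 = 2 * M ^ 2 - 2 * (inner ℂ (F p₀) (F p)).re := fun p => by
    rw [norm_sub_rev, @norm_sub_sq ℂ, hM, hM]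
    simp only [RCLike.re_to_complex]
    ring
  have h2 : Filter.Tendsto (fun p => ‖F p - F p₀‖ ^ 2) (nhds p₀) (nhds 0) := by
    simp only [he]
    have h3 := (((Complex.continuous_re.tendsto _).comp (h p₀)).const_mul 2).const_sub (2 * M ^ 2)
    simp only [Function.comp_def] at h3
    have h4 : 2 * M ^ 2 - 2 * (inner ℂ (F p₀) (F p₀)).re = 0 := by
      have : (inner ℂ (F p₀) (F p₀)).re = ‖F p₀‖ ^ 2 := inner_self_eq_norm_sq (𝕜 := ℂ) (F p₀)
      rw [this, hM]
      ring
    rwa [h4] at h3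
  simpa using h2.sqrt

/-! ### Translations combined with multiplication by phases. -/

section PhaseShift

variable {V : Type*} [AddCommGroup V] [MeasurableSpace V] [MeasurableAdd₂ V] {μ : Measure V}
  [μ.IsAddRightInvariant]

theorem quasiMeasurePreserving_add_const (b : V) :
    Measure.QuasiMeasurePreserving (fun q : V => q + b) μ μ :=
  (measurePreserving_add_right μ b).quasiMeasurePreserving

theorem norm_exp_phase (x : ℝ) (z : ℂ) : ‖Complex.exp (x * Complex.I) * z‖ = ‖z‖ := by
  rw [norm_mul, Complex.norm_exp_ofReal_mul_I, one_mul]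

theorem aestronglyMeasurable_phase {V : Type*} [MeasurableSpace V] {μ : Measure V} {θ : V → ℝ}
    (hθ : Measurable θ) : AEStronglyMeasurable (fun q => Complex.exp (θ q * Complex.I)) μ := by
  have : Measurable fun q => Complex.exp (θ q * Complex.I) := by fun_prop
  exact this.aestronglyMeasurable

theorem memLp_phaseShift {θ : V → ℝ} (hθ : Measurable θ) (b : V) (f : Lp ℂ 2 μ) :
    MemLp (fun q => Complex.exp (θ q * Complex.I) * (f : V → ℂ) (q + b)) 2 μ := by
  have h1 := (Lp.memLp f).comp_measurePreserving (measurePreserving_add_right μ b)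
  refine (memLp_congr_norm ((aestronglyMeasurable_phase hθ).mul h1.1) h1.1
    (Filter.Eventually.of_forall fun q => ?_)).2 h1
  exact norm_exp_phase _ _

/-- The isometry `(T f)(q) = e^{i θ(q)} f(q + b)` of `L²`. -/
def phaseShift (θ : V → ℝ) (hθ : Measurable θ) (b : V) : Lp ℂ 2 μ →ₗᵢ[ℂ] Lp ℂ 2 μ where
  toFun f := (memLp_phaseShift hθ b f).toLp
  map_add' f g := by
    rw [← MemLp.toLp_add, MemLp.toLp_eq_toLp_iff]
    filter_upwards [(quasiMeasurePreserving_add_const b).ae (Lp.coeFn_add f g)] with q hq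
    simp only [Pi.add_apply] at hq ⊢
    rw [hq, mul_add]
  map_smul' c f := by
    rw [RingHom.id_apply, ← MemLp.toLp_const_smul, MemLp.toLp_eq_toLp_iff]
    filter_upwards [(quasiMeasurePreserving_add_const b).ae (Lp.coeFn_smul c f)] with q hq
    simp only [Pi.smul_apply, smul_eq_mul] at hq ⊢
    rw [hq]
    ring
  norm_map' f := by
    have h1 := (Lp.memLp f).comp_measurePreserving (measurePreserving_add_right μ b)
    change ‖(memLp_phaseShift hθ b f).toLp‖ = ‖f‖
    rw [Lp.norm_toLp, Lp.norm_def, ← eLpNorm_comp_measurePreserving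
      (Lp.aestronglyMeasurable f) (measurePreserving_add_right μ b)]
    congr 1
    exact eLpNorm_congr_norm_ae (Filter.Eventually.of_forall fun q => norm_exp_phase _ _)

variable {θ θ' : V → ℝ} (hθ : Measurable θ) (hθ' : Measurable θ') (b b' : V)

theorem coeFn_phaseShift (f : Lp ℂ 2 μ) :
    phaseShift θ hθ b f =ᵐ[μ] fun q => Complex.exp (θ q * Complex.I) * (f : V → ℂ) (q + b) :=
  (memLp_phaseShift hθ b f).coeFn_toLp

theorem phaseShift_phaseShift {θ'' : V → ℝ} (hθ'' : Measurable θ'') (c : ℝ)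
    (h : ∀ q, θ q + θ' (q + b) = c + θ'' q) (f : Lp ℂ 2 μ) :
    phaseShift θ hθ b (phaseShift θ' hθ' b' f) =
      Complex.exp (c * Complex.I) • phaseShift θ'' hθ'' (b + b') f := by
  ext1
  filter_upwards [coeFn_phaseShift hθ b (phaseShift θ' hθ' b' f),
    (quasiMeasurePreserving_add_const b).ae (coeFn_phaseShift hθ' b' f),
    Lp.coeFn_smul (Complex.exp (c * Complex.I)) (phaseShift θ'' hθ'' (b + b') f),
    coeFn_phaseShift hθ'' (b + b') f] with q h1 h2 h3 h4
  rw [h1, h2, h3, Pi.smul_apply, h4, smul_eq_mul, ← mul_assoc, ← mul_assoc, ← Complex.exp_add,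
    ← Complex.exp_add, ← add_mul, ← add_mul, add_assoc q, ← Complex.ofReal_add,
    ← Complex.ofReal_add, h]

/-- Multiplication by a phase that depends continuously on a parameter is strongly continuous. -/
theorem continuous_phaseShift_zero {P : Type*} [TopologicalSpace P] [FirstCountableTopology P]
    {Θ : P → V → ℝ} (hΘ : ∀ p, Measurable (Θ p)) (hc : ∀ q, Continuous fun p => Θ p q)
    (f : Lp ℂ 2 μ) : Continuous fun p => phaseShift (Θ p) (hΘ p) 0 f := by
  refine continuous_of_norm_eq_of_inner (M := ‖f‖) (fun p => LinearIsometry.norm_map _ _) ?_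
  intro p₀
  simp only [L2.inner_def]
  have hae : ∀ p, ∀ᵐ q ∂μ, inner ℂ ((phaseShift (Θ p₀) (hΘ p₀) 0 f : V → ℂ) q)
      ((phaseShift (Θ p) (hΘ p) 0 f : V → ℂ) q) =
      Complex.exp ((Θ p q - Θ p₀ q : ℝ) * Complex.I) * ((‖(f : V → ℂ) q‖ ^ 2 : ℝ) : ℂ) := by
    intro p
    filter_upwards [coeFn_phaseShift (hΘ p) 0 f, coeFn_phaseShift (hΘ p₀) 0 f] with q h1 h2
    rw [h1, h2, add_zero, RCLike.inner_apply, map_mul, ← Complex.exp_conj, map_mul,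
      Complex.conj_I, Complex.conj_ofReal]
    have : (f : V → ℂ) q * (starRingEnd ℂ) ((f : V → ℂ) q) = ((‖(f : V → ℂ) q‖ ^ 2 : ℝ) : ℂ) := by
      rw [Complex.mul_conj']
      push_cast
      rfl
    rw [← this, show ((Θ p q - Θ p₀ q : ℝ) : ℂ) * Complex.I =
      Θ p q * Complex.I + Θ p₀ q * -Complex.I by push_cast; ring, Complex.exp_add]
    ring
  simp only [fun p => integral_congr_ae (hae p)]
  have hint : Integrable (fun q => ‖(f : V → ℂ) q‖ ^ 2) μ :=
    (memLp_two_iff_integrable_sq_norm (Lp.aestronglyMeasurable f)).1 (Lp.memLp f)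
  refine continuousAt_of_dominated (bound := fun q => ‖(f : V → ℂ) q‖ ^ 2) ?_ ?_ hint ?_
  · refine Filter.Eventually.of_forall fun p => ?_
    exact (aestronglyMeasurable_phase ((hΘ p).sub (hΘ p₀))).mul
      hint.ofReal.aestronglyMeasurable
  · refine Filter.Eventually.of_forall fun p => Filter.Eventually.of_forall fun q => ?_
    rw [norm_exp_phase, Complex.norm_real, Real.norm_of_nonneg (by positivity)]
  · refine Filter.Eventually.of_forall fun q => ?_
    have := hc q
    fun_prop

end PhaseShift

/-- The Weyl operator `e^{i (a x + b p)}` of one mode. -/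
def weylMode (ξ : ℝ × ℝ) : Mode →ₗᵢ[ℂ] Mode :=
  phaseShift (fun q => ξ.1 * q + ξ.1 * ξ.2 / 2) (by fun_prop) ξ.2

/-- The Weyl operator `e^{i ∑ ξ_k r_k}` of `n` modes. -/
def weyl {n : ℕ} (ξ : Fin 2 × Fin n → ℝ) : Modes n →ₗᵢ[ℂ] Modes n :=
  phaseShift (fun q => ∑ j, (ξ (0, j) * q j + ξ (0, j) * ξ (1, j) / 2)) (by fun_prop)
    (fun j => ξ (1, j))

/-- The symplectic form of one mode. -/
def sympl (ξ η : ℝ × ℝ) : ℝ := ξ.1 * η.2 - η.1 * ξ.2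

theorem weylMode_weylMode (ξ η : ℝ × ℝ) (f : Mode) :
    weylMode ξ (weylMode η f) = Complex.exp (((-sympl ξ η / 2 : ℝ) : ℂ) * Complex.I) •
      weylMode (ξ + η) f := by
  refine phaseShift_phaseShift _ _ _ _ _ _ (fun q => ?_) f
  simp only [sympl, Prod.fst_add, Prod.snd_add]
  ring

/-- The source of the twist: by the Weyl relations, Gram matrices of Weyl-displaced vectors depend
on η - ξ up to a symplectic phase. -/
theorem inner_weylMode_weylMode (ξ η : ℝ × ℝ) (f g : Mode) :
    inner ℂ (weylMode ξ f) (weylMode η g) =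
      Complex.exp (Complex.I / 2 * (sympl ξ η : ℝ)) * inner ℂ f (weylMode (η - ξ) g) := by
  have h := weylMode_weylMode ξ (η - ξ) g
  rw [add_sub_cancel] at h
  have hs : sympl ξ (η - ξ) = sympl ξ η := by
    simp only [sympl, Prod.fst_sub, Prod.snd_sub]; ring
  have h2 : weylMode η g =
      Complex.exp (Complex.I / 2 * (sympl ξ η : ℝ)) • weylMode ξ (weylMode (η - ξ) g) := by
    rw [h, smul_smul, ← Complex.exp_add, hs]
    rw [show Complex.I / 2 * (sympl ξ η : ℝ) + ((-sympl ξ η / 2 : ℝ) : ℂ) * Complex.I = 0 by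
      push_cast; ring, Complex.exp_zero, one_smul]
  rw [h2, inner_smul_right, LinearIsometry.inner_map_map]

theorem continuous_shift (f : Mode) :
    Continuous fun b : ℝ => phaseShift (fun _ : ℝ => 0) measurable_const b f := by
  have h1 : Continuous fun b : ℝ => Lp.compMeasurePreserving (fun q : ℝ => q + b)
      (measurePreserving_add_right volume b) f := by
    refine Continuous.compMeasurePreservingLp (g := fun b : ℝ => (⟨fun q => q + b, by fun_prop⟩ :
      C(ℝ, ℝ))) continuous_const ?_ (fun b => measurePreserving_add_right volume b) (by simp)
    exact ContinuousMap.continuous_of_continuous_uncurry _ (by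
      simp only [Function.uncurry_def, ContinuousMap.coe_mk]; fun_prop)
  refine h1.congr fun b => ?_
  ext1
  filter_upwards [coeFn_phaseShift (μ := (volume : Measure ℝ)) (θ := fun _ => 0)
    measurable_const b f, Lp.coeFn_compMeasurePreserving f (measurePreserving_add_right volume b)]
    with q h2 h3
  rw [h2, h3]
  simp

/-- A Weyl operator is a multiplication after a translation. Both are strongly continuous families
of isometries, so their composition is too. -/
theorem continuous_weylMode (f : Mode) : Continuous fun ξ : ℝ × ℝ => weylMode ξ f := by
  set Θ : ℝ × ℝ → ℝ → ℝ := fun ξ q => ξ.1 * q + ξ.1 * ξ.2 / 2 with hΘ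
  have hΘm : ∀ ξ, Measurable (Θ ξ) := fun ξ => by fun_prop
  have hfac : ∀ ξ, weylMode ξ f = phaseShift (Θ ξ) (hΘm ξ) 0
      (phaseShift (fun _ : ℝ => 0) measurable_const ξ.2 f) := fun ξ => by
    have := phaseShift_phaseShift (μ := (volume : Measure ℝ)) (hΘm ξ)
      (measurable_const (a := (0 : ℝ))) 0 ξ.2 (hΘm ξ) 0 (fun q => by simp) f
    rw [this]
    simp [weylMode, hΘ]
  rw [continuous_iff_continuousAt]
  intro ξ₀
  simp only [ContinuousAt, hfac]
  rw [tendsto_iff_norm_sub_tendsto_zero]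
  set g := phaseShift (μ := (volume : Measure ℝ)) (fun _ : ℝ => 0) measurable_const ξ₀.2 f with hg
  have c1 : Filter.Tendsto (fun ξ : ℝ × ℝ =>
      ‖phaseShift (μ := (volume : Measure ℝ)) (fun _ : ℝ => 0) measurable_const ξ.2 f - g‖)
      (nhds ξ₀) (nhds 0) :=
    tendsto_iff_norm_sub_tendsto_zero.1 (((continuous_shift f).comp continuous_snd).tendsto ξ₀)
  have c2 := tendsto_iff_norm_sub_tendsto_zero.1
    ((continuous_phaseShift_zero hΘm (fun q => by fun_prop) g).tendsto ξ₀)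
  have c3 := c1.add c2
  rw [add_zero] at c3
  refine squeeze_zero (fun _ => norm_nonneg _) (fun ξ => ?_) c3
  refine (norm_sub_le_norm_sub_add_norm_sub _ (phaseShift (Θ ξ) (hΘm ξ) 0 g) _).trans ?_
  rw [← map_sub, LinearIsometry.norm_map]

/-! ### Product vectors -/

theorem coeFn_tensor {n : ℕ} (f : Fin n → Mode) :
    tensor f =ᵐ[volume] fun q : Fin n → ℝ => ∏ j, (f j : ℝ → ℂ) (q j) :=
  (memLp_tensor f).coeFn_toLp

theorem inner_tensor {n : ℕ} (f g : Fin n → Mode) :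
    inner ℂ (tensor f) (tensor g) = ∏ j, inner ℂ (f j) (g j) := by
  simp only [L2.inner_def]
  rw [← integral_fintype_prod_volume_eq_prod
    (f := fun j (x : ℝ) => inner ℂ ((f j : ℝ → ℂ) x) ((g j : ℝ → ℂ) x))]
  refine integral_congr_ae ?_
  filter_upwards [coeFn_tensor f, coeFn_tensor g] with q h1 h2
  rw [h1, h2]
  simp [RCLike.inner_apply, map_prod, Finset.prod_mul_distrib]

theorem norm_tensor {n : ℕ} (f : Fin n → Mode) : ‖tensor f‖ = ∏ j, ‖f j‖ := by
  have h := inner_tensor f f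
  simp only [inner_self_eq_norm_sq_to_K] at h
  have h2 : ‖tensor f‖ ^ 2 = (∏ j, ‖f j‖) ^ 2 := by
    rw [← Finset.prod_pow]
    exact_mod_cast h
  exact (pow_left_inj₀ (norm_nonneg _) (Finset.prod_nonneg fun j _ => norm_nonneg _)
    two_ne_zero).1 h2

theorem ae_eval {n : ℕ} (j : Fin n) {p : ℝ → Prop} (h : ∀ᵐ x : ℝ, p x) :
    ∀ᵐ q : Fin n → ℝ, p (q j) :=
  (Measure.quasiMeasurePreserving_eval (fun _ : Fin n => (volume : Measure ℝ)) j).ae h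

theorem coeFn_weyl {n : ℕ} (ξ : Fin 2 × Fin n → ℝ) (f : Modes n) :
    weyl ξ f =ᵐ[volume] fun q => Complex.exp
      (((∑ j, (ξ (0, j) * q j + ξ (0, j) * ξ (1, j) / 2) : ℝ) : ℂ) * Complex.I) *
        (f : (Fin n → ℝ) → ℂ) (q + fun j => ξ (1, j)) :=
  coeFn_phaseShift _ _ f

theorem weyl_tensor {n : ℕ} (ξ : Fin 2 × Fin n → ℝ) (f : Fin n → Mode) :
    weyl ξ (tensor f) = tensor fun j => weylMode (ξ (0, j), ξ (1, j)) (f j) := by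
  ext1
  have h3 : ∀ᵐ q : Fin n → ℝ, ∀ j, (weylMode (ξ (0, j), ξ (1, j)) (f j) : ℝ → ℂ) (q j) =
      Complex.exp ((ξ (0, j) * q j + ξ (0, j) * ξ (1, j) / 2 : ℝ) * Complex.I) *
        (f j : ℝ → ℂ) (q j + ξ (1, j)) :=
    ae_all_iff.2 fun j => ae_eval j (coeFn_phaseShift _ _ (f j))
  filter_upwards [coeFn_weyl ξ (tensor f), coeFn_tensor fun j => weylMode (ξ (0, j), ξ (1, j)) (f j),
    (quasiMeasurePreserving_add_const (fun j => ξ (1, j))).ae (coeFn_tensor f), h3]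
    with q h1 h2 h4 h5
  rw [h1, h4, h2]
  simp only [h5]
  rw [Finset.prod_mul_distrib, ← Complex.exp_sum, ← Finset.sum_mul]
  push_cast
  rfl

end

section

/-! ### Weyl operators on Schwartz functions -/

/-- All derivatives have modulus 1; this lets Weyl operators act on Schwartz functions. -/
theorem hasTemperateGrowth_exp_mul_I :
    Function.HasTemperateGrowth fun x : ℝ => Complex.exp (x * Complex.I) := by
  have hd : ∀ m : ℕ, iteratedDeriv m (fun x : ℝ => Complex.exp (x * Complex.I)) =
      fun x : ℝ => Complex.I ^ m * Complex.exp (x * Complex.I) := by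
    intro m
    induction m with
    | zero => simp
    | succ m ih =>
      rw [iteratedDeriv_succ, ih]
      funext x
      have h1 : HasDerivAt (fun x : ℝ => Complex.exp (x * Complex.I))
          (Complex.exp (x * Complex.I) * Complex.I) x := by
        have := ((hasDerivAt_id (x : ℂ)).mul_const Complex.I).cexp.comp_ofReal
        simpa using this
      rw [(h1.const_mul _).deriv]
      ring
  refine ⟨?_, fun m => ⟨0, 1, fun x => ?_⟩⟩
  · have : ContDiff ℝ (⊤ : ℕ∞) fun x : ℝ => Complex.exp (x * Complex.I) :=
      (Complex.ofRealCLM.contDiff.mul contDiff_const).cexp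
    exact this
  · rw [norm_iteratedFDeriv_eq_norm_iteratedDeriv, hd]
    simp [Complex.norm_exp_ofReal_mul_I]

variable {n : ℕ}

/-- The phase of the Weyl operator. -/
def weylPhase (ξ : Fin 2 × Fin n → ℝ) (q : Fin n → ℝ) : ℝ :=
  ∑ j, (ξ (0, j) * q j + ξ (0, j) * ξ (1, j) / 2)

theorem hasTemperateGrowth_coord (j : Fin n) :
    Function.HasTemperateGrowth fun q : Fin n → ℝ => q j :=
  (ContinuousLinearMap.proj (R := ℝ) (φ := fun _ : Fin n => ℝ) j).hasTemperateGrowth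

theorem hasTemperateGrowth_weylPhase (ξ : Fin 2 × Fin n → ℝ) :
    Function.HasTemperateGrowth fun q => Complex.exp (weylPhase ξ q * Complex.I) := by
  refine hasTemperateGrowth_exp_mul_I.comp (f := weylPhase ξ) ?_
  unfold weylPhase
  refine Function.HasTemperateGrowth.sum fun j _ => ?_
  exact ((Function.HasTemperateGrowth.const _).mul (hasTemperateGrowth_coord j)).add
    (Function.HasTemperateGrowth.const _)

/-- The Weyl operator on Schwartz functions. -/
def weylSchwartz (ξ : Fin 2 × Fin n → ℝ) (φ : 𝓢(Fin n → ℝ, ℂ)) : 𝓢(Fin n → ℝ, ℂ) :=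
  SchwartzMap.smulLeftCLM ℂ (fun q => Complex.exp (weylPhase ξ q * Complex.I))
    (SchwartzMap.compSubConstCLM ℂ (-fun j => ξ (1, j)) φ)

theorem weylSchwartz_apply (ξ : Fin 2 × Fin n → ℝ) (φ : 𝓢(Fin n → ℝ, ℂ)) (q : Fin n → ℝ) :
    weylSchwartz ξ φ q =
      Complex.exp (weylPhase ξ q * Complex.I) * φ (q + fun j => ξ (1, j)) := by
  rw [weylSchwartz, smulLeftCLM_apply_apply (hasTemperateGrowth_weylPhase ξ),
    compSubConstCLM_apply, sub_neg_eq_add, smul_eq_mul]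

theorem toLp_weylSchwartz (ξ : Fin 2 × Fin n → ℝ) (φ : 𝓢(Fin n → ℝ, ℂ)) :
    (weylSchwartz ξ φ).toLp 2 volume = weyl ξ (φ.toLp 2 volume) := by
  ext1
  filter_upwards [(weylSchwartz ξ φ).coeFn_toLp 2 volume, coeFn_weyl ξ (φ.toLp 2 volume),
    (quasiMeasurePreserving_add_const (fun j => ξ (1, j))).ae (φ.coeFn_toLp 2 volume)]
    with q h1 h2 h3
  rw [h1, h2, h3, weylSchwartz_apply, weylPhase]

/-- No cocycle appears along a line, since the symplectic form vanishes on parallel vectors. -/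
theorem weylSchwartz_add_smul (ξ : Fin 2 × Fin n → ℝ) (s t : ℝ) (φ : 𝓢(Fin n → ℝ, ℂ)) :
    weylSchwartz ((t + s) • ξ) φ = weylSchwartz (s • ξ) (weylSchwartz (t • ξ) φ) := by
  ext q
  simp only [weylSchwartz_apply]
  rw [← mul_assoc, ← Complex.exp_add, ← add_mul, ← Complex.ofReal_add]
  congr 1
  · congr 3
    simp only [weylPhase, ← Finset.sum_add_distrib]
    refine Finset.sum_congr rfl fun j _ => ?_
    simp only [Pi.smul_apply, smul_eq_mul, Pi.add_apply]
    ring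
  · congr 1
    funext j
    simp only [Pi.smul_apply, smul_eq_mul, Pi.add_apply]
    ring

/-- The generator `i ∑ ξ_k r_k` of the Weyl operators. -/
def weylGen (ξ : Fin 2 × Fin n → ℝ) (φ : 𝓢(Fin n → ℝ, ℂ)) : 𝓢(Fin n → ℝ, ℂ) :=
  ∑ k, (Complex.I * ξ k) • canonicalOp k φ

theorem weylGen_apply (ξ : Fin 2 × Fin n → ℝ) (φ : 𝓢(Fin n → ℝ, ℂ)) (q : Fin n → ℝ) :
    weylGen ξ φ q = Complex.I * ((∑ j, ξ (0, j) * q j : ℝ) : ℂ) * φ q +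
      fderiv ℝ φ q (fun j => ξ (1, j)) := by
  have hsum : (fun j => ξ (1, j)) = ∑ j, ξ (1, j) • (Pi.single j (1 : ℝ) : Fin n → ℝ) := by
    funext i
    simp [Finset.sum_apply, Pi.single_apply]
  have ht : ∀ j : Fin n, Function.HasTemperateGrowth fun q : Fin n → ℝ => ((q j : ℝ) : ℂ) :=
    fun j => (Complex.ofRealCLM.comp (ContinuousLinearMap.proj (R := ℝ)
      (φ := fun _ : Fin n => ℝ) j)).hasTemperateGrowth
  rw [weylGen, _root_.sum_apply, Fintype.sum_prod_type, Fin.sum_univ_two, hsum, map_sum]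
  simp only [_root_.smul_apply, canonicalOp, smul_eq_mul, if_true, one_ne_zero, if_false,
    map_smul, smulLeftCLM_apply_apply (ht _), lineDerivOp_apply_eq_fderiv, Complex.real_smul]
  congr 1
  · push_cast
    rw [Finset.mul_sum, Finset.sum_mul]
    exact Finset.sum_congr rfl fun j _ => by ring
  · refine Finset.sum_congr rfl fun j _ => ?_
    linear_combination (-(ξ (1, j) : ℂ) * (fderiv ℝ φ q) (Pi.single j 1)) * Complex.I_sq

/-- Written this way, the modulus of the derivative at any s is that of a translate of the fixed
Schwartz function `weylGen ξ φ`. -/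
theorem hasDerivAt_weylSchwartz_apply (ξ : Fin 2 × Fin n → ℝ) (φ : 𝓢(Fin n → ℝ, ℂ))
    (q : Fin n → ℝ) (s : ℝ) :
    HasDerivAt (fun s : ℝ => weylSchwartz (s • ξ) φ q)
      (weylSchwartz (s • ξ) (weylGen ξ φ) q) s := by
  set b : Fin n → ℝ := fun j => ξ (1, j) with hb
  have hbs : ∀ s : ℝ, (fun j => (s • ξ) (1, j)) = s • b := fun s => rfl
  simp only [weylSchwartz_apply, hbs]
  have h1 : HasDerivAt (fun s : ℝ => φ (q + s • b)) (fderiv ℝ φ (q + s • b) b) s := by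
    have hl : HasDerivAt (fun s : ℝ => q + s • b) b s := by
      simpa using ((hasDerivAt_id s).smul_const b).const_add q
    exact (φ.hasFDerivAt (q + s • b)).comp_hasDerivAt s hl
  have h2 : HasDerivAt (fun s : ℝ => weylPhase (s • ξ) q)
      (∑ j, ξ (0, j) * (q + s • b) j) s := by
    unfold weylPhase
    refine HasDerivAt.fun_sum fun j _ => ?_
    simp only [Pi.smul_apply, smul_eq_mul, Pi.add_apply, hb]
    have h3 := ((hasDerivAt_id s).mul_const (ξ (0, j) * q j)).add
      (((hasDerivAt_pow 2 s).mul_const (ξ (0, j) * ξ (1, j) / 2)))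
    refine (h3.congr_deriv ?_).congr_of_eventuallyEq (Filter.Eventually.of_forall fun t => ?_)
    · simp; ring
    · simp; ring
  have h4 := (h2.ofReal_comp.mul_const Complex.I).cexp.mul h1
  refine h4.congr_deriv ?_
  rw [weylGen_apply]
  ring

theorem norm_toLp_sq (ψ : 𝓢(Fin n → ℝ, ℂ)) :
    ‖ψ.toLp 2 volume‖ ^ 2 = ∫ q, ‖ψ q‖ ^ 2 := by
  rw [← inner_self_eq_norm_sq (𝕜 := ℂ), L2.inner_def, ← integral_re (L2.integrable_inner _ _)]
  refine integral_congr_ae ?_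
  filter_upwards [ψ.coeFn_toLp 2 volume] with q hq
  rw [hq, inner_self_eq_norm_sq]

/-- Schwartz decay of order k = n + 1 survives bounded translations because 1 + ‖q‖ ≤ (1 + ‖b‖)(1 +
‖q + rb‖). The squared majorant decays with exponent 2n + 2 > n, so it is integrable. -/
theorem exists_bound_translates (ψ : 𝓢(Fin n → ℝ, ℂ)) (b : Fin n → ℝ) :
    ∃ β : (Fin n → ℝ) → ℝ, Integrable (fun q => β q ^ 2) ∧
      ∀ q, ∀ r ∈ Set.Icc (-1 : ℝ) 1, ‖ψ (q + r • b)‖ ≤ β q := by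
  set k := n + 1 with hk
  set C := 2 ^ k * (Finset.Iic (k, 0)).sup (fun m => SchwartzMap.seminorm ℝ m.1 m.2) ψ with hC
  have hC0 : 0 ≤ C := by positivity
  refine ⟨fun q => C * (1 + ‖b‖) ^ k / (1 + ‖q‖) ^ k, ?_, fun q r hr => ?_⟩
  · have h1 : Integrable (fun q : Fin n → ℝ => (1 + ‖q‖) ^ (-((2 * k : ℕ) : ℝ))) := by
      apply integrable_one_add_norm
      simp only [Module.finrank_fintype_fun_eq_card, Fintype.card_fin]
      rw [hk]
      push_cast
      linarith [(Nat.cast_nonneg n : (0 : ℝ) ≤ n)]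
    refine (h1.const_mul ((C * (1 + ‖b‖) ^ k) ^ 2)).congr (Filter.Eventually.of_forall fun q => ?_)
    simp only
    rw [Real.rpow_neg (by positivity), Real.rpow_natCast, div_pow, ← pow_mul, mul_comm k 2,
      div_eq_mul_inv]
  · have h1 := SchwartzMap.one_add_le_sup_seminorm_apply (𝕜 := ℝ) (m := (k, 0)) (k := k) (n := 0)
      le_rfl le_rfl ψ (q + r • b)
    rw [norm_iteratedFDeriv_zero] at h1
    have h2 : 1 + ‖q‖ ≤ (1 + ‖b‖) * (1 + ‖q + r • b‖) := by
      have h3 : ‖q‖ ≤ ‖q + r • b‖ + ‖r • b‖ := by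
        have := norm_sub_le (q + r • b) (r • b)
        rwa [add_sub_cancel_right] at this
      have h4 : ‖r • b‖ ≤ ‖b‖ := by
        rw [norm_smul]
        have : ‖r‖ ≤ 1 := abs_le.2 hr
        nlinarith [norm_nonneg b]
      nlinarith [norm_nonneg b, norm_nonneg (q + r • b)]
    rw [le_div_iff₀ (by positivity)]
    calc ‖ψ (q + r • b)‖ * (1 + ‖q‖) ^ k
        ≤ ‖ψ (q + r • b)‖ * ((1 + ‖b‖) * (1 + ‖q + r • b‖)) ^ k := by gcongr
      _ = ((1 + ‖q + r • b‖) ^ k * ‖ψ (q + r • b)‖) * (1 + ‖b‖) ^ k := by rw [mul_pow]; ring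
      _ ≤ C * (1 + ‖b‖) ^ k := by gcongr

/-- Dominated convergence upgrades the pointwise derivative to one in L². The point s = 0 suffices,
as the group law gives the others. -/
theorem hasDerivAt_toLp_weylSchwartz (ξ : Fin 2 × Fin n → ℝ) (φ : 𝓢(Fin n → ℝ, ℂ)) :
    HasDerivAt (fun s : ℝ => (weylSchwartz (s • ξ) φ).toLp 2 volume)
      ((weylGen ξ φ).toLp 2 volume) 0 := by
  obtain ⟨β, hβ, hβ'⟩ := exists_bound_translates (weylGen ξ φ) (fun j => ξ (1, j))
  have hw0 : ∀ ψ : 𝓢(Fin n → ℝ, ℂ), weylSchwartz ((0 : ℝ) • ξ) ψ = ψ := by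
    intro ψ
    ext q
    rw [weylSchwartz_apply]
    have : (fun j => ((0 : ℝ) • ξ) (1, j)) = (0 : Fin n → ℝ) := by funext j; simp
    rw [this]
    simp [weylPhase]
  have hgen : ∀ q, ∀ r ∈ Set.Icc (-1 : ℝ) 1, ‖weylSchwartz (r • ξ) (weylGen ξ φ) q‖ ≤ β q := by
    intro q r hr
    rw [weylSchwartz_apply, norm_exp_phase]
    exact hβ' q r hr
  rw [hasDerivAt_iff_tendsto_slope, tendsto_iff_norm_sub_tendsto_zero]
  set D : ℝ → 𝓢(Fin n → ℝ, ℂ) := fun s =>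
    ((s⁻¹ : ℝ) : ℂ) • (weylSchwartz (s • ξ) φ - φ) - weylGen ξ φ with hD
  have hslope : ∀ s : ℝ, slope (fun s : ℝ => (weylSchwartz (s • ξ) φ).toLp 2 volume) 0 s -
      (weylGen ξ φ).toLp 2 volume = (D s).toLp 2 volume := by
    intro s
    rw [slope_def_module, sub_zero, hw0, hD]
    change _ = SchwartzMap.toLpCLM ℂ ℂ 2 volume _
    rw [map_sub, map_smul, map_sub]
    rfl
  -- The mean value inequality bounds the difference quotient by β, and the generator itself
  -- contributes another β.
  have hbound : ∀ s ∈ Set.Icc (-1 : ℝ) 1, s ≠ 0 → ∀ q, ‖D s q‖ ≤ 2 * β q := by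
    intro s hs hs0 q
    have h1 : ‖weylSchwartz (s • ξ) φ q - weylSchwartz ((0 : ℝ) • ξ) φ q‖ ≤ β q * ‖s - 0‖ :=
      (convex_Icc (-1 : ℝ) 1).norm_image_sub_le_of_norm_hasDerivWithin_le
        (f' := fun r => weylSchwartz (r • ξ) (weylGen ξ φ) q)
        (fun r _ => (hasDerivAt_weylSchwartz_apply ξ φ q r).hasDerivWithinAt)
        (fun r hr => hgen q r hr) (by norm_num) hs
    have h2 := hgen q 0 (by norm_num)
    rw [hw0] at h1 h2
    rw [sub_zero] at h1
    simp only [hD, _root_.sub_apply, _root_.smul_apply, smul_eq_mul]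
    refine (norm_sub_le _ _).trans ?_
    rw [norm_mul, Complex.norm_real, norm_inv]
    have h3 : ‖s‖⁻¹ * ‖weylSchwartz (s • ξ) φ q - φ q‖ ≤ β q := by
      rw [inv_mul_le_iff₀ (norm_pos_iff.2 hs0), mul_comm]
      exact h1
    linarith
  have hptw : ∀ q, Filter.Tendsto (fun s => D s q) (nhdsWithin 0 {0}ᶜ) (nhds 0) := by
    intro q
    have h1 := (hasDerivAt_iff_tendsto_slope.1 (hasDerivAt_weylSchwartz_apply ξ φ q 0)).sub_const
      (weylGen ξ φ q)
    rw [hw0, sub_self] at h1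
    refine h1.congr fun s => ?_
    simp only [slope_def_module, sub_zero, hw0, hD, _root_.sub_apply,
      _root_.smul_apply, smul_eq_mul, Complex.real_smul]
  have hint : Filter.Tendsto (fun s => ∫ q, ‖D s q‖ ^ 2) (nhdsWithin 0 {0}ᶜ) (nhds 0) := by
    have h0 := tendsto_integral_filter_of_dominated_convergence (μ := volume)
      (F := fun s q => ‖D s q‖ ^ 2) (f := fun _ => 0) (l := nhdsWithin (0 : ℝ) {0}ᶜ)
      (fun q => 4 * β q ^ 2) ?_ ?_ (hβ.const_mul 4) ?_
    · simpa using h0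
    · exact Filter.Eventually.of_forall fun s =>
        ((D s).continuous.norm.pow 2).aestronglyMeasurable
    · have hmem : Set.Icc (-1 : ℝ) 1 ∈ nhdsWithin (0 : ℝ) {0}ᶜ :=
        mem_nhdsWithin_of_mem_nhds (Icc_mem_nhds (by norm_num) (by norm_num))
      filter_upwards [hmem, self_mem_nhdsWithin] with s hs hs0
      refine Filter.Eventually.of_forall fun q => ?_
      rw [Real.norm_of_nonneg (by positivity)]
      have := hbound s hs hs0 q
      calc ‖D s q‖ ^ 2 ≤ (2 * β q) ^ 2 := by gcongr
        _ = 4 * β q ^ 2 := by ring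
    · refine Filter.Eventually.of_forall fun q => ?_
      simpa using (hptw q).norm.pow 2
  simp only [hslope]
  have h2 : ∀ s, ‖(D s).toLp 2 volume‖ = Real.sqrt (∫ q, ‖D s q‖ ^ 2) := fun s => by
    rw [← norm_toLp_sq, Real.sqrt_sq (norm_nonneg _)]
  simp only [h2]
  simpa using hint.sqrt

/-! ### Gaussian unitaries intertwine Weyl operators -/

variable {S : Matrix (Fin 2 × Fin n) (Fin 2 × Fin n) ℝ} {U : Modes n ≃ₗᵢ[ℂ] Modes n}

/-- A linear combination of the defining relations of U; the two terms cancel since the inner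
product conjugates i in its first argument. -/
theorem IsGaussianUnitary.inner_weylGen (hU : IsGaussianUnitary S U) (ξ : Fin 2 × Fin n → ℝ)
    (φ ψ : 𝓢(Fin n → ℝ, ℂ)) :
    inner ℂ ((weylGen ξ φ).toLp 2 volume) (U (ψ.toLp 2 volume)) +
      inner ℂ (φ.toLp 2 volume) (U ((weylGen (Sᵀ *ᵥ ξ) ψ).toLp 2 volume)) = 0 := by
  have e1 : (weylGen ξ φ).toLp 2 volume =
      ∑ k, (Complex.I * ξ k) • (canonicalOp k φ).toLp 2 volume := by
    change SchwartzMap.toLpCLM ℂ ℂ 2 volume _ = _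
    rw [weylGen, map_sum]
    simp only [map_smul]
    rfl
  have e2 : (weylGen (Sᵀ *ᵥ ξ) ψ).toLp 2 volume =
      ∑ i, (Complex.I * ξ i) • (∑ k, (S i k : ℂ) • canonicalOp k ψ).toLp 2 volume := by
    change SchwartzMap.toLpCLM ℂ ℂ 2 volume _ =
      ∑ i, (Complex.I * ξ i) • SchwartzMap.toLpCLM ℂ ℂ 2 volume _
    simp only [weylGen, map_sum, map_smul, Finset.smul_sum, smul_smul]
    rw [Finset.sum_comm]
    refine Finset.sum_congr rfl fun k _ => ?_
    rw [← Finset.sum_smul]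
    congr 1
    simp only [Matrix.mulVec, dotProduct, Matrix.transpose_apply]
    push_cast
    rw [Finset.mul_sum]
    exact Finset.sum_congr rfl fun i _ => by ring
  rw [e1, e2, sum_inner, map_sum, inner_sum, ← Finset.sum_add_distrib]
  refine Finset.sum_eq_zero fun i _ => ?_
  rw [inner_smul_left, map_smul, inner_smul_right, hU i φ ψ]
  simp

/-- For Schwartz functions, ⟨W(tξ)φ, U W(tSᵀξ)ψ⟩ has zero derivative in t by `inner_weylGen`;
compare t = 0 with t = 1 and extend by density. -/
theorem IsGaussianUnitary.inner_weyl_weyl (hU : IsGaussianUnitary S U) (ξ : Fin 2 × Fin n → ℝ)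
    (f g : Modes n) :
    inner ℂ (weyl ξ f) (U (weyl (Sᵀ *ᵥ ξ) g)) = inner ℂ f (U g) := by
  have hS : ∀ φ ψ : 𝓢(Fin n → ℝ, ℂ),
      inner ℂ (weyl ξ (φ.toLp 2 volume)) (U (weyl (Sᵀ *ᵥ ξ) (ψ.toLp 2 volume))) =
        inner ℂ (φ.toLp 2 volume) (U (ψ.toLp 2 volume)) := by
    intro φ ψ
    set η := Sᵀ *ᵥ ξ with hη
    set h : ℝ → ℂ := fun t => inner ℂ ((weylSchwartz (t • ξ) φ).toLp 2 volume)
      (U ((weylSchwartz (t • η) ψ).toLp 2 volume)) with hh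
    have hderiv : ∀ t, HasDerivAt h 0 t := by
      intro t
      have h1 := hasDerivAt_toLp_weylSchwartz ξ (weylSchwartz (t • ξ) φ)
      have h2 := hasDerivAt_toLp_weylSchwartz η (weylSchwartz (t • η) ψ)
      have h3 := ((U.toContinuousLinearEquiv : Modes n →L[ℂ] Modes n).restrictScalars
        ℝ).hasFDerivAt.comp_hasDerivAt 0 h2
      have h4 := h1.inner ℂ h3
      have h5 : HasDerivAt (fun s => h (t + s)) 0 0 := by
        refine (h4.congr_deriv ?_).congr_of_eventuallyEq
          (Filter.Eventually.of_forall fun s => ?_)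
        · have hz : ∀ (ζ : Fin 2 × Fin n → ℝ) (χ : 𝓢(Fin n → ℝ, ℂ)),
              weylSchwartz ((0 : ℝ) • ζ) χ = χ := by
            intro ζ χ
            ext q
            rw [weylSchwartz_apply]
            have : (fun j => ((0 : ℝ) • ζ) (1, j)) = (0 : Fin n → ℝ) := by funext j; simp
            rw [this]
            simp [weylPhase]
          simp only [hz, Function.comp_apply]
          rw [add_comm]
          exact hU.inner_weylGen ξ _ _
        · simp only [hh, weylSchwartz_add_smul]
          rfl
      have h6 := HasDerivAt.comp_const_add (-t) t (f := fun s => h (t + s)) (by simpa using h5)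
      simpa using h6
    have hconst := is_const_of_deriv_eq_zero (fun t => (hderiv t).differentiableAt)
      (fun t => (hderiv t).deriv) 1 0
    simp only [hh, one_smul, toLp_weylSchwartz, zero_smul] at hconst
    have hz : ∀ χ : Modes n, weyl (0 : Fin 2 × Fin n → ℝ) χ = χ := by
      intro χ
      ext1
      filter_upwards [coeFn_weyl (0 : Fin 2 × Fin n → ℝ) χ] with q hq
      rw [hq]
      have : (fun j => (0 : Fin 2 × Fin n → ℝ) (1, j)) = (0 : Fin n → ℝ) := rfl
      rw [this]
      simp
    rw [hz, hz] at hconst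
    exact hconst
  have hd : DenseRange fun φ : 𝓢(Fin n → ℝ, ℂ) => φ.toLp 2 (volume : Measure (Fin n → ℝ)) :=
    SchwartzMap.denseRange_toLpCLM (by simp)
  have hd2 := hd.prodMap hd
  have := DenseRange.equalizer hd2 (g := fun p : Modes n × Modes n =>
      inner ℂ (weyl ξ p.1) (U (weyl (Sᵀ *ᵥ ξ) p.2)))
    (h := fun p : Modes n × Modes n => inner ℂ p.1 (U p.2))
    (by have h1 := (weyl ξ).continuous
        have h2 := (weyl (Sᵀ *ᵥ ξ)).continuous
        have h3 := U.continuous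
        fun_prop)
    (by have h3 := U.continuous
        fun_prop) (by funext p; exact hS p.1 p.2)
  exact congrFun this (f, g)

/-- `U D(Sᵀ ξ) U⁻¹ = D(ξ)`. -/
theorem IsGaussianUnitary.conj_weyl (hU : IsGaussianUnitary S U) (ξ : Fin 2 × Fin n → ℝ)
    (w : Modes n) : U (weyl (Sᵀ *ᵥ ξ) (U.symm w)) = weyl ξ w := by
  have h1 := hU.inner_weyl_weyl ξ w (U.symm w)
  rw [LinearIsometryEquiv.apply_symm_apply] at h1
  -- Both vectors have norm ‖w‖ and their inner product is ‖w‖², so they coincide.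
  rw [← sub_eq_zero, ← norm_eq_zero, ← sq_eq_zero_iff, norm_sub_rev, @norm_sub_sq ℂ, h1]
  simp only [LinearIsometryEquiv.norm_map, LinearIsometry.norm_map, inner_self_eq_norm_sq]
  ring

end

section

/-! ### Wave functions of coherent states -/

/-- The Hermite polynomials with complex coefficients. -/
def hermiteC (k : ℕ) : Polynomial ℂ := (Polynomial.hermite k).map (Int.castRingHom ℂ)

theorem hermiteC_succ (k : ℕ) :
    hermiteC (k + 1) = Polynomial.X * hermiteC k - Polynomial.derivative (hermiteC k) := by
  simp [hermiteC, Polynomial.hermite_succ, Polynomial.derivative_map]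

theorem sqrt_two_mul_self : (Real.sqrt 2 : ℂ) * (Real.sqrt 2 : ℂ) = 2 := by
  rw [← Complex.ofReal_mul, Real.mul_self_sqrt (by norm_num)]
  norm_num

theorem sqrt_two_ne_zero : (Real.sqrt 2 : ℂ) ≠ 0 := by
  intro h
  have := sqrt_two_mul_self
  simp [h] at this

theorem hasDerivAt_vacuumFun (q : ℝ) : HasDerivAt vacuumFun (-q * vacuumFun q) q := by
  have h0 : HasDerivAt (fun q : ℝ => -q ^ 2 / 2) (-q) q := by
    refine (((hasDerivAt_pow 2 q).neg).div_const 2).congr_deriv ?_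
    norm_num
    ring
  refine ((h0.exp.const_mul (Real.pi ^ (-(1 / 4) : ℝ))).ofReal_comp).congr_deriv ?_
  simp only [vacuumFun]
  push_cast
  ring

/-- On p(√2 q) times the vacuum, creation replaces p by X p - p', the recursion of the probabilists'
Hermite polynomials. -/
theorem creation_iterate_vacuumFun (k : ℕ) (q : ℝ) : (creation^[k] vacuumFun) q =
    (hermiteC k).eval (Real.sqrt 2 * q : ℂ) * vacuumFun q := by
  induction k generalizing q with
  | zero => simp [hermiteC]
  | succ k ih =>
    rw [Function.iterate_succ_apply']
    have hf : (creation^[k] vacuumFun) =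
        fun q : ℝ => (hermiteC k).eval (Real.sqrt 2 * q : ℂ) * vacuumFun q := funext ih
    have h1 : HasDerivAt (fun q : ℝ => (hermiteC k).eval (Real.sqrt 2 * q : ℂ))
        ((hermiteC k).derivative.eval (Real.sqrt 2 * q : ℂ) * (Real.sqrt 2 : ℂ)) q := by
      have h2 : HasDerivAt (fun z : ℂ => (hermiteC k).eval (Real.sqrt 2 * z : ℂ))
          ((hermiteC k).derivative.eval (Real.sqrt 2 * q : ℂ) * (Real.sqrt 2 : ℂ)) (q : ℂ) := by
        have h3 : HasDerivAt (fun z : ℂ => (Real.sqrt 2 * z : ℂ)) (Real.sqrt 2 : ℂ) (q : ℂ) := by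
          simpa using (hasDerivAt_id (q : ℂ)).const_mul (Real.sqrt 2 : ℂ)
        exact ((hermiteC k).hasDerivAt (Real.sqrt 2 * q : ℂ)).comp (q : ℂ) h3
      exact h2.comp_ofReal
    simp only [creation, hf]
    rw [(h1.fun_mul (hasDerivAt_vacuumFun q)).deriv, hermiteC_succ, div_eq_iff sqrt_two_ne_zero]
    simp only [Polynomial.eval_sub, Polynomial.eval_mul, Polynomial.eval_X]
    linear_combination (-(q : ℂ) * Polynomial.eval (Real.sqrt 2 * q : ℂ) (hermiteC k) *
      vacuumFun q) * sqrt_two_mul_self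

/-- The generating function of the Hermite polynomials. -/
def hermiteGen (x α : ℂ) : ℂ := Complex.exp (x * α - α ^ 2 / 2)

theorem hasDerivAt_hermiteGen (x α : ℂ) :
    HasDerivAt (hermiteGen x) ((x - α) * hermiteGen x α) α := by
  have h : HasDerivAt (fun α : ℂ => x * α - α ^ 2 / 2) (x - α) α := by
    refine (((hasDerivAt_id α).const_mul x).sub ((hasDerivAt_pow 2 α).div_const 2)).congr_deriv ?_
    simp
  refine h.cexp.congr_deriv ?_
  rw [hermiteGen, mul_comm]

/-- The formula at every α makes the induction run; α = 0 gives the Taylor coefficients. -/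
theorem iteratedDeriv_hermiteGen (x : ℂ) (k : ℕ) :
    iteratedDeriv k (hermiteGen x) = fun α => (hermiteC k).eval (x - α) * hermiteGen x α := by
  induction k with
  | zero => funext α; simp [hermiteC]
  | succ k ih =>
    rw [iteratedDeriv_succ, ih]
    funext α
    have h1 : HasDerivAt (fun α : ℂ => (hermiteC k).eval (x - α))
        (-(hermiteC k).derivative.eval (x - α)) α := by
      have h3 : HasDerivAt (fun z : ℂ => x - z) (-1) α := by
        simpa using (hasDerivAt_id α).const_sub x
      exact (((hermiteC k).hasDerivAt (x - α)).comp α h3).congr_deriv (by ring)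
    rw [(h1.fun_mul (hasDerivAt_hermiteGen x α)).deriv, hermiteC_succ]
    simp only [Polynomial.eval_sub, Polynomial.eval_mul, Polynomial.eval_X]
    ring

theorem differentiable_hermiteGen (x : ℂ) : Differentiable ℂ (hermiteGen x) :=
  fun α => (hasDerivAt_hermiteGen x α).differentiableAt

theorem hasSum_hermiteGen (x α : ℂ) :
    HasSum (fun k : ℕ => (α ^ k / (k.factorial : ℂ)) * (hermiteC k).eval x) (hermiteGen x α) := by
  have h := Complex.hasSum_taylorSeries_of_entire (differentiable_hermiteGen x) 0 α
  refine h.congr_fun fun k => ?_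
  rw [iteratedDeriv_hermiteGen]
  simp [hermiteGen]
  ring

/-- Cauchy's estimate for the generating function on the circle of radius r. -/
theorem norm_hermiteC_eval_le (x : ℂ) (k : ℕ) {r : ℝ} (hr : 0 < r) :
    ‖(hermiteC k).eval x‖ ≤ k.factorial * Real.exp (‖x‖ * r + r ^ 2 / 2) / r ^ k := by
  have h := Complex.norm_iteratedDeriv_le_of_forall_mem_sphere_norm_le (c := 0) (R := r)
    (C := Real.exp (‖x‖ * r + r ^ 2 / 2)) (f := hermiteGen x) k hr
    (differentiable_hermiteGen x).diffContOnCl ?_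
  · rw [iteratedDeriv_hermiteGen] at h
    simpa [hermiteGen] using h
  · intro z hz
    have hz' : ‖z‖ = r := by simpa using hz
    rw [hermiteGen, Complex.norm_exp]
    refine Real.exp_le_exp.2 ((Complex.re_le_norm _).trans ((norm_sub_le _ _).trans ?_))
    simp [hz']

theorem integrable_exp_mul_abs_sub_sq (t : ℝ) :
    Integrable (fun q : ℝ => Real.exp (t * |q| - q ^ 2)) := by
  have h (s : ℝ) : Integrable fun q : ℝ => Real.exp (s * q - q ^ 2) := by
    have := (integrable_cexp_quadratic (b := 1) (by simp) (s : ℂ) 0).norm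
    refine this.congr (Filter.Eventually.of_forall fun q => ?_)
    simp only [Complex.norm_exp]
    congr 1
    have : (-1 * (q : ℂ) ^ 2 + s * q + 0) = ((s * q - q ^ 2 : ℝ) : ℂ) := by push_cast; ring
    rw [this, Complex.ofReal_re]
  refine ((h t).add (h (-t))).mono' (by fun_prop) (Filter.Eventually.of_forall fun q => ?_)
  simp only [Real.norm_eq_abs, Real.abs_exp, Pi.add_apply]
  rcases abs_cases q with ⟨hq, _⟩ | ⟨hq, _⟩ <;> rw [hq]
  · linarith [Real.exp_pos (-t * q - q ^ 2)]
  · rw [mul_neg, ← neg_mul]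
    linarith [Real.exp_pos (t * q - q ^ 2)]

theorem continuous_vacuumFun : Continuous vacuumFun := by
  unfold vacuumFun
  fun_prop

theorem norm_vacuumFun_sq (q : ℝ) :
    ‖vacuumFun q‖ ^ 2 = Real.pi ^ (-(1 / 2) : ℝ) * Real.exp (-q ^ 2) := by
  rw [vacuumFun, Complex.norm_real, Real.norm_eq_abs, sq_abs, mul_pow, ← Real.exp_nat_mul,
    ← Real.rpow_mul_natCast Real.pi_pos.le]
  congr 2
  · norm_num
  · push_cast; ring

theorem memLp_exp_mul_vacuumFun (t : ℝ) :
    MemLp (fun q : ℝ => (Real.exp (t * |q|) : ℂ) * vacuumFun q) 2 volume := by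
  have hc : Continuous fun q : ℝ => (Real.exp (t * |q|) : ℂ) * vacuumFun q := by
    have := continuous_vacuumFun
    fun_prop
  rw [memLp_two_iff_integrable_sq_norm hc.aestronglyMeasurable]
  refine ((integrable_exp_mul_abs_sub_sq (2 * t)).const_mul (Real.pi ^ (-(1 / 2) : ℝ))).congr
    (Filter.Eventually.of_forall fun q => ?_)
  simp only [norm_mul, mul_pow, norm_vacuumFun_sq, Complex.norm_real, Real.norm_eq_abs,
    Real.abs_exp, ← Real.exp_nat_mul]
  rw [mul_left_comm, ← Real.exp_add]
  congr 2
  push_cast; ring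

theorem coeFn_fock (k : ℕ) : (fock k : ℝ → ℂ) =ᵐ[volume] fun q =>
    (Real.sqrt k.factorial : ℂ)⁻¹ * ((hermiteC k).eval (Real.sqrt 2 * q : ℂ) * vacuumFun q) := by
  filter_upwards [(memLp_fockFun k).coeFn_toLp] with q hq
  rw [fock, hq, fockFun, creation_iterate_vacuumFun, div_eq_inv_mul]

/-- A crude estimate, but with r arbitrary: it gives normal convergence of the coherent series
without orthonormality of the Fock states. -/
theorem exists_norm_fock_le {r : ℝ} (hr : 0 < r) :
    ∃ C : ℝ, ∀ k, ‖fock k‖ ≤ Real.sqrt k.factorial / r ^ k * C := by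
  have hm := memLp_exp_mul_vacuumFun (Real.sqrt 2 * r)
  refine ⟨Real.exp (r ^ 2 / 2) * ‖hm.toLp‖, fun k => ?_⟩
  rw [← mul_assoc]
  refine Lp.norm_le_mul_norm_of_ae_le_mul ?_
  filter_upwards [coeFn_fock k, hm.coeFn_toLp] with q hq hq'
  rw [hq, hq', norm_mul, norm_mul, norm_mul, norm_inv]
  simp only [Complex.norm_real, Real.norm_eq_abs, Real.abs_exp, abs_of_nonneg (Real.sqrt_nonneg _)]
  have h := norm_hermiteC_eval_le (Real.sqrt 2 * q : ℂ) k hr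
  have hx : ‖(Real.sqrt 2 * q : ℂ)‖ = Real.sqrt 2 * |q| := by
    simp [abs_of_nonneg (Real.sqrt_nonneg _)]
  rw [hx, Real.exp_add] at h
  have hf : (0 : ℝ) < Real.sqrt k.factorial := Real.sqrt_pos.2 (by positivity)
  have hff : (k.factorial : ℝ) = Real.sqrt k.factorial * Real.sqrt k.factorial :=
    (Real.mul_self_sqrt (by positivity)).symm
  calc (Real.sqrt k.factorial)⁻¹ * (‖(hermiteC k).eval (Real.sqrt 2 * q : ℂ)‖ * ‖vacuumFun q‖)
      ≤ (Real.sqrt k.factorial)⁻¹ * ((k.factorial * (Real.exp (Real.sqrt 2 * |q| * r) *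
        Real.exp (r ^ 2 / 2)) / r ^ k) * ‖vacuumFun q‖) := by gcongr
    _ = _ := by
      rw [show Real.sqrt 2 * |q| * r = Real.sqrt 2 * r * |q| by ring]
      generalize Real.sqrt k.factorial = s at hf hff ⊢
      rw [hff]
      field_simp

theorem exists_summable_fock (R : ℝ) : ∃ u : ℕ → ℝ, Summable u ∧ ∀ (k : ℕ) (α : ℂ), ‖α‖ ≤ R →
    ‖(α ^ k / (Real.sqrt k.factorial : ℂ)) • fock k‖ ≤ u k := by
  -- This radius makes the series geometric with ratio below 1/2, and stays positive when R = 0.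
  have hr : (0 : ℝ) < 2 * |R| + 1 := by positivity
  obtain ⟨C, hC⟩ := exists_norm_fock_le hr
  refine ⟨fun k => (|R| / (2 * |R| + 1)) ^ k * C, ?_, fun k α hα => ?_⟩
  · refine (summable_geometric_of_lt_one (by positivity) ?_).mul_right C
    rw [div_lt_one hr]
    linarith [abs_nonneg R]
  · have hf : (0 : ℝ) < Real.sqrt k.factorial := Real.sqrt_pos.2 (by positivity)
    rw [norm_smul, norm_div, norm_pow, Complex.norm_real, Real.norm_eq_abs, abs_of_pos hf]
    have h0 : ‖α‖ ≤ |R| := hα.trans (le_abs_self R)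
    calc ‖α‖ ^ k / Real.sqrt k.factorial * ‖fock k‖
        ≤ |R| ^ k / Real.sqrt k.factorial *
          (Real.sqrt k.factorial / (2 * |R| + 1) ^ k * C) := by gcongr; exact hC k
      _ = (|R| / (2 * |R| + 1)) ^ k * C := by
        rw [div_pow]
        field_simp

/-- The unnormalised coherent vector `∑ₖ α^k / √(k!) |k⟩`. -/
def cohVec (α : ℂ) : Mode := ∑' k : ℕ, (α ^ k / (Real.sqrt (k.factorial) : ℂ)) • fock k

theorem coherentMode_eq (α : ℂ) :
    coherentMode α = ((Real.exp (-‖α‖ ^ 2 / 2) : ℝ) : ℂ) • cohVec α := rfl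

/-- The series converges uniformly on balls. Holomorphy in α is what the reproducing formula will
use. -/
theorem differentiable_cohVec : Differentiable ℂ cohVec := by
  intro α
  obtain ⟨u, hu, hle⟩ := exists_summable_fock (‖α‖ + 1)
  have h := Complex.differentiableOn_tsum_of_summable_norm (U := Metric.ball 0 (‖α‖ + 1)) hu
    (F := fun k α => (α ^ k / (Real.sqrt (k.factorial) : ℂ)) • fock k)
    (fun k => by
      refine Differentiable.differentiableOn ?_
      exact Differentiable.smul_const (by fun_prop) _) Metric.isOpen_ball
    (fun k w hw => hle k w (by simpa using (Metric.mem_ball.1 hw).le))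
  exact h.differentiableAt (Metric.isOpen_ball.mem_nhds (by simp))

/-- Absolute convergence in L² lets the sum be taken pointwise almost everywhere, where it is the
Hermite generating function. -/
theorem coeFn_cohVec (α : ℂ) : (cohVec α : ℝ → ℂ) =ᵐ[volume] fun q =>
    hermiteGen (Real.sqrt 2 * q : ℂ) α * vacuumFun q := by
  obtain ⟨u, hu, hle⟩ := exists_summable_fock ‖α‖
  have hs : Summable fun k : ℕ => ‖(α ^ k / (Real.sqrt (k.factorial) : ℂ)) • fock k‖ :=
    Summable.of_nonneg_of_le (fun _ => norm_nonneg _) (fun k => hle k α le_rfl) hu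
  have h := Lp.hasSum_coeFn_tsum (tsum_enorm_ne_top_iff_summable_norm.2 hs)
  have h2 : ∀ᵐ q : ℝ, ∀ k : ℕ, ((α ^ k / (Real.sqrt (k.factorial) : ℂ)) • fock k : Mode) q =
      (α ^ k / (k.factorial : ℂ)) * (hermiteC k).eval (Real.sqrt 2 * q : ℂ) * vacuumFun q := by
    rw [ae_all_iff]
    intro k
    filter_upwards [Lp.coeFn_smul (α ^ k / (Real.sqrt (k.factorial) : ℂ)) (fock k),
      coeFn_fock k] with q h1 h2
    rw [h1, Pi.smul_apply, h2, smul_eq_mul]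
    have hff : (k.factorial : ℂ) = Real.sqrt k.factorial * Real.sqrt k.factorial := by
      rw [← Complex.ofReal_mul, Real.mul_self_sqrt (by positivity)]
      simp
    have hf : (Real.sqrt k.factorial : ℂ) ≠ 0 := by
      have : (0 : ℝ) < Real.sqrt k.factorial := Real.sqrt_pos.2 (by positivity)
      exact_mod_cast this.ne'
    rw [hff]
    field_simp
  filter_upwards [h, h2] with q hq hq2
  have h3 := (hasSum_hermiteGen (Real.sqrt 2 * q : ℂ) α).mul_right (vacuumFun q)
  simp_rw [hq2] at hq
  exact hq.unique h3

theorem inner_cohVec (α β : ℂ) :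
    inner ℂ (cohVec α) (cohVec β) = Complex.exp (starRingEnd ℂ α * β) := by
  rw [L2.inner_def]
  have h : (fun q : ℝ => inner ℂ ((cohVec α : ℝ → ℂ) q) ((cohVec β : ℝ → ℂ) q)) =ᵐ[volume]
      fun q : ℝ => ((Real.pi ^ (-(1 / 2) : ℝ) : ℝ) : ℂ) * Complex.exp ((-1) * (q : ℂ) ^ 2 +
        (Real.sqrt 2 * (starRingEnd ℂ α + β)) * q + (-(starRingEnd ℂ α) ^ 2 / 2 - β ^ 2 / 2)) := by
    filter_upwards [coeFn_cohVec α, coeFn_cohVec β] with q h1 h2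
    have h3 : starRingEnd ℂ (vacuumFun q) * vacuumFun q =
        ((Real.pi ^ (-(1 / 2) : ℝ) : ℝ) : ℂ) * Complex.exp (-(q : ℂ) ^ 2) := by
      rw [← Complex.normSq_eq_conj_mul_self, Complex.normSq_eq_norm_sq, norm_vacuumFun_sq]
      push_cast
      rfl
    rw [h1, h2, RCLike.inner_apply', map_mul, hermiteGen, hermiteGen, ← Complex.exp_conj]
    simp only [map_sub, map_mul, map_pow, map_div₀, Complex.conj_ofReal, Complex.conj_ofNat]
    rw [mul_mul_mul_comm, h3, mul_left_comm, ← Complex.exp_add, ← Complex.exp_add]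
    congr 2
    ring
  rw [integral_congr_ae h, integral_const_mul, integral_cexp_quadratic (by simp)]
  have h4 : ((Real.pi : ℂ) / -(-1)) ^ (1 / 2 : ℂ) = ((Real.pi ^ (1 / 2 : ℝ) : ℝ) : ℂ) := by
    rw [Complex.ofReal_cpow Real.pi_pos.le]
    norm_num
  rw [h4, ← mul_assoc, ← Complex.ofReal_mul, ← Real.rpow_add Real.pi_pos]
  norm_num
  congr 1
  linear_combination (1 / 4 * (starRingEnd ℂ α + β) ^ 2) * sqrt_two_mul_self

theorem norm_cohVec (α : ℂ) : ‖cohVec α‖ = Real.exp (‖α‖ ^ 2 / 2) := by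
  have h : ‖cohVec α‖ ^ 2 = Real.exp (‖α‖ ^ 2 / 2) ^ 2 := by
    rw [← Real.exp_nat_mul]
    have := inner_self_eq_norm_sq_to_K (𝕜 := ℂ) (cohVec α)
    rw [inner_cohVec, ← Complex.normSq_eq_conj_mul_self, Complex.normSq_eq_norm_sq] at this
    have h2 : ((Real.exp (‖α‖ ^ 2) : ℝ) : ℂ) = ((‖cohVec α‖ ^ 2 : ℝ) : ℂ) := by
      push_cast at this ⊢
      exact this
    rw [← Complex.ofReal_injective h2]
    congr 1
    push_cast
    ring
  exact (pow_left_inj₀ (norm_nonneg _) (Real.exp_pos _).le two_ne_zero).1 h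

theorem norm_coherentMode (α : ℂ) : ‖coherentMode α‖ = 1 := by
  rw [coherentMode_eq, norm_smul, norm_cohVec, Complex.norm_real, Real.norm_eq_abs, Real.abs_exp,
    ← Real.exp_add]
  norm_num
  ring

theorem continuous_coherentMode : Continuous coherentMode := by
  have := differentiable_cohVec.continuous
  have h : Continuous fun α : ℂ => ((Real.exp (-‖α‖ ^ 2 / 2) : ℝ) : ℂ) := by fun_prop
  exact h.smul this

end

section

/-! ### Gaussian integrals of entire functions -/

/-- Used to absorb linear exponents into the slack of a Gaussian rate. -/
theorem mul_le_sq_add (t x : ℝ) {e : ℝ} (he : 0 < e) : t * x ≤ e * x ^ 2 + t ^ 2 / (4 * e) := by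
  have h : e * x ^ 2 + t ^ 2 / (4 * e) - t * x = (2 * e * x - t) ^ 2 / (4 * e) := by
    field_simp
    ring
  have : 0 ≤ (2 * e * x - t) ^ 2 / (4 * e) := by positivity
  linarith

theorem integrable_exp_neg_mul_norm_sq {c : ℝ} (hc : 0 < c) :
    Integrable fun γ : ℂ => Real.exp (-c * ‖γ‖ ^ 2) := by
  have := (GaussianFourier.integrable_cexp_neg_mul_sq_norm_add (V := ℂ) (b := (c : ℂ))
    (by simpa using hc) 0 0).norm
  refine this.congr (Filter.Eventually.of_forall fun γ => ?_)
  simp only [Complex.norm_exp]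
  congr 1
  have : (-(c : ℂ) * (‖γ‖ : ℂ) ^ 2 + 0 * ((inner ℝ (0 : ℂ) γ : ℝ) : ℂ)) =
      ((-c * ‖γ‖ ^ 2 : ℝ) : ℂ) := by
    push_cast; ring
  rw [this, Complex.ofReal_re]

theorem integral_exp_neg_mul_norm_sq {c : ℝ} (hc : 0 < c) :
    ∫ γ : ℂ, Real.exp (-c * ‖γ‖ ^ 2) = Real.pi / c := by
  have := GaussianFourier.integral_rexp_neg_mul_sq_norm (V := ℂ) hc
  rw [this]
  simp [Complex.finrank_real_complex]

/-- Mean value property of entire functions with respect to a Gaussian weight. -/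
theorem integral_gauss_mul_entire {c s C : ℝ} (hc : 0 < c) (hs : s < c) {g : ℂ → ℂ}
    (hg : Differentiable ℂ g) (hC : ∀ γ, ‖g γ‖ ≤ C * Real.exp (s * ‖γ‖ ^ 2)) :
    ∫ γ : ℂ, (Real.exp (-c * ‖γ‖ ^ 2) : ℂ) * g γ = (Real.pi / c : ℝ) * g 0 := by
  have hgc : Continuous g := hg.continuous
  -- The weight is rotation invariant, so g may be replaced by its mean over circles, which is g 0.
  have hrot (θ : ℝ) : ∫ γ : ℂ, (Real.exp (-c * ‖γ‖ ^ 2) : ℂ) * g (circleMap 0 1 θ * γ) =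
      ∫ γ : ℂ, (Real.exp (-c * ‖γ‖ ^ 2) : ℂ) * g γ := by
    have := (rotation (Circle.exp θ)).measurePreserving.integral_comp
      (rotation (Circle.exp θ)).toHomeomorph.measurableEmbedding
      (fun γ : ℂ => (Real.exp (-c * ‖γ‖ ^ 2) : ℂ) * g γ)
    rw [← this]
    refine integral_congr_ae (Filter.Eventually.of_forall fun γ => ?_)
    simp [rotation_apply, Circle.coe_exp, circleMap_zero]
  have hmean (γ : ℂ) : ∫ θ in (0 : ℝ)..2 * Real.pi, g (circleMap 0 1 θ * γ) =
      ((2 * Real.pi : ℝ) : ℂ) * g 0 := by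
    have hd : Differentiable ℂ fun z => g (z * γ) := hg.comp (differentiable_id.mul_const γ)
    have := DiffContOnCl.circleAverage (f := fun z => g (z * γ)) (c := 0) (R := 1)
      hd.diffContOnCl
    rw [Real.circleAverage_def, inv_smul_eq_iff₀ (by positivity)] at this
    rw [this, zero_mul, Complex.real_smul]
  have hint : Integrable (fun p : ℝ × ℂ => (Real.exp (-c * ‖p.2‖ ^ 2) : ℂ) *
      g (circleMap 0 1 p.1 * p.2))
      ((volume.restrict (Set.Ioc 0 (2 * Real.pi))).prod (volume : Measure ℂ)) := by
    have h1 := (integrable_exp_neg_mul_norm_sq (c := c - s) (by linarith)).const_mul C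
    refine (h1.comp_snd (volume.restrict (Set.Ioc 0 (2 * Real.pi)))).mono' ?_
      (Filter.Eventually.of_forall fun p => ?_)
    · refine Continuous.aestronglyMeasurable ?_
      have := continuous_circleMap 0 1
      fun_prop
    · rw [norm_mul, Complex.norm_real, Real.norm_eq_abs, Real.abs_exp]
      calc Real.exp (-c * ‖p.2‖ ^ 2) * ‖g (circleMap 0 1 p.1 * p.2)‖
          ≤ Real.exp (-c * ‖p.2‖ ^ 2) * (C * Real.exp (s * ‖p.2‖ ^ 2)) := by
            gcongr
            simpa using hC (circleMap 0 1 p.1 * p.2)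
        _ = C * Real.exp (-(c - s) * ‖p.2‖ ^ 2) := by
            rw [mul_left_comm, ← Real.exp_add]
            congr 2
            ring
  have hswap := integral_integral_swap (f := fun (θ : ℝ) (γ : ℂ) =>
    (Real.exp (-c * ‖γ‖ ^ 2) : ℂ) * g (circleMap 0 1 θ * γ)) hint
  simp only [hrot, integral_const_mul] at hswap
  simp_rw [← intervalIntegral.integral_of_le (a := (0 : ℝ)) (b := 2 * Real.pi) (μ := volume)
    (by positivity), hmean] at hswap
  rw [intervalIntegral.integral_const, integral_mul_const, integral_complex_ofReal,
    integral_exp_neg_mul_norm_sq hc, Complex.real_smul, sub_zero] at hswap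
  have hpi : ((2 * Real.pi : ℝ) : ℂ) ≠ 0 := by
    exact_mod_cast (by positivity : (2 * Real.pi : ℝ) ≠ 0)
  refine mul_left_cancel₀ hpi (hswap.trans ?_)
  ring

/-- The reproducing formula of the Fock space of entire functions. -/
theorem integral_reproducing {c s C : ℝ} (hs0 : 0 ≤ s) (hs : s < c) {f : ℂ → ℂ}
    (hf : Differentiable ℂ f) (hC : ∀ γ, ‖f γ‖ ≤ C * Real.exp (s * ‖γ‖ ^ 2)) (α : ℂ) :
    ∫ β : ℂ, Complex.exp (c * starRingEnd ℂ β * α - c * ‖β‖ ^ 2) * f β =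
      (Real.pi / c : ℝ) * f α := by
  have hC0 : 0 ≤ C := by
    have := (norm_nonneg _).trans (hC 0)
    simpa using this
  -- For β = γ + α the exponent becomes -c|γ|² - c ᾱ γ: a centred Gaussian times a function
  -- holomorphic in γ.
  rw [← integral_add_right_eq_self _ α]
  have hd : Differentiable ℂ fun γ : ℂ => Complex.exp (-(c * starRingEnd ℂ α * γ)) * f (γ + α) := by
    have : Differentiable ℂ fun γ : ℂ => f (γ + α) := hf.comp (differentiable_id.add_const α)
    fun_prop
  have he : 0 < (c - s) / 2 := by linarith
  have hb : ∀ γ : ℂ, ‖Complex.exp (-(c * starRingEnd ℂ α * γ)) * f (γ + α)‖ ≤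
      (C * Real.exp (s * ‖α‖ ^ 2 + (c * ‖α‖ + 2 * s * ‖α‖) ^ 2 / (4 * ((c - s) / 2)))) *
        Real.exp ((s + c) / 2 * ‖γ‖ ^ 2) := by
    intro γ
    rw [norm_mul, Complex.norm_exp]
    have h1 : (-(c * starRingEnd ℂ α * γ)).re ≤ c * ‖α‖ * ‖γ‖ := by
      refine (Complex.re_le_norm _).trans ?_
      rw [norm_neg, norm_mul, norm_mul, Complex.norm_real, Complex.norm_conj, Real.norm_eq_abs,
        abs_of_pos (by linarith)]
    have h2 : ‖f (γ + α)‖ ≤ C * Real.exp (s * (‖γ‖ + ‖α‖) ^ 2) := by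
      refine (hC _).trans ?_
      have := norm_add_le γ α
      gcongr
    calc _ ≤ Real.exp (c * ‖α‖ * ‖γ‖) * (C * Real.exp (s * (‖γ‖ + ‖α‖) ^ 2)) := by gcongr
      _ = C * Real.exp (c * ‖α‖ * ‖γ‖ + s * (‖γ‖ + ‖α‖) ^ 2) := by
        rw [Real.exp_add]; ring
      _ ≤ C * Real.exp ((s * ‖α‖ ^ 2 + (c * ‖α‖ + 2 * s * ‖α‖) ^ 2 / (4 * ((c - s) / 2))) +
          (s + c) / 2 * ‖γ‖ ^ 2) := by
        refine mul_le_mul_of_nonneg_left (Real.exp_le_exp.2 ?_) hC0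
        have := mul_le_sq_add (c * ‖α‖ + 2 * s * ‖α‖) ‖γ‖ he
        linarith
      _ = _ := by rw [Real.exp_add]; ring
  have h := integral_gauss_mul_entire (c := c) (s := (s + c) / 2) (by linarith) (by linarith) hd hb
  rw [mul_zero, neg_zero, Complex.exp_zero, one_mul, zero_add] at h
  rw [← h]
  refine integral_congr_ae (Filter.Eventually.of_forall fun γ => ?_)
  simp only []
  rw [← mul_assoc, Complex.ofReal_exp, ← Complex.exp_add]
  congr 2
  have h3 : ∀ z : ℂ, ((‖z‖ : ℝ) : ℂ) ^ 2 = starRingEnd ℂ z * z := fun z => by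
    rw [← Complex.normSq_eq_conj_mul_self, Complex.normSq_eq_norm_sq]
    push_cast; rfl
  push_cast
  rw [h3, h3, map_add]
  ring

/-- Shifting the holomorphic argument in a Gaussian integral of a sesqui-holomorphic kernel. -/
theorem integral_gauss_shift {c s C : ℝ} (hs0 : 0 ≤ s) (hs : s < c / 2) {K : ℂ → ℂ → ℂ}
    (hK₁ : ∀ β, Differentiable ℂ fun α => starRingEnd ℂ (K α β)) (hK₂ : ∀ α, Differentiable ℂ (K α))
    (hK : Continuous fun p : ℂ × ℂ => K p.1 p.2)
    (hC : ∀ α β, ‖K α β‖ ≤ C * Real.exp (s * (‖α‖ ^ 2 + ‖β‖ ^ 2))) (δ : ℂ) :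
    ∫ α : ℂ, (Real.exp (-c * ‖α‖ ^ 2) : ℂ) * K α (α + δ) =
      ∫ β : ℂ, (Real.exp (-c * ‖β‖ ^ 2) : ℂ) * (Complex.exp (c * starRingEnd ℂ β * δ) * K β β) := by
  have hc : 0 < c := by linarith
  have hsc : s < c := by linarith
  have hC0 : 0 ≤ C := by
    have := (norm_nonneg _).trans (hC 0 0)
    simpa using this
  have hrep₂ (α : ℂ) : ∫ β : ℂ, Complex.exp (c * starRingEnd ℂ β * (α + δ) - c * ‖β‖ ^ 2) * K α β =
      (Real.pi / c : ℝ) * K α (α + δ) :=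
    integral_reproducing (C := C * Real.exp (s * ‖α‖ ^ 2)) hs0 hsc (hK₂ α) (fun β => by
      refine (hC α β).trans (le_of_eq ?_)
      rw [mul_add, Real.exp_add]; ring) (α + δ)
  have hrep₁ (β : ℂ) : ∫ α : ℂ, Complex.exp (c * starRingEnd ℂ β * α - c * ‖α‖ ^ 2) * K α β =
      (Real.pi / c : ℝ) * K β β := by
    have := integral_reproducing (C := C * Real.exp (s * ‖β‖ ^ 2)) hs0 hsc (hK₁ β) (fun α => by
      rw [Complex.norm_conj]
      refine (hC α β).trans (le_of_eq ?_)
      rw [mul_add, Real.exp_add]; ring) β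
    apply_fun starRingEnd ℂ at this
    rw [← integral_conj] at this
    simp only [map_mul, ← Complex.exp_conj, Complex.conj_conj, map_sub, map_pow,
      Complex.conj_ofReal] at this
    rw [← this]
    refine integral_congr_ae (Filter.Eventually.of_forall fun α => ?_)
    simp only []
    congr 2
    ring
  have hκ : 0 < (c / 2 - s) / 2 := by linarith
  -- Both sides of the claim are iterated integrals of this one function: integrating over β first
  -- reproduces K at (α, α+δ), over α first at (β, β). Since |α||β| ≤ (|α|² + |β|²)/2, the Gaussian
  -- factor decays at rate c/2, hence the condition s < c/2.
  have hint : Integrable (fun p : ℂ × ℂ => (Real.exp (-c * ‖p.1‖ ^ 2) : ℂ) *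
      (Complex.exp (c * starRingEnd ℂ p.2 * (p.1 + δ) - c * ‖p.2‖ ^ 2) * K p.1 p.2))
      ((volume : Measure ℂ).prod (volume : Measure ℂ)) := by
    have h1 := ((integrable_exp_neg_mul_norm_sq hκ).mul_prod
      (integrable_exp_neg_mul_norm_sq hκ)).const_mul
      (C * Real.exp ((c * ‖δ‖) ^ 2 / (4 * ((c / 2 - s) / 2))))
    refine h1.mono' ?_ (Filter.Eventually.of_forall fun p => ?_)
    · refine Continuous.aestronglyMeasurable ?_
      have := Complex.continuous_conj
      fun_prop
    · rw [norm_mul, norm_mul, Complex.norm_real, Real.norm_eq_abs, Real.abs_exp, Complex.norm_exp]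
      have h2 : (c * starRingEnd ℂ p.2 * (p.1 + δ) - c * ‖p.2‖ ^ 2 : ℂ).re ≤
          c * ‖p.2‖ * (‖p.1‖ + ‖δ‖) - c * ‖p.2‖ ^ 2 := by
        have h3 : (c * starRingEnd ℂ p.2 * (p.1 + δ)).re ≤ c * ‖p.2‖ * (‖p.1‖ + ‖δ‖) := by
          refine (Complex.re_le_norm _).trans ?_
          rw [norm_mul, norm_mul, Complex.norm_real, Complex.norm_conj, Real.norm_eq_abs,
            abs_of_pos hc]
          have := norm_add_le p.1 δ
          gcongr
        have h4 : ((c : ℂ) * (‖p.2‖ : ℂ) ^ 2).re = c * ‖p.2‖ ^ 2 := by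
          rw [← Complex.ofReal_pow, ← Complex.ofReal_mul, Complex.ofReal_re]
        rw [Complex.sub_re, h4]
        linarith
      have h5 := hC p.1 p.2
      calc _ ≤ Real.exp (-c * ‖p.1‖ ^ 2) * (Real.exp (c * ‖p.2‖ * (‖p.1‖ + ‖δ‖) - c * ‖p.2‖ ^ 2) *
            (C * Real.exp (s * (‖p.1‖ ^ 2 + ‖p.2‖ ^ 2)))) := by gcongr
        _ = C * Real.exp (-c * ‖p.1‖ ^ 2 + (c * ‖p.2‖ * (‖p.1‖ + ‖δ‖) - c * ‖p.2‖ ^ 2) +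
            s * (‖p.1‖ ^ 2 + ‖p.2‖ ^ 2)) := by
          rw [Real.exp_add, Real.exp_add]; ring
        _ ≤ C * Real.exp ((c * ‖δ‖) ^ 2 / (4 * ((c / 2 - s) / 2)) +
            (-((c / 2 - s) / 2) * ‖p.1‖ ^ 2 + -((c / 2 - s) / 2) * ‖p.2‖ ^ 2)) := by
          refine mul_le_mul_of_nonneg_left (Real.exp_le_exp.2 ?_) hC0
          have h6 := mul_le_sq_add (c * ‖δ‖) ‖p.2‖ hκ
          have h7 : 0 ≤ c / 2 * (‖p.1‖ - ‖p.2‖) ^ 2 := by positivity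
          have h8 : 0 ≤ (c / 2 - s) / 2 * ‖p.1‖ ^ 2 := by positivity
          linarith
        _ = _ := by rw [Real.exp_add, Real.exp_add]; ring
  have hswap := integral_integral_swap (f := fun (α β : ℂ) => (Real.exp (-c * ‖α‖ ^ 2) : ℂ) *
      (Complex.exp (c * starRingEnd ℂ β * (α + δ) - c * ‖β‖ ^ 2) * K α β)) hint
  have hL (α : ℂ) : ∫ β : ℂ, (Real.exp (-c * ‖α‖ ^ 2) : ℂ) *
      (Complex.exp (c * starRingEnd ℂ β * (α + δ) - c * ‖β‖ ^ 2) * K α β) =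
      (Real.pi / c : ℝ) * ((Real.exp (-c * ‖α‖ ^ 2) : ℂ) * K α (α + δ)) := by
    rw [integral_const_mul, hrep₂]; ring
  have hR (β : ℂ) : ∫ α : ℂ, (Real.exp (-c * ‖α‖ ^ 2) : ℂ) *
      (Complex.exp (c * starRingEnd ℂ β * (α + δ) - c * ‖β‖ ^ 2) * K α β) =
      (Real.pi / c : ℝ) * ((Real.exp (-c * ‖β‖ ^ 2) : ℂ) *
        (Complex.exp (c * starRingEnd ℂ β * δ) * K β β)) := by
    have h9 : (fun α : ℂ => (Real.exp (-c * ‖α‖ ^ 2) : ℂ) *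
        (Complex.exp (c * starRingEnd ℂ β * (α + δ) - c * ‖β‖ ^ 2) * K α β)) = fun α : ℂ =>
        ((Real.exp (-c * ‖β‖ ^ 2) : ℂ) * Complex.exp (c * starRingEnd ℂ β * δ)) *
          (Complex.exp (c * starRingEnd ℂ β * α - c * ‖α‖ ^ 2) * K α β) := by
      funext α
      simp only [← mul_assoc, Complex.ofReal_exp, ← Complex.exp_add]
      congr 2
      push_cast
      ring
    rw [h9, integral_const_mul, hrep₁]; ring
  simp only [hL, hR, integral_const_mul] at hswap
  refine mul_left_cancel₀ ?_ hswap
  exact_mod_cast (div_pos Real.pi_pos hc).ne'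

open scoped ComplexOrder in
/-- An integral of Gram matrices is positive semidefinite. -/
theorem posSemidef_integral_inner {X A H : Type} [MeasurableSpace A] {μ : Measure A}
    [NormedAddCommGroup H] [InnerProductSpace ℂ H] {Ψ : X → A → H}
    (hΨ : ∀ x y, Integrable (fun a => inner ℂ (Ψ x a) (Ψ y a)) μ) :
    (Matrix.of fun x y => ∫ a, inner ℂ (Ψ x a) (Ψ y a) ∂μ).PosSemidef := by
  refine ⟨?_, fun v => ?_⟩
  · ext x y
    simp only [Matrix.conjTranspose_apply, Matrix.of_apply, Complex.star_def]
    rw [← integral_conj]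
    simp only [inner_conj_symm]
  · have h : (v.sum fun i xi => v.sum fun j xj => star xi *
        (Matrix.of fun x y => ∫ a, inner ℂ (Ψ x a) (Ψ y a) ∂μ) i j * xj) =
        ∫ a, ((‖v.sum fun i xi => xi • Ψ i a‖ ^ 2 : ℝ) : ℂ) ∂μ := by
      have h1 (a : A) : ((‖v.sum fun i xi => xi • Ψ i a‖ ^ 2 : ℝ) : ℂ) =
          ∑ i ∈ v.support, ∑ j ∈ v.support,
            star (v i) * (inner ℂ (Ψ i a) (Ψ j a)) * v j := by
        have := inner_self_eq_norm_sq_to_K (𝕜 := ℂ) (v.sum fun i xi => xi • Ψ i a)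
        push_cast
        refine this.symm.trans ?_
        simp only [Finsupp.sum, sum_inner, inner_sum, inner_smul_left, inner_smul_right,
          Finset.mul_sum, Complex.star_def]
        rw [Finset.sum_comm]
        refine Finset.sum_congr rfl fun i _ => Finset.sum_congr rfl fun j _ => by ring
      simp only [h1]
      simp only [Finsupp.sum, Matrix.of_apply]
      have hi : ∀ i j, Integrable (fun a => star (v i) * (inner ℂ (Ψ i a) (Ψ j a)) * v j) μ :=
        fun i j => ((hΨ i j).const_mul _).mul_const _
      rw [integral_finsetSum _ fun i _ => integrable_finsetSum _ fun j _ => hi i j]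
      refine Finset.sum_congr rfl fun i _ => ?_
      rw [integral_finsetSum _ fun j _ => hi i j]
      refine Finset.sum_congr rfl fun j _ => ?_
      rw [integral_mul_const, integral_const_mul]
    rw [h, integral_complex_ofReal]
    exact_mod_cast integral_nonneg fun a => by positivity

end

section

/-! ### Positivity of the kernel of a local operation -/

/-- Strong continuity becomes joint continuity because every Weyl operator is isometric. -/
theorem continuous_weylMode_uncurry :
    Continuous fun p : (ℝ × ℝ) × Mode => weylMode p.1 p.2 := by
  rw [continuous_iff_continuousAt]
  rintro ⟨ξ₀, f₀⟩
  have h1 : Filter.Tendsto (fun p : (ℝ × ℝ) × Mode => weylMode p.1 f₀) (nhds (ξ₀, f₀))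
      (nhds (weylMode ξ₀ f₀)) :=
    ((continuous_weylMode f₀).comp continuous_fst).tendsto (ξ₀, f₀)
  have h2 : Filter.Tendsto (fun p : (ℝ × ℝ) × Mode => weylMode p.1 (p.2 - f₀)) (nhds (ξ₀, f₀))
      (nhds 0) := by
    rw [tendsto_zero_iff_norm_tendsto_zero]
    simp only [LinearIsometry.norm_map]
    have : Continuous fun p : (ℝ × ℝ) × Mode => ‖p.2 - f₀‖ := by fun_prop
    simpa using this.tendsto (ξ₀, f₀)
  have h3 := h1.add h2
  rw [add_zero] at h3
  refine h3.congr fun p => ?_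
  rw [← map_add, add_sub_cancel]

theorem continuous_weylMode_apply {X : Type*} [TopologicalSpace X] {ζ : X → ℝ × ℝ} {f : X → Mode}
    (hζ : Continuous ζ) (hf : Continuous f) : Continuous fun x => weylMode (ζ x) (f x) := by
  have h := Continuous.prodMk hζ hf
  have := Continuous.comp continuous_weylMode_uncurry h
  exact this

theorem norm_sq_eq_conj_mul (z : ℂ) : ((‖z‖ : ℝ) : ℂ) ^ 2 = starRingEnd ℂ z * z := by
  rw [← Complex.normSq_eq_conj_mul_self, Complex.normSq_eq_norm_sq]
  push_cast
  rfl

theorem integrable_gauss_shift {c s C : ℝ} (hs0 : 0 ≤ s) (hs : s < c / 2) {K : ℂ → ℂ → ℂ}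
    (hK : Continuous fun p : ℂ × ℂ => K p.1 p.2)
    (hC : ∀ α β, ‖K α β‖ ≤ C * Real.exp (s * (‖α‖ ^ 2 + ‖β‖ ^ 2))) (δ : ℂ) :
    Integrable fun α : ℂ => (Real.exp (-c * ‖α‖ ^ 2) : ℂ) * K α (α + δ) := by
  have hC0 : 0 ≤ C := by
    have := (norm_nonneg _).trans (hC 0 0)
    simpa using this
  have he : 0 < (c - 2 * s) / 2 := by linarith
  have h1 := (integrable_exp_neg_mul_norm_sq he).const_mul
    (C * Real.exp (s * ‖δ‖ ^ 2 + (2 * s * ‖δ‖) ^ 2 / (4 * ((c - 2 * s) / 2))))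
  refine h1.mono' ?_ (Filter.Eventually.of_forall fun α => ?_)
  · refine Continuous.aestronglyMeasurable ?_
    have : Continuous fun α : ℂ => K α (α + δ) :=
      hK.comp (continuous_id.prodMk (continuous_id.add continuous_const))
    fun_prop
  · rw [norm_mul, Complex.norm_real, Real.norm_eq_abs, Real.abs_exp]
    calc _ ≤ Real.exp (-c * ‖α‖ ^ 2) * (C * Real.exp (s * (‖α‖ ^ 2 + (‖α‖ + ‖δ‖) ^ 2))) := by
          refine mul_le_mul_of_nonneg_left ((hC _ _).trans ?_) (Real.exp_pos _).le
          have := norm_add_le α δ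
          gcongr
      _ = C * Real.exp (-c * ‖α‖ ^ 2 + s * (‖α‖ ^ 2 + (‖α‖ + ‖δ‖) ^ 2)) := by
          rw [Real.exp_add]; ring
      _ ≤ C * Real.exp ((s * ‖δ‖ ^ 2 + (2 * s * ‖δ‖) ^ 2 / (4 * ((c - 2 * s) / 2))) +
          -((c - 2 * s) / 2) * ‖α‖ ^ 2) := by
          refine mul_le_mul_of_nonneg_left (Real.exp_le_exp.2 ?_) hC0
          have := mul_le_sq_add (2 * s * ‖δ‖) ‖α‖ he
          linarith
      _ = _ := by rw [Real.exp_add]; ring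

/-- The characteristic function of the output of `A` on the Gaussian ensemble of coherent states,
correlated with the input amplitude. -/
def modeKernel (l : ℝ) (A : Mode →L[ℂ] Mode) (p : (ℝ × ℝ) × (ℝ × ℝ)) : ℂ :=
  ∫ α : ℂ, ((l / Real.pi * Real.exp (-l * ‖α‖ ^ 2) : ℝ) : ℂ) *
    (Complex.exp (-((Real.sqrt 2 * (p.1.1 * α.re + p.1.2 * α.im) : ℝ) : ℂ) * Complex.I) *
      inner ℂ (A (coherentMode α)) (weylMode p.2 (A (coherentMode α))))

theorem norm_modeKernel_integrand_le {l : ℝ} (hl : 0 < l) (A : Mode →L[ℂ] Mode) (x : ℝ)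
    (ζ : ℝ × ℝ) (α : ℂ) :
    ‖((l / Real.pi * Real.exp (-l * ‖α‖ ^ 2) : ℝ) : ℂ) * (Complex.exp (-(x : ℂ) * Complex.I) *
      inner ℂ (A (coherentMode α)) (weylMode ζ (A (coherentMode α))))‖ ≤
      l / Real.pi * Real.exp (-l * ‖α‖ ^ 2) * ‖A‖ ^ 2 := by
  have hp := Real.pi_pos
  rw [norm_mul, norm_mul, Complex.norm_real, Real.norm_of_nonneg (by positivity),
    ← Complex.ofReal_neg, Complex.norm_exp_ofReal_mul_I, one_mul]
  have h : ‖A (coherentMode α)‖ ≤ ‖A‖ := by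
    simpa [norm_coherentMode] using A.le_opNorm (coherentMode α)
  have h2 := norm_inner_le_norm (𝕜 := ℂ) (A (coherentMode α)) (weylMode ζ (A (coherentMode α)))
  rw [LinearIsometry.norm_map] at h2
  refine mul_le_mul_of_nonneg_left (h2.trans ?_) (by positivity)
  rw [sq]
  gcongr

theorem continuous_modeKernel_integrand (l : ℝ) (A : Mode →L[ℂ] Mode) :
    Continuous fun x : ((ℝ × ℝ) × (ℝ × ℝ)) × ℂ =>
      ((l / Real.pi * Real.exp (-l * ‖x.2‖ ^ 2) : ℝ) : ℂ) *
    (Complex.exp (-((Real.sqrt 2 * (x.1.1.1 * x.2.re + x.1.1.2 * x.2.im) : ℝ) : ℂ) * Complex.I) *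
      inner ℂ (A (coherentMode x.2)) (weylMode x.1.2 (A (coherentMode x.2)))) := by
  have h1 : Continuous fun x : ((ℝ × ℝ) × (ℝ × ℝ)) × ℂ => A (coherentMode x.2) :=
    A.continuous.comp (continuous_coherentMode.comp continuous_snd)
  have h2 : Continuous fun x : ((ℝ × ℝ) × (ℝ × ℝ)) × ℂ =>
      weylMode x.1.2 (A (coherentMode x.2)) :=
    continuous_weylMode_apply (continuous_snd.comp continuous_fst) h1
  have h3 := h1.inner (𝕜 := ℂ) h2
  have h4 : Continuous fun x : ((ℝ × ℝ) × (ℝ × ℝ)) × ℂ =>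
      ((l / Real.pi * Real.exp (-l * ‖x.2‖ ^ 2) : ℝ) : ℂ) := by fun_prop
  have h5 : Continuous fun x : ((ℝ × ℝ) × (ℝ × ℝ)) × ℂ => Complex.exp
      (-((Real.sqrt 2 * (x.1.1.1 * x.2.re + x.1.1.2 * x.2.im) : ℝ) : ℂ) * Complex.I) := by
    have := Complex.continuous_re
    have := Complex.continuous_im
    fun_prop
  exact h4.mul (h5.mul h3)

theorem continuous_integral_of_le {X : Type*} [TopologicalSpace X] [FirstCountableTopology X]
    {G : X × ℂ → ℂ} {b : ℂ → ℝ} (hG : Continuous G) (hb : Integrable b)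
    (hle : ∀ x α, ‖G (x, α)‖ ≤ b α) : Continuous fun x => ∫ α, G (x, α) :=
  continuous_of_dominated
    (fun _ => (hG.comp (continuous_const.prodMk continuous_id)).aestronglyMeasurable)
    (fun x => Filter.Eventually.of_forall fun α => hle x α) hb
    (Filter.Eventually.of_forall fun _ => hG.comp (continuous_id.prodMk continuous_const))

theorem continuous_modeKernel {l : ℝ} (hl : 0 < l) (A : Mode →L[ℂ] Mode) :
    Continuous (modeKernel l A) := by
  have h := continuous_integral_of_le (continuous_modeKernel_integrand l A)
    (b := fun α : ℂ => l / Real.pi * Real.exp (-l * ‖α‖ ^ 2) * ‖A‖ ^ 2)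
    (((integrable_exp_neg_mul_norm_sq hl).const_mul _).mul_const _)
    (fun p α => norm_modeKernel_integrand_le hl A _ p.2 α)
  exact h

/-- The complex amplitude `-i (a + i b) / √2` of the phase space point `(a, b)`. -/
def amplitude (ξ : ℝ × ℝ) : ℂ := -Complex.I * (ξ.1 + ξ.2 * Complex.I) / (Real.sqrt 2 : ℂ)

theorem amplitude_sub (ξ η : ℝ × ℝ) : amplitude (ξ - η) = amplitude ξ - amplitude η := by
  simp only [amplitude, Prod.fst_sub, Prod.snd_sub]
  push_cast
  ring

theorem conj_amplitude (ξ : ℝ × ℝ) : starRingEnd ℂ (amplitude ξ) =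
    Complex.I * (ξ.1 - ξ.2 * Complex.I) / (Real.sqrt 2 : ℂ) := by
  simp only [amplitude, map_div₀, map_mul, map_neg, map_add, Complex.conj_I, Complex.conj_ofReal]
  ring

theorem amplitude_mul_conj_amplitude (ξ η : ℝ × ℝ) :
    amplitude ξ * starRingEnd ℂ (amplitude η) =
      (ξ.1 + ξ.2 * Complex.I) * (η.1 - η.2 * Complex.I) / 2 := by
  rw [conj_amplitude, amplitude, div_mul_div_comm, sqrt_two_mul_self]
  linear_combination (-(ξ.1 + ξ.2 * Complex.I) * (η.1 - η.2 * Complex.I) / 2) * Complex.I_sq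

/-- The choice of `amplitude` splits the phase into an antiholomorphic and a holomorphic exponential
in α, the form needed for shifting arguments. -/
theorem amplitude_phase (ξ : ℝ × ℝ) (α : ℂ) :
    amplitude ξ * starRingEnd ℂ α - starRingEnd ℂ (amplitude ξ) * α =
      -((Real.sqrt 2 * (ξ.1 * α.re + ξ.2 * α.im) : ℝ) : ℂ) * Complex.I := by
  have hα : α = α.re + α.im * Complex.I := (Complex.re_add_im α).symm
  have hα' : starRingEnd ℂ α = α.re - α.im * Complex.I := by
    apply Complex.ext <;> simp
  rw [conj_amplitude, hα', amplitude]
  conv_lhs => enter [2, 2]; rw [hα]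
  rw [div_mul_eq_mul_div, div_mul_eq_mul_div, ← sub_div, div_eq_iff sqrt_two_ne_zero]
  push_cast
  linear_combination (Complex.I * (ξ.1 * α.re + ξ.2 * α.im)) * sqrt_two_mul_self +
    (2 * Complex.I * ξ.2 * α.im) * Complex.I_sq

/-- The two normalisations e^{-|α|²/2} are absorbed into the weight, raising its rate from l to 1 +
l and leaving vectors holomorphic in α. -/
theorem modeKernel_eq (l : ℝ) (A : Mode →L[ℂ] Mode) (ξ ζ : ℝ × ℝ) :
    modeKernel l A (ξ, ζ) = (l / Real.pi : ℝ) *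
      ∫ α : ℂ, (Real.exp (-(1 + l) * ‖α‖ ^ 2) : ℂ) *
        (Complex.exp (amplitude ξ * starRingEnd ℂ α - starRingEnd ℂ (amplitude ξ) * α) *
          inner ℂ (A (cohVec α)) (weylMode ζ (A (cohVec α)))) := by
  rw [modeKernel, ← integral_const_mul]
  refine integral_congr_ae (Filter.Eventually.of_forall fun α => ?_)
  simp only []
  rw [amplitude_phase, coherentMode_eq]
  simp only [map_smul, inner_smul_left, inner_smul_right, Complex.conj_ofReal]
  have h : Real.exp (-(1 + l) * ‖α‖ ^ 2) =
      Real.exp (-l * ‖α‖ ^ 2) * (Real.exp (-‖α‖ ^ 2 / 2) * Real.exp (-‖α‖ ^ 2 / 2)) := by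
    rw [← Real.exp_add, ← Real.exp_add]
    congr 1
    ring
  rw [h]
  push_cast
  ring

theorem norm_map_cohVec_le (A : Mode →L[ℂ] Mode) (α : ℂ) :
    ‖A (cohVec α)‖ ≤ ‖A‖ * Real.exp (‖α‖ ^ 2 / 2) := by
  simpa [norm_cohVec] using A.le_opNorm (cohVec α)

/-- Gaussian averages of the sesqui-holomorphic kernel of `A` with a shifted argument. -/
theorem integral_shifted_kernel {l : ℝ} (hl : 0 < l) (A : Mode →L[ℂ] Mode) (ζ : ℝ × ℝ) (w : ℂ) :
    Integrable (fun α : ℂ => (Real.exp (-(1 + l) * ‖α‖ ^ 2) : ℂ) *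
      (Complex.exp (-(starRingEnd ℂ w * α)) *
        inner ℂ (A (cohVec α)) (weylMode ζ (A (cohVec (α + w / (1 + l : ℝ))))))) ∧
    ∫ α : ℂ, (Real.exp (-(1 + l) * ‖α‖ ^ 2) : ℂ) *
      (Complex.exp (-(starRingEnd ℂ w * α)) *
        inner ℂ (A (cohVec α)) (weylMode ζ (A (cohVec (α + w / (1 + l : ℝ)))))) =
      Complex.exp (starRingEnd ℂ w * w / (1 + l : ℝ)) *
      ∫ α : ℂ, (Real.exp (-(1 + l) * ‖α‖ ^ 2) : ℂ) *
        (Complex.exp (w * starRingEnd ℂ α - starRingEnd ℂ w * α) *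
          inner ℂ (A (cohVec α)) (weylMode ζ (A (cohVec α)))) := by
  have hc : (0 : ℝ) < 1 + l := by linarith
  have hc' : ((1 + l : ℝ) : ℂ) ≠ 0 := by exact_mod_cast hc.ne'
  -- The exponential is arranged to be holomorphic in β and to become e^{-w̄α} at β = α + w/(1+l).
  -- In `integral_gauss_shift` this shift is worth the missing factor e^{wᾱ}.
  let K : ℂ → ℂ → ℂ := fun α β => Complex.exp (-(starRingEnd ℂ w * (β - w / (1 + l : ℝ)))) *
    inner ℂ (A (cohVec α)) (weylMode ζ (A (cohVec β)))
  have hd₀ : Differentiable ℂ fun α => A (cohVec α) :=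
    A.differentiable.comp differentiable_cohVec
  have hd₁ : ∀ v : Mode, Differentiable ℂ fun α => inner ℂ v (A (cohVec α)) := fun v =>
    (innerSL ℂ v).differentiable.comp hd₀
  have hd₂ : ∀ v : Mode, Differentiable ℂ fun β => inner ℂ v (weylMode ζ (A (cohVec β))) := fun v =>
    ((innerSL ℂ v).comp (weylMode ζ).toContinuousLinearMap).differentiable.comp hd₀
  have hK₁ : ∀ β, Differentiable ℂ fun α => starRingEnd ℂ (K α β) := fun β => by
    simp only [K, map_mul, inner_conj_symm]
    exact (hd₁ _).const_mul _
  have hK₂ : ∀ α, Differentiable ℂ (K α) := fun α => by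
    have := hd₂ (A (cohVec α))
    refine Differentiable.mul (by fun_prop) this
  have hK : Continuous fun p : ℂ × ℂ => K p.1 p.2 := by
    have h1 : Continuous fun p : ℂ × ℂ => A (cohVec p.1) := hd₀.continuous.comp continuous_fst
    have h2 : Continuous fun p : ℂ × ℂ => weylMode ζ (A (cohVec p.2)) :=
      (weylMode ζ).continuous.comp (hd₀.continuous.comp continuous_snd)
    exact Continuous.mul (by fun_prop) (h1.inner h2)
  -- The rate 1/2 is the growth of `cohVec`, and l/4 absorbs the linear exponent; the sum stays
  -- below (1+l)/2 because l > 0.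
  have hC : ∀ α β, ‖K α β‖ ≤ (‖A‖ ^ 2 * Real.exp (‖w‖ * (‖w‖ / (1 + l)) + ‖w‖ ^ 2 / (4 * (l / 4)))) *
      Real.exp ((1 / 2 + l / 4) * (‖α‖ ^ 2 + ‖β‖ ^ 2)) := by
    intro α β
    rw [norm_mul, Complex.norm_exp]
    have h1 : (-(starRingEnd ℂ w * (β - w / (1 + l : ℝ)))).re ≤
        ‖w‖ * (‖β‖ + ‖w‖ / (1 + l)) := by
      refine (Complex.re_le_norm _).trans ?_
      rw [norm_neg, norm_mul, Complex.norm_conj]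
      refine mul_le_mul_of_nonneg_left ((norm_sub_le _ _).trans ?_) (norm_nonneg _)
      rw [norm_div, Complex.norm_real, Real.norm_of_nonneg hc.le]
    have h2 : ‖inner ℂ (A (cohVec α)) (weylMode ζ (A (cohVec β)))‖ ≤
        (‖A‖ * Real.exp (‖α‖ ^ 2 / 2)) * (‖A‖ * Real.exp (‖β‖ ^ 2 / 2)) := by
      refine (norm_inner_le_norm _ _).trans ?_
      rw [LinearIsometry.norm_map]
      gcongr <;> exact norm_map_cohVec_le A _
    calc _ ≤ Real.exp (‖w‖ * (‖β‖ + ‖w‖ / (1 + l))) *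
          ((‖A‖ * Real.exp (‖α‖ ^ 2 / 2)) * (‖A‖ * Real.exp (‖β‖ ^ 2 / 2))) := by gcongr
      _ = ‖A‖ ^ 2 * Real.exp (‖w‖ * (‖β‖ + ‖w‖ / (1 + l)) + ‖α‖ ^ 2 / 2 + ‖β‖ ^ 2 / 2) := by
        rw [Real.exp_add, Real.exp_add]; ring
      _ ≤ ‖A‖ ^ 2 * Real.exp ((‖w‖ * (‖w‖ / (1 + l)) + ‖w‖ ^ 2 / (4 * (l / 4))) +
          (1 / 2 + l / 4) * (‖α‖ ^ 2 + ‖β‖ ^ 2)) := by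
        refine mul_le_mul_of_nonneg_left (Real.exp_le_exp.2 ?_) (by positivity)
        have h3 := mul_le_sq_add ‖w‖ ‖β‖ (by linarith : 0 < l / 4)
        have h4 : 0 ≤ l / 4 * ‖α‖ ^ 2 := by positivity
        linarith
      _ = _ := by rw [Real.exp_add]; ring
  have hs : (1 / 2 + l / 4 : ℝ) < (1 + l) / 2 := by linarith
  have hs0 : (0 : ℝ) ≤ 1 / 2 + l / 4 := by linarith
  have h1 := integrable_gauss_shift hs0 hs hK hC (w / (1 + l : ℝ))
  have h2 := integral_gauss_shift hs0 hs hK₁ hK₂ hK hC (w / (1 + l : ℝ))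
  simp only [K, add_sub_cancel_right] at h1 h2
  refine ⟨h1, h2.trans ?_⟩
  rw [← integral_const_mul]
  refine integral_congr_ae (Filter.Eventually.of_forall fun α => ?_)
  simp only []
  rw [← mul_assoc (Complex.exp _), ← Complex.exp_add, mul_left_comm (Complex.exp _),
    ← mul_assoc (Complex.exp _) (Complex.exp _), ← Complex.exp_add]
  congr 3
  field_simp
  ring

-- The kernel is an integral of Gram matrices of the vectors Ψ. The Weyl operators on the output
-- give the twist σ. The input phase is traded for a shift of the coherent amplitude by w/(1+l), and
-- completing squares in these shifts produces both the twist -σ/(1+l) and the factor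
-- e^{|w|²/(2(1+l))}, where |w|² = |ξ|²/2.
open scoped ComplexOrder in
theorem isTwistedPosDef_modeKernel {l : ℝ} (hl : 0 < l) (A : Mode →L[ℂ] Mode) :
    IsTwistedPosDef (fun p q : (ℝ × ℝ) × (ℝ × ℝ) => sympl p.2 q.2 - sympl p.1 q.1 / (1 + l))
      (fun p => (Real.exp ((p.1.1 ^ 2 + p.1.2 ^ 2) / (4 * (1 + l))) : ℂ) * modeKernel l A p) := by
  have hc : (0 : ℝ) < 1 + l := by linarith
  have hc' : ((1 + l : ℝ) : ℂ) ≠ 0 := by exact_mod_cast hc.ne'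
  have hpi := Real.pi_pos
  let Ψ : (ℝ × ℝ) × (ℝ × ℝ) → ℂ → Mode := fun p α =>
    ((Real.sqrt (l / Real.pi) : ℂ) *
      Complex.exp (-(((1 + l) * ‖α‖ ^ 2 / 2 : ℝ) : ℂ) -
        starRingEnd ℂ (amplitude p.1) * amplitude p.1 / (2 * (1 + l : ℝ)) -
        starRingEnd ℂ (amplitude p.1) * α)) •
      weylMode p.2 (A (cohVec (α + amplitude p.1 / (1 + l : ℝ))))
  -- Up to a constant, the inner product is the integrand of `integral_shifted_kernel` for the
  -- difference q - p, translated by the amplitude of p; translation invariance then removes the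
  -- dependence on p.
  have hΨ (p q : (ℝ × ℝ) × (ℝ × ℝ)) (α : ℂ) : inner ℂ (Ψ p α) (Ψ q α) =
      ((l / Real.pi : ℝ) * Complex.exp (Complex.I / 2 * (sympl p.2 q.2 : ℝ)) *
        Complex.exp (-(starRingEnd ℂ (amplitude p.1) * amplitude p.1 +
          starRingEnd ℂ (amplitude q.1) * amplitude q.1) / (2 * (1 + l : ℝ)) +
          starRingEnd ℂ (amplitude q.1) * amplitude p.1 / (1 + l : ℝ))) *
      (fun α : ℂ => (Real.exp (-(1 + l) * ‖α‖ ^ 2) : ℂ) *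
      (Complex.exp (-(starRingEnd ℂ (amplitude (q.1 - p.1)) * α)) *
        inner ℂ (A (cohVec α)) (weylMode (q.2 - p.2)
          (A (cohVec (α + amplitude (q.1 - p.1) / (1 + l : ℝ)))))))
        (α + amplitude p.1 / (1 + l : ℝ)) := by
    simp only [Ψ, inner_smul_left, inner_smul_right, inner_weylMode_weylMode]
    have h1 : α + amplitude p.1 / (1 + l : ℝ) + amplitude (q.1 - p.1) / (1 + l : ℝ) =
        α + amplitude q.1 / (1 + l : ℝ) := by
      rw [amplitude_sub]; ring
    have h2 : (Real.sqrt (l / Real.pi) : ℂ) * (Real.sqrt (l / Real.pi) : ℂ) =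
        ((l / Real.pi : ℝ) : ℂ) := by
      rw [← Complex.ofReal_mul, Real.mul_self_sqrt (by positivity)]
    rw [h1, ← h2, map_mul, Complex.conj_ofReal, ← Complex.exp_conj, Complex.ofReal_exp]
    generalize inner ℂ (A (cohVec (α + amplitude p.1 / (1 + l : ℝ))))
      (weylMode (q.2 - p.2) (A (cohVec (α + amplitude q.1 / (1 + l : ℝ))))) = X
    generalize Complex.exp (Complex.I / 2 * (sympl p.2 q.2 : ℝ)) = Y
    generalize (Real.sqrt (l / Real.pi) : ℂ) = s
    have h3 : ∀ a b c d e : ℂ, a + b = c + d + e → (s * Complex.exp a) * ((s * Complex.exp b) *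
        (Y * X)) = s * s * Y * Complex.exp c * (Complex.exp d * (Complex.exp e * X)) := by
      intro a b c d e h
      have : Complex.exp a * Complex.exp b = Complex.exp c * Complex.exp d * Complex.exp e := by
        rw [← Complex.exp_add, ← Complex.exp_add, ← Complex.exp_add, h]
      linear_combination (s * s * Y * X) * this
    rw [mul_left_comm]
    refine (mul_left_comm _ _ _).trans (h3 _ _ _ _ _ ?_)
    simp only [map_sub, map_neg, map_div₀, map_mul, Complex.conj_conj, Complex.conj_ofReal,
      amplitude_sub, Complex.conj_ofNat]
    push_cast
    rw [norm_sq_eq_conj_mul, norm_sq_eq_conj_mul]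
    simp only [map_add, map_div₀, Complex.conj_ofReal]
    push_cast at hc' ⊢
    simp only [map_one]
    field_simp
    ring
  have hint (p q : (ℝ × ℝ) × (ℝ × ℝ)) : Integrable fun α : ℂ => inner ℂ (Ψ p α) (Ψ q α) := by
    simp only [hΨ]
    exact ((integral_shifted_kernel hl A (q.2 - p.2) (amplitude (q.1 - p.1))).1.comp_add_right
      (amplitude p.1 / (1 + l : ℝ))).const_mul _
  have hmain := posSemidef_integral_inner hint
  unfold IsTwistedPosDef
  refine (congrArg Matrix.PosSemidef ?_).mpr hmain
  ext p q
  simp only [Matrix.of_apply, hΨ]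
  rw [integral_const_mul, integral_add_right_eq_self (fun α : ℂ =>
    (Real.exp (-(1 + l) * ‖α‖ ^ 2) : ℂ) * (Complex.exp (-(starRingEnd ℂ (amplitude (q.1 - p.1)) * α)) *
        inner ℂ (A (cohVec α)) (weylMode (q.2 - p.2)
          (A (cohVec (α + amplitude (q.1 - p.1) / (1 + l : ℝ)))))))
    (amplitude p.1 / (1 + l : ℝ)),
    (integral_shifted_kernel hl A (q.2 - p.2) (amplitude (q.1 - p.1))).2]
  rw [show q - p = (q.1 - p.1, q.2 - p.2) from rfl, modeKernel_eq]
  generalize (∫ α : ℂ, (Real.exp (-(1 + l) * ‖α‖ ^ 2) : ℂ) *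
        (Complex.exp (amplitude (q.1 - p.1) * starRingEnd ℂ α -
          starRingEnd ℂ (amplitude (q.1 - p.1)) * α) *
          inner ℂ (A (cohVec α)) (weylMode (q.2 - p.2) (A (cohVec α))))) = X
  have h3 : ∀ a b c d e x : ℂ, a + b = c + d + e → Complex.exp a * (Complex.exp b *
      (x * X)) = x * Complex.exp c * Complex.exp d * (Complex.exp e * X) := by
    intro a b c d e x h
    have : Complex.exp a * Complex.exp b = Complex.exp c * Complex.exp d * Complex.exp e := by
      rw [← Complex.exp_add, ← Complex.exp_add, ← Complex.exp_add, h]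
    linear_combination (x * X) * this
  rw [Complex.ofReal_exp]
  refine h3 _ _ _ _ _ _ ?_
  rw [mul_comm (starRingEnd ℂ (amplitude p.1)), mul_comm (starRingEnd ℂ (amplitude q.1)),
    mul_comm (starRingEnd ℂ (amplitude q.1)), mul_comm (starRingEnd ℂ (amplitude (q.1 - p.1)))]
  simp only [amplitude_mul_conj_amplitude, sympl, Prod.fst_sub, Prod.snd_sub]
  push_cast at hc' ⊢
  field_simp
  ring_nf
  simp only [Complex.I_sq]
  ring

end

section

/-! ### Overlaps with coherent states -/

/-- Phase space as the product of the position and momentum parts. -/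
def phaseSpaceEquiv (n : ℕ) : ((Fin n → ℝ) × (Fin n → ℝ)) ≃ᵐ (Fin 2 × Fin n → ℝ) where
  toFun p k := if k.1 = 0 then p.1 k.2 else p.2 k.2
  invFun ξ := (fun j => ξ (0, j), fun j => ξ (1, j))
  left_inv p := by simp
  right_inv ξ := by
    funext ⟨i, j⟩
    fin_cases i <;> simp
  measurable_toFun := by
    refine measurable_pi_lambda _ fun k => ?_
    by_cases h : k.1 = 0
    · simp only [h, Equiv.coe_fn_mk, if_true]
      fun_prop
    · simp only [h, Equiv.coe_fn_mk, if_false]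
      fun_prop
  measurable_invFun := by
    simp only [Equiv.symm_mk, Equiv.coe_fn_mk]
    fun_prop

theorem phaseSpaceEquiv_zero {n : ℕ} (p : (Fin n → ℝ) × (Fin n → ℝ)) (j : Fin n) :
    phaseSpaceEquiv n p (0, j) = p.1 j := rfl

theorem phaseSpaceEquiv_one {n : ℕ} (p : (Fin n → ℝ) × (Fin n → ℝ)) (j : Fin n) :
    phaseSpaceEquiv n p (1, j) = p.2 j := rfl

theorem measurePreserving_phaseSpaceEquiv (n : ℕ) :
    MeasurePreserving (phaseSpaceEquiv n) (volume.prod volume) volume := by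
  refine ⟨(phaseSpaceEquiv n).measurable, ?_⟩
  refine (Measure.pi_eq fun s hs => ?_).symm
  rw [(phaseSpaceEquiv n).map_apply]
  have : phaseSpaceEquiv n ⁻¹' Set.univ.pi s =
      (Set.univ.pi fun j => s (0, j)) ×ˢ (Set.univ.pi fun j => s (1, j)) := by
    ext p
    simp only [Set.mem_preimage, Set.mem_pi, Set.mem_univ, true_imp_iff, Set.mem_prod]
    constructor
    · exact fun h => ⟨fun j => h (0, j), fun j => h (1, j)⟩
    · rintro ⟨h0, h1⟩ ⟨i, j⟩
      fin_cases i
      · exact h0 j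
      · exact h1 j
  rw [this, Measure.prod_prod, volume_pi_pi, volume_pi_pi, Fintype.prod_prod_type,
    Fin.prod_univ_two]

/-- The wave function of a one-mode coherent state. -/
def cohFun (γ : ℂ) (q : ℝ) : ℂ :=
  ((Real.exp (-‖γ‖ ^ 2 / 2) : ℝ) : ℂ) * (hermiteGen (Real.sqrt 2 * q : ℂ) γ * vacuumFun q)

theorem coeFn_coherentMode (γ : ℂ) : (coherentMode γ : ℝ → ℂ) =ᵐ[volume] cohFun γ := by
  rw [coherentMode_eq]
  filter_upwards [Lp.coeFn_smul ((Real.exp (-‖γ‖ ^ 2 / 2) : ℝ) : ℂ) (cohVec γ), coeFn_cohVec γ]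
    with q h1 h2
  rw [h1, Pi.smul_apply, h2, smul_eq_mul, cohFun]

theorem coeFn_coherent {n : ℕ} (γ : Fin n → ℂ) :
    (coherent γ : (Fin n → ℝ) → ℂ) =ᵐ[volume] fun q => ∏ j, cohFun (γ j) (q j) := by
  have h : ∀ᵐ q : Fin n → ℝ, ∀ j, (coherentMode (γ j) : ℝ → ℂ) (q j) = cohFun (γ j) (q j) :=
    ae_all_iff.2 fun j => ae_eval j (coeFn_coherentMode (γ j))
  filter_upwards [coeFn_tensor fun j => coherentMode (γ j), h] with q h1 h2
  rw [coherent, h1]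
  simp only [h2]

/-- The first two factors are the value of the integral of exp(-a²/4 + ia(q - √2 Re γ + b/2)) over
a, so integrating out a gives a product of wave functions at q and q + b. -/
theorem cohFun_mul_conj (γ : ℂ) (q b : ℝ) :
    (Real.pi / (1 / 4 : ℂ)) ^ (1 / 2 : ℂ) *
      Complex.exp ((Complex.I * (q - Real.sqrt 2 * γ.re + b / 2)) ^ 2 / (4 * (1 / 4))) *
      Complex.exp (-(b ^ 2 / 4) - Complex.I * (Real.sqrt 2 * γ.im * b)) =
      2 * Real.pi * (cohFun γ q * starRingEnd ℂ (cohFun γ (q + b))) := by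
  have h1 : (Real.pi / (1 / 4 : ℂ)) ^ (1 / 2 : ℂ) =
      2 * Real.pi * ((Real.pi ^ (-(1 / 2) : ℝ) : ℝ) : ℂ) := by
    have h2 : (Real.pi / (1 / 4 : ℂ)) = ((4 * Real.pi : ℝ) : ℂ) := by push_cast; ring
    rw [h2, show (1 / 2 : ℂ) = ((1 / 2 : ℝ) : ℂ) by push_cast; ring,
      ← Complex.ofReal_cpow (by positivity), Real.mul_rpow (by norm_num) Real.pi_pos.le,
      ← Real.sqrt_eq_rpow 4, show (4 : ℝ) = 2 ^ 2 by norm_num, Real.sqrt_sq (by norm_num)]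
    have h3 : Real.pi ^ (1 / 2 : ℝ) = Real.pi * Real.pi ^ (-(1 / 2) : ℝ) := by
      rw [← Real.rpow_one_add' Real.pi_pos.le (by norm_num)]
      norm_num
    rw [h3]
    push_cast
    ring
  have h4 : ((Real.pi ^ (-(1 / 4) : ℝ) : ℝ) : ℂ) * ((Real.pi ^ (-(1 / 4) : ℝ) : ℝ) : ℂ) =
      ((Real.pi ^ (-(1 / 2) : ℝ) : ℝ) : ℂ) := by
    rw [← Complex.ofReal_mul, ← Real.rpow_add Real.pi_pos]
    norm_num
  rw [h1, ← h4]
  simp only [cohFun, vacuumFun, hermiteGen, map_mul, Complex.conj_ofReal, ← Complex.exp_conj,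
    map_sub, map_div₀, map_pow, Complex.conj_ofNat]
  rw [Complex.ofReal_mul, Complex.ofReal_mul, Complex.ofReal_exp, Complex.ofReal_exp,
    Complex.ofReal_exp]
  generalize ((Real.pi ^ (-(1 / 4) : ℝ) : ℝ) : ℂ) = s
  have h5 : ∀ a b c d e f g h : ℂ, a + b = c + d + e + f + g + h →
      2 * Real.pi * (s * s) * Complex.exp a * Complex.exp b =
      2 * Real.pi * (Complex.exp c * (Complex.exp d * (s * Complex.exp e)) *
        (Complex.exp f * (Complex.exp g * (s * Complex.exp h)))) := by
    intro a b c d e f g h H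
    have : Complex.exp a * Complex.exp b = Complex.exp c * Complex.exp d * Complex.exp e *
        Complex.exp f * Complex.exp g * Complex.exp h := by
      simp only [← Complex.exp_add, H]
    linear_combination (2 * Real.pi * (s * s)) * this
  refine h5 _ _ _ _ _ _ _ _ ?_
  have h6 : starRingEnd ℂ γ = γ.re - γ.im * Complex.I := by
    apply Complex.ext <;> simp
  have h7 : γ = γ.re + γ.im * Complex.I := (Complex.re_add_im γ).symm
  have h8 : ((‖γ‖ : ℝ) : ℂ) ^ 2 = γ.re ^ 2 + γ.im ^ 2 := by
    rw [norm_sq_eq_conj_mul, h6]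
    conv_lhs => enter [2]; rw [h7]
    linear_combination (-(γ.im : ℂ) ^ 2) * Complex.I_sq
  push_cast
  rw [h8, h6]
  generalize hx : (γ.re : ℂ) = x at *
  generalize hy : (γ.im : ℂ) = y at *
  rw [h7]
  linear_combination ((q - Real.sqrt 2 * x + b / 2) ^ 2 + y ^ 2) * Complex.I_sq -
    x ^ 2 * sqrt_two_mul_self

theorem integral_gauss_phase {n : ℕ} (γ : Fin n → ℂ) (q b : Fin n → ℝ) :
    ∫ a : Fin n → ℝ, Complex.exp (-∑ j, (1 / 4 : ℂ) * (a j : ℂ) ^ 2 +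
      ∑ j, (Complex.I * (q j - Real.sqrt 2 * (γ j).re + b j / 2)) * a j) *
      ∏ j, Complex.exp (-((b j : ℂ) ^ 2 / 4) - Complex.I * (Real.sqrt 2 * (γ j).im * b j)) =
      (2 * Real.pi) ^ n * ((∏ j, cohFun (γ j) (q j)) *
        starRingEnd ℂ (∏ j, cohFun (γ j) ((q + b) j))) := by
  rw [integral_mul_const, GaussianFourier.integral_cexp_neg_sum_mul_add (by intro i; norm_num),
    ← Finset.prod_mul_distrib, map_prod, ← Finset.prod_mul_distrib]
  simp only [Pi.add_apply, cohFun_mul_conj]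
  rw [Finset.prod_mul_distrib]
  simp

/-- The overlap with a coherent state as a phase space average of Weyl operators. -/
theorem norm_inner_coherent_sq {n : ℕ} (φ : Modes n) (γ : Fin n → ℂ) :
    ((‖inner ℂ φ (coherent γ)‖ ^ 2 : ℝ) : ℂ) = ((2 * Real.pi) ^ n : ℂ)⁻¹ *
      ∫ ξ : Fin 2 × Fin n → ℝ, (Real.exp (-∑ k, 1 / 4 * ξ k ^ 2) : ℂ) *
        (Complex.exp (-((Real.sqrt 2 * ∑ j, (ξ (0, j) * (γ j).re + ξ (1, j) * (γ j).im) : ℝ) : ℂ) *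
          Complex.I) * inner ℂ φ (weyl ξ φ)) := by
  set F : (Fin 2 × Fin n → ℝ) → ℂ := fun ξ => (Real.exp (-∑ k, 1 / 4 * ξ k ^ 2) : ℂ) *
        (Complex.exp (-((Real.sqrt 2 * ∑ j, (ξ (0, j) * (γ j).re + ξ (1, j) * (γ j).im) : ℝ) : ℂ) *
          Complex.I) * inner ℂ φ (weyl ξ φ)) with hF
  let f : (Fin n → ℝ) → ℂ := φ
  let g : (Fin n → ℝ) → ℂ := fun q => ∏ j, cohFun (γ j) (q j)
  have hf : Measurable f := (Lp.stronglyMeasurable φ).measurable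
  -- The integrand with the inner product written out as an integral over q; (a, b) are the two
  -- halves of ξ.
  let T : (Fin n → ℝ) → (Fin n → ℝ) → (Fin n → ℝ) → ℂ := fun a b q =>
    Complex.exp (-∑ j, (1 / 4 : ℂ) * (a j : ℂ) ^ 2 +
      ∑ j, (Complex.I * (q j - Real.sqrt 2 * (γ j).re + b j / 2)) * a j) *
    (∏ j, Complex.exp (-((b j : ℂ) ^ 2 / 4) - Complex.I * (Real.sqrt 2 * (γ j).im * b j))) *
      (starRingEnd ℂ (f q) * f (q + b))
  have hFT (a b : Fin n → ℝ) : F (phaseSpaceEquiv n (a, b)) = ∫ q, T a b q := by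
    simp only [hF, L2.inner_def]
    rw [← integral_const_mul, ← integral_const_mul]
    refine integral_congr_ae ?_
    filter_upwards [coeFn_weyl (phaseSpaceEquiv n (a, b)) φ] with q hq
    rw [hq]
    simp only [T, phaseSpaceEquiv_zero, phaseSpaceEquiv_one, RCLike.inner_apply',
      Fintype.sum_prod_type, Fin.sum_univ_two]
    rw [← Complex.exp_sum, ← Complex.exp_add, Complex.ofReal_exp]
    have h : ∀ u v w x y z : ℂ, u + v + w = x → Complex.exp u * (Complex.exp v *
        (y * (Complex.exp w * z))) = Complex.exp x * (y * z) := by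
      intro u v w x y z h
      rw [← h, Complex.exp_add, Complex.exp_add]; ring
    refine h _ _ _ _ _ _ ?_
    push_cast
    simp only [Finset.mul_sum, Finset.sum_mul, ← Finset.sum_neg_distrib, neg_mul, neg_add,
      ← Finset.sum_add_distrib]
    refine Finset.sum_congr rfl fun j _ => ?_
    ring
  have hff (b : Fin n → ℝ) : Integrable fun q => starRingEnd ℂ (f q) * f (q + b) := by
    have h := L2.integrable_inner (𝕜 := ℂ) φ (weyl (phaseSpaceEquiv n (0, b)) φ)
    refine h.congr ?_
    filter_upwards [coeFn_weyl (phaseSpaceEquiv n (0, b)) φ] with q hq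
    rw [hq]
    simp only [phaseSpaceEquiv_zero, phaseSpaceEquiv_one, RCLike.inner_apply', f]
    simp
  have hfg : Integrable fun q => starRingEnd ℂ (f q) * g q := by
    have h := L2.integrable_inner (𝕜 := ℂ) φ (coherent γ)
    refine h.congr ?_
    filter_upwards [coeFn_coherent γ] with q hq
    rw [hq, RCLike.inner_apply']
  have hinner : inner ℂ φ (coherent γ) = ∫ q, starRingEnd ℂ (f q) * g q := by
    rw [L2.inner_def]
    refine integral_congr_ae ?_
    filter_upwards [coeFn_coherent γ] with q hq
    rw [hq, RCLike.inner_apply']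
  have hgauss : Integrable fun a : Fin n → ℝ => Complex.exp (-∑ j, (1 / 4 : ℂ) * (a j : ℂ) ^ 2 +
      ∑ j, (0 : ℂ) * a j) :=
    GaussianFourier.integrable_cexp_neg_sum_mul_add (by intro i; norm_num) _
  have hTa (b : Fin n → ℝ) : ∫ a, ∫ q, T a b q = ∫ q, (2 * Real.pi) ^ n *
      ((starRingEnd ℂ (f q) * g q) * starRingEnd ℂ (starRingEnd ℂ (f (q + b)) * g (q + b))) := by
    rw [integral_integral_swap]
    · refine integral_congr_ae (Filter.Eventually.of_forall fun q => ?_)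
      simp only [T]
      rw [integral_mul_const, integral_gauss_phase, map_mul, Complex.conj_conj]
      simp only [g]
      ring
    · have h1 := (hgauss.norm.mul_prod (hff b).norm).const_mul
        ‖∏ j, Complex.exp (-((b j : ℂ) ^ 2 / 4) - Complex.I * (Real.sqrt 2 * (γ j).im * b j))‖
      refine h1.mono' ?_ (Filter.Eventually.of_forall fun p => ?_)
      · refine Measurable.aestronglyMeasurable ?_
        simp only [T, Function.uncurry_def]
        have h2 : Measurable fun q : Fin n → ℝ => starRingEnd ℂ (f q) :=
          Complex.continuous_conj.measurable.comp hf
        fun_prop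
      · simp only [T, Function.uncurry_def, norm_mul]
        rw [mul_comm ‖Complex.exp _‖, mul_assoc]
        refine mul_le_mul_of_nonneg_left ?_ (norm_nonneg _)
        rw [Complex.norm_exp, Complex.norm_exp]
        refine le_of_eq ?_
        congr 2
        simp [Complex.add_re, Complex.mul_re]
  have hFi : Integrable (fun p : (Fin n → ℝ) × (Fin n → ℝ) => F (phaseSpaceEquiv n p))
      (volume.prod volume) := by
    have h1 : Integrable (fun p : (Fin n → ℝ) × (Fin n → ℝ) =>
        Real.exp (-∑ k, 1 / 4 * (phaseSpaceEquiv n p) k ^ 2) * ‖φ‖ ^ 2) (volume.prod volume) := by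
      refine Integrable.mul_const ?_ _
      exact (measurePreserving_phaseSpaceEquiv n).integrable_comp_of_integrable
        (integrable_gauss (c := fun _ => 1 / 4) (fun _ => by norm_num))
    refine h1.mono' ?_ (Filter.Eventually.of_forall fun p => ?_)
    · have h2 : StronglyMeasurable fun p : (Fin n → ℝ) × (Fin n → ℝ) => ∫ q, T p.1 p.2 q := by
        refine StronglyMeasurable.integral_prod_right (f := fun (p : (Fin n → ℝ) × (Fin n → ℝ)) q =>
          T p.1 p.2 q) (Measurable.stronglyMeasurable ?_)
        simp only [T, Function.uncurry_def]
        have h2 : Measurable fun q : Fin n → ℝ => starRingEnd ℂ (f q) :=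
          Complex.continuous_conj.measurable.comp hf
        fun_prop
      simp only [← hFT] at h2
      exact h2.aestronglyMeasurable
    · simp only [hF]
      rw [norm_mul, norm_mul, Complex.norm_real, Real.norm_eq_abs, Real.abs_exp,
        ← Complex.ofReal_neg, Complex.norm_exp_ofReal_mul_I, one_mul]
      refine mul_le_mul_of_nonneg_left ((norm_inner_le_norm _ _).trans ?_) (Real.exp_pos _).le
      rw [LinearIsometry.norm_map, sq]
  have hRi : Integrable (fun p : (Fin n → ℝ) × (Fin n → ℝ) => (2 * Real.pi : ℂ) ^ n *
      ((starRingEnd ℂ (f p.1) * g p.1) * starRingEnd ℂ (starRingEnd ℂ (f p.2) * g p.2)))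
      (volume.prod volume) := by
    have := (hfg.mul_prod (Complex.conjCLE.toContinuousLinearMap.integrable_comp hfg)).const_mul
      ((2 * Real.pi : ℂ) ^ n)
    exact this
  -- Once a is integrated out, the shear (q, b) ↦ (q, q + b) decouples the double integral into the
  -- overlap times its conjugate.
  have hsh := measurePreserving_prod_add (volume : Measure (Fin n → ℝ))
    (volume : Measure (Fin n → ℝ))
  have hshe : MeasurableEmbedding fun z : (Fin n → ℝ) × (Fin n → ℝ) => (z.1, z.1 + z.2) :=
    (MeasurableEquiv.shearAddRight (Fin n → ℝ)).measurableEmbedding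
  rw [← (measurePreserving_phaseSpaceEquiv n).integral_comp' F, integral_prod_symm _ hFi]
  simp only [hFT, hTa]
  rw [integral_integral_swap, integral_integral, hsh.integral_comp hshe (fun p => (2 * Real.pi : ℂ) ^ n *
      ((starRingEnd ℂ (f p.1) * g p.1) * starRingEnd ℂ (starRingEnd ℂ (f p.2) * g p.2))),
      integral_const_mul, integral_prod_mul (fun q => starRingEnd ℂ (f q) * g q)
      (fun q => starRingEnd ℂ (starRingEnd ℂ (f q) * g q)), integral_conj, ← hinner]
  · have hpi : ((2 * Real.pi : ℂ) ^ n) ≠ 0 := by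
      have : (2 * Real.pi : ℂ) ≠ 0 := by
        exact_mod_cast (by positivity : (2 * Real.pi : ℝ) ≠ 0)
      exact pow_ne_zero _ this
    rw [inv_mul_cancel_left₀ hpi, Complex.mul_conj']
    push_cast
    rfl
  · exact (hsh.integrable_comp_emb hshe).2 hRi
  · have := ((hsh.integrable_comp_emb hshe).2 hRi).swap
    exact this

end

section

/-! ### The fidelity of one branch of a protocol -/

variable {n : ℕ}

/-- The Gaussian density of one amplitude. -/
def modeDensity (l : ℝ) (α : ℂ) : ℝ := l / Real.pi * Real.exp (-l * ‖α‖ ^ 2)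

/-- The integrand of `modeKernel`. -/
def modeIntegrand (l : ℝ) (A : Mode →L[ℂ] Mode) (x : ((ℝ × ℝ) × (ℝ × ℝ)) × ℂ) : ℂ :=
  (modeDensity l x.2 : ℂ) *
    (Complex.exp (-((Real.sqrt 2 * (x.1.1.1 * x.2.re + x.1.1.2 * x.2.im) : ℝ) : ℂ) * Complex.I) *
      inner ℂ (A (coherentMode x.2)) (weylMode x.1.2 (A (coherentMode x.2))))

theorem modeKernel_eq_integral (l : ℝ) (A : Mode →L[ℂ] Mode) (p : (ℝ × ℝ) × (ℝ × ℝ)) :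
    modeKernel l A p = ∫ α, modeIntegrand l A (p, α) := rfl

theorem continuous_modeIntegrand (l : ℝ) (A : Mode →L[ℂ] Mode) : Continuous (modeIntegrand l A) :=
  continuous_modeKernel_integrand l A

theorem norm_modeIntegrand_le {l : ℝ} (hl : 0 < l) (A : Mode →L[ℂ] Mode)
    (x : ((ℝ × ℝ) × (ℝ × ℝ)) × ℂ) : ‖modeIntegrand l A x‖ ≤ modeDensity l x.2 * ‖A‖ ^ 2 :=
  norm_modeKernel_integrand_le hl A _ x.1.2 x.2

theorem integrable_modeDensity {l : ℝ} (hl : 0 < l) : Integrable (modeDensity l) :=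
  (integrable_exp_neg_mul_norm_sq hl).const_mul _

theorem modeDensity_nonneg {l : ℝ} (hl : 0 < l) (α : ℂ) : 0 ≤ modeDensity l α := by
  have := Real.pi_pos
  unfold modeDensity
  positivity

theorem integral_modeDensity {l : ℝ} (hl : 0 < l) : ∫ α, modeDensity l α = 1 := by
  have := Real.pi_pos
  unfold modeDensity
  rw [integral_const_mul, integral_exp_neg_mul_norm_sq hl]
  field_simp

theorem prod_modeDensity (l : ℝ) (α : Fin n → ℂ) :
    ∏ j, modeDensity l (α j) = (l / Real.pi) ^ n * Real.exp (-l * ∑ j, ‖α j‖ ^ 2) := by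
  simp only [modeDensity, Finset.prod_mul_distrib, ← Real.exp_sum, Finset.mul_sum]
  simp [div_pow]

theorem modeIntegrand_zero (l : ℝ) (A : Mode →L[ℂ] Mode) (α : ℂ) :
    modeIntegrand l A (0, α) = ((modeDensity l α * ‖A (coherentMode α)‖ ^ 2 : ℝ) : ℂ) := by
  have h : weylMode 0 (A (coherentMode α)) = A (coherentMode α) := by
    have := weylMode_weylMode 0 0 (A (coherentMode α))
    simp only [sympl, Prod.fst_zero, zero_mul, sub_zero, neg_zero, zero_div,
      Complex.ofReal_zero, Complex.exp_zero, one_smul, add_zero] at this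
    exact (weylMode 0).injective this
  simp only [modeIntegrand, Prod.fst_zero, Prod.snd_zero, h]
  rw [inner_self_eq_norm_sq_to_K]
  simp

theorem norm_coherent (α : Fin n → ℂ) : ‖coherent α‖ = 1 := by
  simp [coherent, norm_tensor, norm_coherentMode]

theorem continuous_coherent : Continuous (coherent : (Fin n → ℂ) → Modes n) := by
  refine continuous_of_norm_eq_of_inner norm_coherent fun α₀ => ?_
  refine Continuous.continuousAt ?_
  simp only [coherent, inner_tensor]
  refine continuous_finsetProd _ fun j _ => ?_
  exact continuous_const.inner (continuous_coherentMode.comp (continuous_apply j))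

/-- The position and momentum of party `j` before and after the transformation `S⁻ᵀ`. -/
def phasePoint (S : Matrix (Fin 2 × Fin n) (Fin 2 × Fin n) ℝ) (j : Fin n) :
    (Fin 2 × Fin n → ℝ) →+ (ℝ × ℝ) × (ℝ × ℝ) where
  toFun ξ := ((ξ (0, j), ξ (1, j)), (((S⁻¹)ᵀ *ᵥ ξ) (0, j), ((S⁻¹)ᵀ *ᵥ ξ) (1, j)))
  map_zero' := by simp
  map_add' ξ η := by simp [Matrix.mulVec_add]

theorem continuous_phasePoint (S : Matrix (Fin 2 × Fin n) (Fin 2 × Fin n) ℝ) (j : Fin n) :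
    Continuous (phasePoint S j) := by
  have : Continuous fun ξ : Fin 2 × Fin n → ℝ => (S⁻¹)ᵀ *ᵥ ξ := by fun_prop
  change Continuous fun ξ : Fin 2 × Fin n → ℝ =>
    ((ξ (0, j), ξ (1, j)), (((S⁻¹)ᵀ *ᵥ ξ) (0, j), ((S⁻¹)ᵀ *ᵥ ξ) (1, j)))
  fun_prop

section Branch

variable {S : Matrix (Fin 2 × Fin n) (Fin 2 × Fin n) ℝ} {U : Modes n ≃ₗᵢ[ℂ] Modes n}
  {A : Fin n → (Mode →L[ℂ] Mode)} {K : Modes n →L[ℂ] Modes n}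

/-- Apply `norm_inner_coherent_sq` to U⁻¹K|α⟩. Conjugation by U turns W(ξ) into W(S⁻ᵀξ) acting on
K|α⟩, where everything is a product over the modes. -/
theorem prod_modeDensity_mul_norm_inner_sq (hS : IsSymplectic S) (hU : IsGaussianUnitary S U)
    (hK : IsTensorOp A K) (l : ℝ) (α : Fin n → ℂ) :
    (((∏ j, modeDensity l (α j)) * ‖inner ℂ (K (coherent α)) (U (coherent α))‖ ^ 2 : ℝ) : ℂ) =
      ((2 * Real.pi) ^ n : ℂ)⁻¹ * ∫ ξ : Fin 2 × Fin n → ℝ,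
        (Real.exp (-∑ k, 1 / 4 * ξ k ^ 2) : ℂ) *
          ∏ j, modeIntegrand l (A j) (phasePoint S j ξ, α j) := by
  have h1 : inner ℂ (K (coherent α)) (U (coherent α)) =
      inner ℂ (U.symm (K (coherent α))) (coherent α) := by
    conv_rhs => rw [← U.inner_map_map, U.apply_symm_apply]
  rw [Complex.ofReal_mul, h1, norm_inner_coherent_sq, mul_left_comm, ← integral_const_mul]
  congr 1
  refine integral_congr_ae (Filter.Eventually.of_forall fun ξ => ?_)
  have h2 : inner ℂ (U.symm (K (coherent α))) (weyl ξ (U.symm (K (coherent α)))) =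
      ∏ j, inner ℂ (A j (coherentMode (α j))) (weylMode (phasePoint S j ξ).2
        (A j (coherentMode (α j)))) := by
    have h3 : Sᵀ *ᵥ ((S⁻¹)ᵀ *ᵥ ξ) = ξ := by
      rw [Matrix.mulVec_mulVec, ← Matrix.transpose_mul, Matrix.nonsing_inv_mul _ hS.isUnit_det,
        Matrix.transpose_one, Matrix.one_mulVec]
    have h4 := hU.conj_weyl ((S⁻¹)ᵀ *ᵥ ξ) (K (coherent α))
    rw [h3] at h4
    rw [← U.inner_map_map, U.apply_symm_apply, h4, coherent, hK, weyl_tensor, inner_tensor]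
    rfl
  simp only []
  rw [h2]
  simp only [modeIntegrand, Finset.prod_mul_distrib]
  rw [mul_left_comm]
  congr 1
  push_cast
  congr 2
  rw [← Complex.exp_sum]
  congr 1
  rw [neg_mul, Finset.mul_sum, Finset.sum_mul, ← Finset.sum_neg_distrib]
  refine Finset.sum_congr rfl fun j _ => ?_
  simp only [phasePoint, AddMonoidHom.coe_mk, ZeroHom.coe_mk, neg_mul]

theorem integral_norm_inner_sq (hS : IsSymplectic S) (hU : IsGaussianUnitary S U)
    (hK : IsTensorOp A K) {l : ℝ} (hl : 0 < l) :
    ((∫ α : Fin n → ℂ, (∏ j, modeDensity l (α j)) *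
      ‖inner ℂ (K (coherent α)) (U (coherent α))‖ ^ 2 : ℝ) : ℂ) =
      ((2 * Real.pi) ^ n : ℂ)⁻¹ * ∫ ξ : Fin 2 × Fin n → ℝ,
        (Real.exp (-∑ k, 1 / 4 * ξ k ^ 2) : ℂ) * ∏ j, modeKernel l (A j) (phasePoint S j ξ) := by
  rw [← integral_complex_ofReal]
  simp only [prod_modeDensity_mul_norm_inner_sq hS hU hK]
  rw [integral_const_mul, integral_integral_swap]
  · congr 1
    refine integral_congr_ae (Filter.Eventually.of_forall fun ξ => ?_)
    simp only []
    rw [integral_const_mul, integral_fintype_prod_volume_eq_prod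
      (f := fun j α => modeIntegrand l (A j) (phasePoint S j ξ, α))]
    rfl
  · have h1 : Integrable fun α : Fin n → ℂ => ∏ j, modeDensity l (α j) * ‖A j‖ ^ 2 :=
      Integrable.fintype_prod (f := fun j α => modeDensity l α * ‖A j‖ ^ 2)
        fun j => (integrable_modeDensity hl).mul_const _
    have h2 := h1.mul_prod (integrable_gauss (ι := Fin 2 × Fin n) (c := fun _ => 1 / 4)
      (fun _ => by norm_num))
    refine h2.mono' ?_ (Filter.Eventually.of_forall fun p => ?_)
    · refine Continuous.aestronglyMeasurable ?_
      simp only [Function.uncurry_def]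
      refine Continuous.mul (by fun_prop) (continuous_finsetProd _ fun j _ => ?_)
      have h3 : Continuous fun p : (Fin n → ℂ) × (Fin 2 × Fin n → ℝ) =>
          (phasePoint S j p.2, p.1 j) := by
        have := continuous_phasePoint S j
        fun_prop
      exact (continuous_modeIntegrand l (A j)).comp h3
    · simp only [Function.uncurry_def]
      rw [norm_mul, norm_prod, Complex.norm_real, Real.norm_eq_abs, Real.abs_exp, mul_comm]
      refine mul_le_mul_of_nonneg_right ?_ (Real.exp_pos _).le
      exact Finset.prod_le_prod (fun _ _ => norm_nonneg _)
        fun j _ => norm_modeIntegrand_le hl (A j) (phasePoint S j p.2, p.1 j)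

theorem matForm_omegaJ (J : Finset (Fin n)) (x y : Fin 2 × Fin n → ℝ) :
    matForm (omegaJ J) x y = ∑ j, (if j ∈ J then sympl (x (0, j), x (1, j)) (y (0, j), y (1, j))
      else -sympl (x (0, j), x (1, j)) (y (0, j), y (1, j))) := by
  simp only [matForm, dotProduct, Matrix.mulVec, Fintype.sum_prod_type, Fin.sum_univ_two, omegaJ,
    Matrix.blockDiagonal_apply]
  rw [← Finset.sum_add_distrib]
  refine Finset.sum_congr rfl fun j _ => ?_
  simp only [ite_mul, zero_mul, Finset.sum_ite_eq, Finset.mem_univ, if_true]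
  by_cases h : j ∈ J
  · simp [h, sympl]; ring
  · simp [h, sympl]; ring

theorem matForm_twistMatrix (l : ℝ) (J : Finset (Fin n)) (x y : Fin 2 × Fin n → ℝ) :
    matForm (twistMatrix l S J) x y = ∑ j, (if j ∈ J then
      sympl (phasePoint S j x).2 (phasePoint S j y).2 -
        sympl (phasePoint S j x).1 (phasePoint S j y).1 / (1 + l)
      else -(sympl (phasePoint S j x).2 (phasePoint S j y).2 -
        sympl (phasePoint S j x).1 (phasePoint S j y).1 / (1 + l))) := by
  have h1 : matForm (twistMatrix l S J) x y =
      matForm (omegaJ J) ((S⁻¹)ᵀ *ᵥ x) ((S⁻¹)ᵀ *ᵥ y) - (1 + l)⁻¹ * matForm (omegaJ J) x y := by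
    simp only [matForm, twistMatrix, Matrix.sub_mulVec, dotProduct_sub, Matrix.smul_mulVec,
      dotProduct_smul, smul_eq_mul]
    rw [Matrix.mul_assoc, ← Matrix.mulVec_mulVec, ← Matrix.mulVec_mulVec, Matrix.dotProduct_mulVec,
      Matrix.mulVec_transpose, Matrix.mulVec_transpose]
  rw [h1, matForm_omegaJ, matForm_omegaJ, Finset.mul_sum, ← Finset.sum_sub_distrib]
  refine Finset.sum_congr rfl fun j _ => ?_
  by_cases h : j ∈ J
  · simp only [h, if_true, phasePoint, AddMonoidHom.coe_mk, ZeroHom.coe_mk]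
    ring
  · simp only [h, if_false, phasePoint, AddMonoidHom.coe_mk, ZeroHom.coe_mk]
    ring

/-- Where locality enters: because the kernel is a product over the modes, the twist may be reversed
separately in the modes outside J. -/
theorem isTwistedPosDef_prod_modeKernel {l : ℝ} (hl : 0 < l) (A : Fin n → (Mode →L[ℂ] Mode))
    (J : Finset (Fin n)) :
    IsTwistedPosDef (matForm (twistMatrix l S J)) (fun ξ => ∏ j,
      ((Real.exp ((ξ (0, j) ^ 2 + ξ (1, j) ^ 2) / (4 * (1 + l))) : ℂ) *
        modeKernel l (A j) (phasePoint S j ξ))) := by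
  have h : ∀ j ∈ Finset.univ, IsTwistedPosDef (fun x y : Fin 2 × Fin n → ℝ => if j ∈ J then
      sympl (phasePoint S j x).2 (phasePoint S j y).2 -
        sympl (phasePoint S j x).1 (phasePoint S j y).1 / (1 + l)
      else -(sympl (phasePoint S j x).2 (phasePoint S j y).2 -
        sympl (phasePoint S j x).1 (phasePoint S j y).1 / (1 + l)))
      (fun ξ => (Real.exp ((ξ (0, j) ^ 2 + ξ (1, j) ^ 2) / (4 * (1 + l))) : ℂ) *
        modeKernel l (A j) (phasePoint S j ξ)) := by
    intro j _
    have h0 := isTwistedPosDef_modeKernel hl (A j)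
    by_cases hj : j ∈ J
    · simp only [hj, if_true]
      exact h0.comp (phasePoint S j)
    · simp only [hj, if_false]
      refine IsTwistedPosDef.comp (h0.neg_twist (fun x y => ?_) (fun x y => ?_)) (phasePoint S j)
      · simp only [sympl]; ring
      · simp only [sympl, Prod.fst_neg, Prod.snd_neg]; ring
  have h1 := IsTwistedPosDef.prod Finset.univ h
  have h2 : (fun x y : Fin 2 × Fin n → ℝ => ∑ j, (if j ∈ J then
      sympl (phasePoint S j x).2 (phasePoint S j y).2 -
        sympl (phasePoint S j x).1 (phasePoint S j y).1 / (1 + l)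
      else -(sympl (phasePoint S j x).2 (phasePoint S j y).2 -
        sympl (phasePoint S j x).1 (phasePoint S j y).1 / (1 + l)))) =
      matForm (twistMatrix l S J) := by
    funext x y
    rw [matForm_twistMatrix]
  rwa [h2] at h1

/-- The bound for one branch of a protocol. -/
theorem integral_norm_inner_sq_le (hS : IsSymplectic S) (hU : IsGaussianUnitary S U)
    (hK : IsTensorOp A K) {l : ℝ} (hl : 0 < l) (J : Finset (Fin n)) :
    ∫ α : Fin n → ℂ, (∏ j, modeDensity l (α j)) *
      ‖inner ℂ (K (coherent α)) (U (coherent α))‖ ^ 2 ≤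
      bound l S J * ∫ α : Fin n → ℂ, (∏ j, modeDensity l (α j)) * ‖K (coherent α)‖ ^ 2 := by
  set h : (Fin 2 × Fin n → ℝ) → ℂ := fun ξ => ∏ j,
      ((Real.exp ((ξ (0, j) ^ 2 + ξ (1, j) ^ 2) / (4 * (1 + l))) : ℂ) *
        modeKernel l (A j) (phasePoint S j ξ)) with hh
  have hpos : IsTwistedPosDef (matForm (twistMatrix l S J)) h :=
    isTwistedPosDef_prod_modeKernel hl A J
  have hcont : Continuous h := by
    refine continuous_finsetProd _ fun j _ => ?_
    have h1 := (continuous_modeKernel hl (A j)).comp (continuous_phasePoint S j)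
    exact Continuous.mul (by fun_prop) h1
  have hM : ((twistMatrix l S J)ᵀ * twistMatrix l S J).IsHermitian := by
    rw [Matrix.IsHermitian, Matrix.conjTranspose_eq_transpose_of_trivial, Matrix.transpose_mul,
      Matrix.transpose_transpose]
  -- This is 1/4 + 1/(4(1+l)): the width from the coherent overlap plus the compensation for the
  -- exponential factors in h.
  have hc : (0 : ℝ) < (2 + l) / (4 * (1 + l)) := by positivity
  have hbd := hpos.norm_gaussAvg_le_prod hcont (twistMatrix_transpose l J) hM hc
  have hpi := Real.pi_pos
  have hF : ((∫ α : Fin n → ℂ, (∏ j, modeDensity l (α j)) *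
      ‖inner ℂ (K (coherent α)) (U (coherent α))‖ ^ 2 : ℝ) : ℂ) =
      ((2 * Real.pi) ^ n : ℂ)⁻¹ * gaussAvg (fun _ => (2 + l) / (4 * (1 + l))) h := by
    rw [integral_norm_inner_sq hS hU hK hl, gaussAvg]
    congr 1
    refine integral_congr_ae (Filter.Eventually.of_forall fun ξ => ?_)
    simp only [hh, Finset.prod_mul_distrib]
    rw [← mul_assoc]
    congr 1
    rw [← Complex.ofReal_prod, ← Real.exp_sum, ← Complex.ofReal_mul, ← Real.exp_add,
      Fintype.sum_prod_type, Fintype.sum_prod_type, Fin.sum_univ_two, Fin.sum_univ_two,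
      ← Finset.sum_add_distrib, ← Finset.sum_add_distrib, ← Finset.sum_neg_distrib,
      ← Finset.sum_neg_distrib, ← Finset.sum_add_distrib]
    congr 2
    refine Finset.sum_congr rfl fun j _ => ?_
    field_simp
    ring
  -- The value at the origin is the probability of the branch, averaged over the ensemble.
  have h0 : (h 0).re = ∫ α : Fin n → ℂ, (∏ j, modeDensity l (α j)) * ‖K (coherent α)‖ ^ 2 := by
    have h1 : h 0 = ((∏ j, ∫ α, modeDensity l α * ‖A j (coherentMode α)‖ ^ 2 : ℝ) : ℂ) := by
      simp only [hh, map_zero, modeKernel_eq_integral, modeIntegrand_zero, Pi.zero_apply]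
      rw [Complex.ofReal_prod]
      refine Finset.prod_congr rfl fun j _ => ?_
      rw [integral_complex_ofReal]
      simp
    rw [h1, Complex.ofReal_re, ← integral_fintype_prod_volume_eq_prod
      (f := fun j α => modeDensity l α * ‖A j (coherentMode α)‖ ^ 2)]
    refine integral_congr_ae (Filter.Eventually.of_forall fun α => ?_)
    simp only [coherent, hK (fun j => coherentMode (α j)), norm_tensor, Finset.prod_mul_distrib,
      Finset.prod_pow]
  have hle := Complex.re_le_norm ((∫ α : Fin n → ℂ, (∏ j, modeDensity l (α j)) *
      ‖inner ℂ (K (coherent α)) (U (coherent α))‖ ^ 2 : ℝ) : ℂ)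
  rw [Complex.ofReal_re, hF, norm_mul] at hle
  have hn : ‖((2 * Real.pi) ^ n : ℂ)⁻¹‖ = ((2 * Real.pi) ^ n)⁻¹ := by
    rw [norm_inv, norm_pow, norm_mul, Complex.norm_real, Real.norm_of_nonneg hpi.le]
    simp
  refine hle.trans ?_
  rw [hn, ← prod_sqrt_eq_bound hl J hM, ← h0]
  calc _ ≤ ((2 * Real.pi) ^ n)⁻¹ * ((h 0).re * ∏ k, Real.sqrt (Real.pi /
        ((2 + l) / (4 * (1 + l)) + Real.sqrt (hM.eigenvalues k) / 4))) :=
        mul_le_mul_of_nonneg_left hbd (by positivity)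
    _ = _ := by ring

end Branch

end

section

/-! ### The fidelity of a protocol -/

variable {n : ℕ}

/-- Countability permits exchanging the sum over branches with the integral over the ensemble. -/
theorem Protocol.countable_branch {H H' : Fin n → HilbertSpace} (P : Protocol H H') :
    Countable P.Branch := by
  induction P with
  | done H => exact inferInstanceAs (Countable Unit)
  | round M _ next ih =>
    have := ih
    exact inferInstanceAs (Countable (Σ x, (next x).Branch))

/-! ### Decompositions of operators into pure states. -/

section PureState

variable {H : Type} [NormedAddCommGroup H] [InnerProductSpace ℂ H]

theorem hasSum_norm_inner_sq {ι : Type} {v : ι → H} {R : H →L[ℂ] H}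
    (h : HasSum (fun i => pureState (v i)) R) (φ : H) :
    HasSum (fun i => ‖inner ℂ (v i) φ‖ ^ 2) (inner ℂ φ (R φ)).re := by
  have h1 := (ContinuousLinearMap.apply ℂ H φ).hasSum h
  have h2 := Complex.reCLM.hasSum ((innerSL ℂ φ).hasSum h1)
  refine h2.congr_fun fun i => ?_
  simp only [ContinuousLinearMap.apply_apply, innerSL_apply_apply,
    Complex.reCLM_apply, pureState, ContinuousLinearMap.smulRight_apply, inner_smul_right]
  rw [← inner_conj_symm φ (v i), Complex.mul_conj', ← Complex.ofReal_pow, Complex.ofReal_re]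

theorem tsum_ofReal_norm_inner_sq {ι : Type} {v : ι → H} {R : H →L[ℂ] H}
    (h : HasSum (fun i => pureState (v i)) R) (φ : H) :
    ∑' i, ENNReal.ofReal (‖inner ℂ (v i) φ‖ ^ 2) = ENNReal.ofReal (inner ℂ φ (R φ)).re := by
  have h1 := hasSum_norm_inner_sq h φ
  rw [← h1.tsum_eq, ENNReal.ofReal_tsum_of_nonneg (fun _ => by positivity) h1.summable]

theorem norm_pureState (v : H) : ‖pureState v‖ = ‖v‖ ^ 2 := by
  rw [pureState, ContinuousLinearMap.norm_smulRight_apply, innerSL_apply_norm, sq]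

theorem tsum_ofReal_norm_inner_hilbertBasis {ι : Type} (b : HilbertBasis ι ℂ H) (v : H) :
    ∑' m, ENNReal.ofReal (‖inner ℂ v (b m)‖ ^ 2) = ENNReal.ofReal (‖v‖ ^ 2) := by
  have h := Complex.reCLM.hasSum (b.hasSum_inner_mul_inner v v)
  have h1 : HasSum (fun m => ‖inner ℂ v (b m)‖ ^ 2) (‖v‖ ^ 2) := by
    rw [inner_self_eq_norm_sq_to_K] at h
    have h2 : Complex.reCLM (((‖v‖ : ℝ) : ℂ) ^ 2) = ‖v‖ ^ 2 := by
      rw [← Complex.ofReal_pow, Complex.reCLM_apply, Complex.ofReal_re]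
    refine (h2 ▸ h).congr_fun fun m => ?_
    rw [← inner_conj_symm (b m) v, Complex.mul_conj', ← Complex.ofReal_pow,
      Complex.reCLM_apply, Complex.ofReal_re]
  rw [← h1.tsum_eq, ENNReal.ofReal_tsum_of_nonneg (fun _ => by positivity) h1.summable]

variable [CompleteSpace H]

/-- Two decompositions of an operator into pure states have the same trace. -/
theorem tsum_norm_sq_eq {ι κ : Type} {v : ι → H} {w : κ → H} {R : H →L[ℂ] H}
    (hv : HasSum (fun i => pureState (v i)) R) (hw : HasSum (fun k => pureState (w k)) R) :
    ∑' i, ENNReal.ofReal (‖v i‖ ^ 2) = ∑' k, ENNReal.ofReal (‖w k‖ ^ 2) := by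
  -- In either decomposition the squared overlaps with b_m sum to ⟨b_m, R b_m⟩; summing over the
  -- basis in `ℝ≥0∞` needs no summability argument.
  obtain ⟨s, b, -⟩ := exists_hilbertBasis ℂ H
  simp only [← tsum_ofReal_norm_inner_hilbertBasis b]
  rw [ENNReal.tsum_comm, ENNReal.tsum_comm (α := κ)]
  simp only [tsum_ofReal_norm_inner_sq hv, tsum_ofReal_norm_inner_sq hw]

theorem Channel.hasSum_apply (L : Channel H) (ψ : H) :
    HasSum (fun i => pureState (L.kraus i ψ)) (L.apply (pureState ψ)) := by
  have h : ∀ i, (L.kraus i).comp ((pureState ψ).comp (ContinuousLinearMap.adjoint (L.kraus i))) =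
      pureState (L.kraus i ψ) := by
    intro i
    ext x
    simp [pureState, ContinuousLinearMap.adjoint_inner_right]
  unfold Channel.apply
  simp only [h]
  refine Summable.hasSum (Summable.of_norm ?_)
  simp only [norm_pureState]
  exact (L.complete ψ).summable

/-- Trace preservation is assumed for the Kraus operators of the channel. Independence of the trace
from the decomposition transfers it to the branches of a protocol. -/
theorem Channel.tsum_norm_sq_eq (L : Channel H) {ι : Type} {ψ : H} {v : ι → H}
    (hv : HasSum (fun i => pureState (v i)) (L.apply (pureState ψ))) :
    ∑' i, ENNReal.ofReal (‖v i‖ ^ 2) = ENNReal.ofReal (‖ψ‖ ^ 2) := by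
  rw [GaussLOCC.tsum_norm_sq_eq hv (L.hasSum_apply ψ), ← (L.complete ψ).tsum_eq,
    ENNReal.ofReal_tsum_of_nonneg (fun _ => by positivity) (L.complete ψ).summable]

end PureState

theorem lintegral_gaussianEnsemble {l : ℝ} (hl : 0 < l) {g : (Fin n → ℂ) → ℝ} (hg : Continuous g)
    (hg0 : ∀ α, 0 ≤ g α) {C : ℝ} (hC : ∀ α, g α ≤ C) :
    ∫⁻ α, ENNReal.ofReal (g α) ∂(gaussianEnsemble n l) =
      ENNReal.ofReal (∫ α : Fin n → ℂ, (∏ j, modeDensity l (α j)) * g α) := by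
  have hd : Continuous fun α : Fin n → ℂ => ∏ j, modeDensity l (α j) := by
    unfold modeDensity
    fun_prop
  have hd0 : ∀ α : Fin n → ℂ, 0 ≤ ∏ j, modeDensity l (α j) := fun α =>
    Finset.prod_nonneg fun j _ => modeDensity_nonneg hl _
  have hdi : Integrable fun α : Fin n → ℂ => ∏ j, modeDensity l (α j) :=
    Integrable.fintype_prod (f := fun _ α => modeDensity l α) fun _ => integrable_modeDensity hl
  have hi : Integrable fun α : Fin n → ℂ => (∏ j, modeDensity l (α j)) * g α := by
    refine (hdi.mul_const C).mono' (hd.mul hg).aestronglyMeasurable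
      (Filter.Eventually.of_forall fun α => ?_)
    rw [Real.norm_of_nonneg (mul_nonneg (hd0 α) (hg0 α))]
    exact mul_le_mul_of_nonneg_left (hC α) (hd0 α)
  rw [ofReal_integral_eq_lintegral_ofReal hi
    (Filter.Eventually.of_forall fun α => mul_nonneg (hd0 α) (hg0 α)), gaussianEnsemble]
  simp only [← prod_modeDensity]
  rw [lintegral_withDensity_eq_lintegral_mul _ hd.measurable.ennreal_ofReal
    hg.measurable.ennreal_ofReal]
  refine lintegral_congr fun α => ?_
  rw [Pi.mul_apply, ENNReal.ofReal_mul (hd0 α)]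

theorem gaussianEnsemble_univ {l : ℝ} (hl : 0 < l) : gaussianEnsemble n l Set.univ = 1 := by
  have h := lintegral_gaussianEnsemble (n := n) hl (g := fun _ => 1) continuous_const
    (fun _ => zero_le_one) (fun _ => le_rfl)
  simp only [ENNReal.ofReal_one, lintegral_const, one_mul, mul_one] at h
  rw [h, integral_fintype_prod_volume_eq_prod (f := fun (_ : Fin n) α => modeDensity l α)]
  simp [integral_modeDensity hl]

theorem bound_nonneg {l : ℝ} (hl : 0 < l) (S : Matrix (Fin 2 × Fin n) (Fin 2 × Fin n) ℝ)
    (J : Finset (Fin n)) : 0 ≤ bound l S J := by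
  unfold bound
  positivity

section Fidelity

variable {S : Matrix (Fin 2 × Fin n) (Fin 2 × Fin n) ℝ} {U : Modes n ≃ₗᵢ[ℂ] Modes n}

theorem lintegral_norm_inner_sq_le (hS : IsSymplectic S) (hU : IsGaussianUnitary S U)
    {A : Fin n → (Mode →L[ℂ] Mode)} {K : Modes n →L[ℂ] Modes n}
    (hK : IsTensorOp A K) {l : ℝ} (hl : 0 < l) (J : Finset (Fin n)) :
    ∫⁻ α, ENNReal.ofReal (‖inner ℂ (K (coherent α)) (U (coherent α))‖ ^ 2)
      ∂(gaussianEnsemble n l) ≤ ENNReal.ofReal (bound l S J) *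
      ∫⁻ α, ENNReal.ofReal (‖K (coherent α)‖ ^ 2) ∂(gaussianEnsemble n l) := by
  have hKc : Continuous fun α : Fin n → ℂ => K (coherent α) :=
    K.continuous.comp continuous_coherent
  have hUc : Continuous fun α : Fin n → ℂ => U (coherent α) :=
    U.continuous.comp continuous_coherent
  have hn : ∀ α : Fin n → ℂ, ‖K (coherent α)‖ ≤ ‖K‖ := fun α => by
    simpa [norm_coherent] using K.le_opNorm (coherent α)
  have hc₁ : Continuous fun α : Fin n → ℂ =>
      ‖inner ℂ (K (coherent α)) (U (coherent α))‖ ^ 2 := (hKc.inner hUc).norm.pow 2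
  have hc₂ : Continuous fun α : Fin n → ℂ => ‖K (coherent α)‖ ^ 2 := hKc.norm.pow 2
  rw [lintegral_gaussianEnsemble hl hc₁ (fun _ => by positivity)
    (C := ‖K‖ ^ 2) (fun α => ?_), lintegral_gaussianEnsemble hl hc₂ (fun _ => by positivity)
    (C := ‖K‖ ^ 2) (fun α => ?_),
    ← ENNReal.ofReal_mul (bound_nonneg hl S J)]
  · exact ENNReal.ofReal_le_ofReal (integral_norm_inner_sq_le hS hU hK hl J)
  · gcongr
    exact hn α
  · gcongr
    refine (norm_inner_le_norm _ _).trans ?_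
    rw [LinearIsometryEquiv.norm_map, norm_coherent, mul_one]
    exact hn α

/-- The fidelity of the output of `L` on the coherent state `|α⟩` with `U |α⟩`. -/
def avgFidelityIntegrand (U : Modes n ≃ₗᵢ[ℂ] Modes n) (L : Channel (Modes n)) (α : Fin n → ℂ) :
    ℝ≥0∞ :=
  ENNReal.ofReal (inner ℂ (U (coherent α)) (L.apply (pureState (coherent α)) (U (coherent α)))).re

/-- The branch bounds share one constant and the branch probabilities sum to 1. Measurability is
recorded for the later use of Fatou's lemma. -/
theorem IsImplementedBy.fidelity_le (hS : IsSymplectic S) (hU : IsGaussianUnitary S U)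
    {L : Channel (Modes n)} {P : Protocol (fun _ : Fin n => modeSpace) (fun _ : Fin n => modeSpace)}
    (hL : IsImplementedBy L P) {l : ℝ} (hl : 0 < l) (J : Finset (Fin n)) :
    Measurable (avgFidelityIntegrand U L) ∧
    ∫⁻ α, avgFidelityIntegrand U L α ∂(gaussianEnsemble n l) ≤ ENNReal.ofReal (bound l S J) := by
  obtain ⟨K, hK, hsum⟩ := hL
  have := P.countable_branch
  have heq : avgFidelityIntegrand U L = fun α : Fin n → ℂ =>
      ∑' b, ENNReal.ofReal (‖inner ℂ (K b (coherent α)) (U (coherent α))‖ ^ 2) := by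
    funext α
    rw [tsum_ofReal_norm_inner_sq (hsum (coherent α))]
    rfl
  have hKc : ∀ b, Continuous fun α : Fin n → ℂ => K b (coherent α) := fun b =>
    (K b).continuous.comp continuous_coherent
  have hUc : Continuous fun α : Fin n → ℂ => U (coherent α) :=
    U.continuous.comp continuous_coherent
  have hm : ∀ b, Measurable fun α : Fin n → ℂ =>
      ENNReal.ofReal (‖inner ℂ (K b (coherent α)) (U (coherent α))‖ ^ 2) := fun b =>
    ((((hKc b).inner hUc).norm.pow 2).measurable).ennreal_ofReal
  have hm' : ∀ b, Measurable fun α : Fin n → ℂ => ENNReal.ofReal (‖K b (coherent α)‖ ^ 2) :=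
    fun b => (((hKc b).norm.pow 2).measurable).ennreal_ofReal
  rw [heq]
  refine ⟨Measurable.tsum hm, ?_⟩
  rw [lintegral_tsum fun b => (hm b).aemeasurable]
  calc _ ≤ ∑' b, ENNReal.ofReal (bound l S J) *
        ∫⁻ α, ENNReal.ofReal (‖K b (coherent α)‖ ^ 2) ∂(gaussianEnsemble n l) :=
        ENNReal.tsum_le_tsum fun b => lintegral_norm_inner_sq_le hS hU (hK b) hl J
    _ = ENNReal.ofReal (bound l S J) *
        ∫⁻ α, ∑' b, ENNReal.ofReal (‖K b (coherent α)‖ ^ 2) ∂(gaussianEnsemble n l) := by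
        rw [ENNReal.tsum_mul_left, lintegral_tsum fun b => (hm' b).aemeasurable]
    _ = ENNReal.ofReal (bound l S J) := by
        simp only [fun α : Fin n → ℂ => L.tsum_norm_sq_eq (hsum (coherent α)), norm_coherent,
          one_pow, ENNReal.ofReal_one, lintegral_const, gaussianEnsemble_univ hl, mul_one]

/-- The fidelity integrands converge pointwise in α, and Fatou's lemma carries the uniform upper
bound to the limit. -/
theorem IsLOCC.fidelity_le (hS : IsSymplectic S) (hU : IsGaussianUnitary S U)
    {L : Channel (Modes n)} (hL : IsLOCC L) {l : ℝ} (hl : 0 < l) (J : Finset (Fin n)) :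
    ∫⁻ α, avgFidelityIntegrand U L α ∂(gaussianEnsemble n l) ≤ ENNReal.ofReal (bound l S J) := by
  obtain ⟨P, Lm, hLm, hlim⟩ := hL
  have ht : ∀ α, Filter.Tendsto (fun m => avgFidelityIntegrand U (Lm m) α) Filter.atTop
      (nhds (avgFidelityIntegrand U L α)) := fun α =>
    (ENNReal.continuous_ofReal.tendsto _).comp ((Complex.continuous_re.tendsto _).comp
      (hlim (U (coherent α)) (coherent α)))
  calc _ = ∫⁻ α, Filter.liminf (fun m => avgFidelityIntegrand U (Lm m) α) Filter.atTop
        ∂(gaussianEnsemble n l) := lintegral_congr fun α => (ht α).liminf_eq.symm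
    _ ≤ Filter.liminf (fun m => ∫⁻ α, avgFidelityIntegrand U (Lm m) α ∂(gaussianEnsemble n l))
        Filter.atTop := lintegral_liminf_le fun m => ((hLm m).fidelity_le hS hU hl J).1
    _ ≤ Filter.liminf (fun _ : ℕ => ENNReal.ofReal (bound l S J)) Filter.atTop :=
        Filter.liminf_le_liminf (Filter.Eventually.of_forall fun m =>
          ((hLm m).fidelity_le hS hU hl J).2)
    _ = _ := Filter.liminf_const _

theorem simulationFidelity_le (hS : IsSymplectic S) (hU : IsGaussianUnitary S U) {l : ℝ}
    (hl : 0 < l) :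
    simulationFidelity (gaussianEnsemble n l) coherent U ≤
      ENNReal.ofReal (⨅ J : Finset (Fin n), bound l S J) := by
  obtain ⟨J, hJ⟩ := exists_eq_ciInf_of_finite (f := fun J : Finset (Fin n) => bound l S J)
  rw [← hJ]
  exact iSup₂_le fun L hL => hL.fidelity_le hS hU hl J

end Fidelity

end

end GaussLOCC

end

theorem theorem2 (n : ℕ) (S : Matrix (Fin 2 × Fin n) (Fin 2 × Fin n) ℝ)
    (hS : GaussLOCC.IsSymplectic S)
    (U : GaussLOCC.Modes n ≃ₗᵢ[ℂ] GaussLOCC.Modes n) (hU : GaussLOCC.IsGaussianUnitary S U)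
    (l : ℝ) (hl : 0 < l) :
    GaussLOCC.simulationFidelity (GaussLOCC.gaussianEnsemble n l) GaussLOCC.coherent U ≤
        ENNReal.ofReal (⨅ J : Finset (Fin n), GaussLOCC.bound l S J) ∧
      (2 ≤ n →
        (⨅ J : Finset (Fin n), GaussLOCC.bound l S J) =
          (⨅ J : {J : Finset (Fin n) // 1 ≤ J.card ∧ J.card ≤ n / 2},
            GaussLOCC.bound l S J.1)) :=
  ⟨GaussLOCC.simulationFidelity_le hS hU hl, fun hn => hS.iInf_bound_eq hl hn⟩
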